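/- **Setting.** Let $V\neq\{0\}$ be a finite-dimensional real Euclidean space of dimension $n$ with inner product $(\cdot|\cdot)$, and let $\Omega\subset V$ be an irreducible symmetric cone (an open convex cone that is self-dual, on which its group $G(\Omega)$ of linear automorphisms acts transitively, and which does not split as a sum along a direct sum decomposition of $V$ into two nonzero subspaces). Let $V$ carry the structure of a Euclidean Jordan algebra with identity ${\bf e}$ for which $\overline\Omega=\{x^2: x\in V\}$ and $(x|y)=\operatorname{tr}(xy)$. If $x=\sum_i\lambda_ic_i$ along a Jordan frame $(c_i)$, then $\operatorname{tr}x=\sum_i\lambda_i$ and $\Delta(x)=\det x=\prod_i\lambda_i$. Let $d$ be the distance on $\Omega$ of the invariant Riemannian metric $\langle v,w\rangle_y=(g^{-1}v|g^{-1}w)$, where $y=g{\bf e}$ with $g\in G(\Omega)$ (the metric does not depend on the choice of $g$), and let $B_\rho(\xi)=\{\eta\in\Omega: d(\xi,\eta)<\rho\}$. Let $(\xi_j)_{j\in\mathbb N}$ be a $(\frac12,2)$-lattice in $\Omega$: the balls $B_{1/2}(\xi_j)$ are pairwise disjoint and the balls $B_1(\xi_j)$ cover $\Omega$. Choose $g_j\in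 G(\Omega)$ with $g_j{\bf e}=\xi_j$ and a real $\phi_0\in C_c^\infty(V)$ with $\operatorname{supp}\phi_0\subset B_2({\bf e})$, $0\le\phi_0\le1$ and $\phi_0=1$ on $B_1({\bf e})$. Put $\phi_j=\phi_0(g_j^{-1}\,\cdot\,)$ and $\hat\psi_j=\phi_j/\sum_k\phi_k$ on $\Omega$, $\hat\psi_j=0$ off $\Omega$. The Fourier transform is $\hat f(\xi)=(2\pi)^{-n}\int_V e^{-i(x|\xi)}f(x)\,dx$, extended to tempered distributions, and $f*\psi_j$ denotes the function with Fourier transform $\hat f\,\hat\psi_j$. Functions are complex-valued. Let $\mathcal D_\Omega$ be the set of Schwartz functions $f$ on $V$ whose Fourier transform has compact support contained in $\Omega$; for $f\in\mathcal D_\Omega$ put $$\|f\|_{B^{p,s}_\mu}=\Bigl[\sum_j\Delta(\xi_j)^{-\mu}\|f*\psi_j\|_p^s\Bigr]^{1/s},\qquad \mathcal L f(x+iy)=\int_\Omega e^{i(x+iy|\xi)}\hat f(\xi)\,d\xi\quad(x\in V,\ y\in\Omega).$$ **Proposition.** Let $1\le p,s<\infty$ and $\mu>0$. The following are equivalent.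 1. There exist $\delta>0$ and $C_\delta>0$ such that $$\Bigl\|\sum_jf_j\Bigr\|_p\le C_\delta\Bigl[\sum_j\Delta(\xi_j)^{-\mu}e^{\delta(\xi_j|{\bf e})}\|f_j\|_p^s\Bigr]^{1/s}$$ for every finite sequence $\{f_j\}$ in $L^p(V)$ with $\operatorname{supp}\hat f_j\subset B_2(\xi_j)$. 2. There exists $C>0$ such that $$\Bigl\|\sum_jf_j\Bigr\|_p\le C\Bigl[\sum_j\Delta(\xi_j)^{-\mu}\|f_j\|_p^s\Bigr]^{1/s}$$ for every finite sequence $\{f_j\}$ in $L^p(V)$ with $\operatorname{supp}\hat f_j\subset B_2(\xi_j)\cap H_0$, where $H_0=\{\xi:\frac12<({\bf e}|\xi)<2\}$. 3. There exists $C>0$ such that $$\|\mathcal Lf(\cdot+iy)\|_p\le C\,\Delta(y)^{-\mu/s}\,\|f\|_{B^{p,s}_\mu}\qquad\text{for all } f\in\mathcal D_\Omega\text{ and all }y\in\Omega.$$ -/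

import Mathlib

open MeasureTheory SchwartzMap Distribution Set
open scoped ENNReal FourierTransform RealInnerProductSpace ContDiff Pointwise

noncomputable section

namespace ConeLP

/-! ## Euclidean Jordan algebras -/

section Jordan

variable (V : Type*) [NormedAddCommGroup V] [InnerProductSpace ℝ V]

/-- A Euclidean Jordan algebra structure on the Euclidean space `V`: a commutative bilinear product
with identity `e` that satisfies the Jordan identity and for which the multiplication operators
are symmetric with respect to the inner product of `V`. -/
structure EuclideanJordanAlgebra where
  mul : V →ₗ[ℝ] V →ₗ[ℝ] V
  e : V
  mul_comm : ∀ x y, mul x y = mul y x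
  jordan : ∀ x y, mul x (mul (mul x x) y) = mul (mul x x) (mul x y)
  e_mul : ∀ x, mul e x = x
  inner_mul : ∀ x u v, ⟪mul x u, v⟫ = ⟪u, mul x v⟫

variable {V}

namespace EuclideanJordanAlgebra

variable (J : EuclideanJordanAlgebra V)

def IsIdempotent (c : V) : Prop := J.mul c c = c

/-- A nonzero idempotent that is not a sum of two nonzero idempotents. -/
def IsPrimitive (c : V) : Prop :=
  J.IsIdempotent c ∧ c ≠ 0 ∧
    ∀ a b, J.IsIdempotent a → J.IsIdempotent b → c = a + b → a = 0 ∨ b = 0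

/-- A Jordan frame: a complete system of orthogonal primitive idempotents. -/
structure IsJordanFrame {r : ℕ} (c : Fin r → V) : Prop where
  primitive : ∀ i, J.IsPrimitive (c i)
  orthogonal : ∀ i j, i ≠ j → J.mul (c i) (c j) = 0
  sum_eq : ∑ i, c i = J.e

/-- `m` is the multiset of the coefficients `lam 1, …, lam r` in a spectral decomposition
`x = ∑ i, lam i • c i` of `x` along some Jordan frame `c`. By the spectral theorem every `x` has
exactly one such multiset. -/
def IsSpectrum (x : V) (m : Multiset ℝ) : Prop :=
  ∃ (r : ℕ) (c : Fin r → V) (lam : Fin r → ℝ),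
    J.IsJordanFrame c ∧ x = ∑ i, lam i • c i ∧ m = Finset.univ.val.map lam

/-- The eigenvalues of `x`, with multiplicity. -/
def eigenvalues (x : V) : Multiset ℝ := Classical.epsilon (J.IsSpectrum x)

/-- The trace of `x`: the sum of its eigenvalues. -/
def tr (x : V) : ℝ := (J.eigenvalues x).sum

/-- The determinant `Δ(x)` of `x`: the product of its eigenvalues. -/
def det (x : V) : ℝ := (J.eigenvalues x).prod

end EuclideanJordanAlgebra

/-! ## Symmetric cones -/

/-- The group of linear automorphisms of the cone (as a set of linear bijections). -/
def coneAut (Ω : Set V) : Set (V ≃L[ℝ] V) := {g | g '' Ω = Ω}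

/-- A homogeneous self-dual open convex cone. -/
structure IsSymmetricCone (Ω : Set V) : Prop where
  isOpen : IsOpen Ω
  convex : Convex ℝ Ω
  smul_mem : ∀ t : ℝ, 0 < t → ∀ x ∈ Ω, t • x ∈ Ω
  selfDual : Ω = {x | ∀ y ∈ closure Ω, y ≠ 0 → 0 < ⟪x, y⟫}
  homogeneous : ∀ x ∈ Ω, ∀ y ∈ Ω, ∃ g ∈ coneAut Ω, g x = y

/-- `Ω` does not split as a sum `Ω₁ + Ω₂` along a direct sum decomposition of the space into two
nonzero subspaces. -/
def IsIrreducibleCone (Ω : Set V) : Prop :=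
  ∀ (V₁ V₂ : Submodule ℝ V) (Ω₁ Ω₂ : Set V), IsCompl V₁ V₂ → Ω₁ ⊆ V₁ → Ω₂ ⊆ V₂ →
    Ω = Ω₁ + Ω₂ → V₁ = ⊥ ∨ V₂ = ⊥

variable (V)

/-- An irreducible symmetric cone `Ω` in the Euclidean space `V`, together with the Euclidean Jordan
algebra structure of `V` for which the closure of `Ω` is the set of squares; the inner product is
normalized as `(x|y) = tr (xy)`. -/
structure JordanCone extends EuclideanJordanAlgebra V where
  Ω : Set V
  isSymmetricCone : IsSymmetricCone Ω
  isIrreducible : IsIrreducibleCone Ω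
  closure_eq_squares : closure Ω = range fun x => mul x x
  inner_eq_tr : ∀ x y, ⟪x, y⟫ = toEuclideanJordanAlgebra.tr (mul x y)

variable {V}

namespace JordanCone

variable (𝒞 : JordanCone V)

/-! ## The invariant distance, balls and lattices -/

open Classical in
/-- The norm of the tangent vector `v` at `y` for the invariant Riemannian metric
`⟨v, w⟩_y = (g⁻¹ v | g⁻¹ w)`, where `y = g e` with `g` an automorphism of the cone. The stabilizer
of `e` consists of isometries, so the choice of `g` does not matter. -/
def tangentNorm (y v : V) : ℝ :=
  if h : ∃ g ∈ coneAut 𝒞.Ω, g 𝒞.e = y then ‖h.choose.symm v‖ else 0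

/-- The invariant Riemannian distance on the cone: the infimum of the lengths of `C¹` curves in the
cone from `x` to `y`. -/
def dist (x y : V) : ℝ :=
  sInf {L | ∃ γ : ℝ → V, ContDiff ℝ 1 γ ∧ (∀ t ∈ Icc (0 : ℝ) 1, γ t ∈ 𝒞.Ω) ∧ γ 0 = x ∧ γ 1 = y ∧
    L = ∫ t in (0 : ℝ)..1, 𝒞.tangentNorm (γ t) (deriv γ t)}

/-- The open invariant ball `B_δ(x)` in the cone. -/
def ball (δ : ℝ) (x : V) : Set V := {y ∈ 𝒞.Ω | 𝒞.dist x y < δ}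

/-- A `(δ, R)`-lattice of the cone. -/
structure IsLattice (δ R : ℝ) (ξ : ℕ → V) : Prop where
  mem : ∀ j, ξ j ∈ 𝒞.Ω
  disjoint : ∀ j k, j ≠ k → Disjoint (𝒞.ball δ (ξ j)) (𝒞.ball δ (ξ k))
  cover : 𝒞.Ω ⊆ ⋃ j, 𝒞.ball (R * δ) (ξ j)

end JordanCone

end Jordan

/-! ## The Fourier transform -/

section Fourier

variable {V : Type*} [NormedAddCommGroup V] [InnerProductSpace ℝ V] [FiniteDimensional ℝ V]
  [MeasurableSpace V] [BorelSpace V]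

variable (V) in
/-- The dilation by `(2π)⁻¹`. -/
def dil : V ≃L[ℝ] V :=
  ContinuousLinearEquiv.smulLeft (Units.mk0 (2 * Real.pi)⁻¹ (by positivity))

variable (V) in
/-- The Fourier transform on Schwartz functions with the normalization
`(2π)⁻ⁿ ∫ exp (-i (x|ξ)) f(x) dx`, see `fourierHat_apply`. -/
def fourierHat : 𝓢(V, ℂ) →L[ℂ] 𝓢(V, ℂ) :=
  (((2 * Real.pi : ℝ) : ℂ) ^ Module.finrank ℝ V)⁻¹ •
    ((SchwartzMap.compCLMOfContinuousLinearEquiv ℂ (dil V)).comp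
      (FourierTransform.fourierCLM ℂ 𝓢(V, ℂ)))

theorem fourierHat_apply (f : 𝓢(V, ℂ)) (ξ : V) :
    fourierHat V f ξ = (((2 * Real.pi : ℝ) : ℂ) ^ Module.finrank ℝ V)⁻¹ *
      ∫ x, Complex.exp (-(Complex.I * (⟪x, ξ⟫ : ℝ))) * f x := by
  have h : fourierHat V f ξ = (((2 * Real.pi : ℝ) : ℂ) ^ Module.finrank ℝ V)⁻¹ *
      (𝓕 f) ((2 * Real.pi)⁻¹ • ξ) := rfl
  rw [h, SchwartzMap.fourier_coe, Real.fourier_eq']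
  congr 1
  refine integral_congr_ae (Filter.Eventually.of_forall fun x => ?_)
  have hpi : (2 * Real.pi : ℝ) ≠ 0 := by positivity
  have h2 : -2 * Real.pi * ⟪x, (2 * Real.pi)⁻¹ • ξ⟫ = -⟪x, ξ⟫ := by
    rw [inner_smul_right]
    field_simp
  simp only [h2, smul_eq_mul]
  congr 2
  push_cast
  ring

/-- The Fourier transform of a tempered distribution, `⟨T^, φ⟩ = ⟨T, φ^⟩`, in the same
normalization. -/
def temperedHat (T : 𝓢'(V, ℂ)) : 𝓢'(V, ℂ) :=
  PointwiseConvergenceCLM.precomp ℂ (fourierHat V) T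

theorem temperedHat_apply (T : 𝓢'(V, ℂ)) (φ : 𝓢(V, ℂ)) :
    temperedHat T φ = T (fourierHat V φ) := rfl

/-- The support of the distributional Fourier transform of an `Lᵖ` function. -/
def fourierSupport {p : ℝ≥0∞} [Fact (1 ≤ p)] (f : Lp ℂ p (volume : Measure V)) : Set V :=
  dsupport (temperedHat (f : 𝓢'(V, ℂ)))

/-- The inverse Fourier transform `∫ exp (i (x|ξ)) u(ξ) dξ` of an integrable function `u`. -/
def fourierInvInt (u : V → ℂ) (x : V) : ℂ :=
  ∫ ξ, Complex.exp (Complex.I * (⟪x, ξ⟫ : ℝ)) * u ξ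

/-! ## Littlewood–Paley functions and the Besov norm -/

namespace JordanCone

variable (𝒞 : JordanCone V)

/-- A `(1/2, 2)`-lattice `ξ j = g j e` of the cone with a bump function `φ₀` that generates the
Littlewood–Paley functions. -/
structure LittlewoodPaley where
  ξ : ℕ → V
  isLattice : 𝒞.IsLattice (1 / 2) 2 ξ
  g : ℕ → V ≃L[ℝ] V
  g_mem : ∀ j, g j ∈ coneAut 𝒞.Ω
  g_e : ∀ j, g j 𝒞.e = ξ j
  φ₀ : V → ℝ
  smooth : ContDiff ℝ ∞ φ₀
  compactSupport : HasCompactSupport φ₀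
  tsupport_subset : tsupport φ₀ ⊆ 𝒞.ball 2 𝒞.e
  nonneg : ∀ x, 0 ≤ φ₀ x
  le_one : ∀ x, φ₀ x ≤ 1
  eq_one : ∀ x ∈ 𝒞.ball 1 𝒞.e, φ₀ x = 1

namespace LittlewoodPaley

variable {𝒞} (P : 𝒞.LittlewoodPaley)

def φ (j : ℕ) (η : V) : ℝ := P.φ₀ ((P.g j).symm η)

def Φ (η : V) : ℝ := ∑' j, P.φ j η

/-- The Fourier transform of the Littlewood–Paley function `ψ j`; it vanishes off the cone. -/
def ψHat (j : ℕ) (η : V) : ℝ := P.φ j η / P.Φ η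

/-- The `j`-th piece `f * ψ j` of `f`, the function with Fourier transform `f^ · (ψ j)^`. -/
def piece (f : 𝓢(V, ℂ)) (j : ℕ) : V → ℂ :=
  fourierInvInt fun η => fourierHat V f η * P.ψHat j η

/-- The Besov norm
`‖f‖_{B^{p,s}_ν} = (∑ j, Δ(ξ j)^(-ν) * ‖f * ψ j‖_p ^ s) ^ (1 / s)`. -/
def besovNorm (p : ℝ≥0∞) (s ν : ℝ) (f : 𝓢(V, ℂ)) : ℝ≥0∞ :=
  (∑' j, ENNReal.ofReal (𝒞.det (P.ξ j) ^ (-ν)) * eLpNorm (P.piece f j) p volume ^ s) ^ (1 / s)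

end LittlewoodPaley

/-- `f` belongs to `𝒟_Ω`: its Fourier transform has compact support contained in the cone. -/
def IsTest (f : 𝓢(V, ℂ)) : Prop :=
  HasCompactSupport (fourierHat V f) ∧ tsupport (fourierHat V f) ⊆ 𝒞.Ω

/-- The Fourier–Laplace extension
`𝓛f(x + iy) = ∫_Ω exp (i (x + iy | ξ)) f^(ξ) dξ`. -/
def fourierLaplace (f : 𝓢(V, ℂ)) (x y : V) : ℂ :=
  ∫ ξ in 𝒞.Ω, Complex.exp (Complex.I * ((⟪x, ξ⟫ : ℝ) + Complex.I * (⟪y, ξ⟫ : ℝ))) *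
    fourierHat V f ξ

/-- The band `H₀ = {1/2 < (e|ξ) < 2}`. -/
def band : Set V := {ξ | 1 / 2 < ⟪𝒞.e, ξ⟫ ∧ ⟪𝒞.e, ξ⟫ < 2}

end JordanCone

end Fourier

end ConeLP

end

/-! The geometry of the cone enters through order comparability: `x ≤ M y` and `y ≤ M x` in the
order of `Ω`. Along a curve in `Ω` the logarithm of `(γ|z)`, with `z` in the closed cone, varies no
faster than invariant length, so points at distance less than `R` are `exp R`-comparable. The points
comparable to `e` form a compact subset of `Ω`. By homogeneity this yields bounded overlap of the
lattice balls, operator bounds for the maps `g⁻¹ h` between comparable points, and slow variation of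
`Δ`.

The Jordan structure supplies the remaining algebra. Spectral decompositions give each point of `Ω`
a logarithm `a` with `exp(L(a)) e = x`. Irreducibility makes `Tr L(x)` a multiple of `(x|e)`. Hence
`Δ(g e)` is a fixed power of `|det g|` (`det_apply_e`), and the stabilizer of `e` acts by isometries
(`norm_stabilizer`), which makes the invariant metric independent of choices.

The analytic tool is `exists_multiplierBound`: a compact family of smooth symbols supported in one
compact set is uniformly bounded on `Lᵖ`. Composition with an automorphism leaves multiplier norms
unchanged, so every `ψHat k` may be moved to `e`, where these functions form such a family.
Exponential factors join the family after an extremal constant is split off.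

1 implies 2: a ball `B₂(ξ j)` that meets `H₀` has `(ξ j|e) ≤ 2 exp 2`, so the exponential weight is
bounded.

2 implies 3: the transform of `𝓛f(· + iy)` is `exp(-(y|ξ)) f^(ξ)`. It is cut dyadically where
`(y|ξ)` is of size `2^m`. An automorphism and a dilation carry each part into `H₀`, where 2 applies
to its Littlewood–Paley pieces. Finite overlap returns to the pieces of `f`. The change of
determinant contributes `Δ(y)^(-μ/s) 2^(mκ)` with `κ > 0`, the multiplier contributes `exp(-2^m/4)`,
and the product is summable over `m ∈ ℤ` (`exists_norm_le`, `laplaceEstimate`).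

3 implies 1: for Schwartz `v j`, apply 3 at `y = e` to the `f` whose transform is `exp((e|ξ)) ∑ v
j^(ξ)`; its extension is `∑ v j`. The factor `exp((e|ξ))` costs `exp(κ (e|ξ k))` on the `k`-th
piece, which becomes the exponential weight (`exists_norm_sum_le`). General `Lᵖ` functions are
limits of Schwartz functions whose spectra are only slightly larger
(`exists_tendsto_of_fourierSupport_subset`). -/

set_option linter.unusedSectionVars false

noncomputable section

namespace ConeLP

/-! ### Identities for Jordan multiplication operators -/

namespace EuclideanJordanAlgebra

variable {V : Type*} [NormedAddCommGroup V] [InnerProductSpace ℝ V]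
  (J : EuclideanJordanAlgebra V)

theorem mul_e (x : V) : J.mul x J.e = x := by rw [J.mul_comm, J.e_mul]

/-- The Jordan identity, linearized once. -/
theorem jordan_linearized (x z y : V) :
    J.mul z (J.mul (J.mul x x) y) - J.mul (J.mul x x) (J.mul z y) +
      (2 : ℝ) • (J.mul x (J.mul (J.mul x z) y) - J.mul (J.mul x z) (J.mul x y)) = 0 := by
  -- The identity is cubic in its first variable: half the difference at `x + z` and `x - z` is its
  -- odd part in `z`, and removing the identity at `z` leaves the part linear in `z`.
  have h1 := J.jordan (x + z) y
  have h2 := J.jordan (x - z) y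
  have h3 := J.jordan z y
  simp only [map_add, map_sub, LinearMap.add_apply, LinearMap.sub_apply, J.mul_comm z x] at h1 h2
  linear_combination (norm := module) (1 / 2 : ℝ) • h1 - (1 / 2 : ℝ) • h2 - h3

/-- The fully linearized Jordan identity. -/
theorem jordan_polarized (x y z w : V) :
    J.mul x (J.mul (J.mul y z) w) - J.mul (J.mul y z) (J.mul x w) +
      (J.mul y (J.mul (J.mul z x) w) - J.mul (J.mul z x) (J.mul y w)) +
      (J.mul z (J.mul (J.mul x y) w) - J.mul (J.mul x y) (J.mul z w)) = 0 := by
  have h1 := J.jordan_linearized (x + y) z w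
  have h2 := J.jordan_linearized x z w
  have h3 := J.jordan_linearized y z w
  simp only [map_add, LinearMap.add_apply, J.mul_comm y x, J.mul_comm z x] at h1 h2 ⊢
  linear_combination (norm := module) (1 / 2 : ℝ) • h1 - (1 / 2 : ℝ) • h2 - (1 / 2 : ℝ) • h3

/-- The multiplication operators of triple products. -/
theorem mul_mul_mul (x y w : V) :
    J.mul (J.mul (J.mul x y) w) = J.mul (J.mul x y) * J.mul w + J.mul (J.mul x w) * J.mul y +
      J.mul (J.mul y w) * J.mul x - J.mul x * J.mul w * J.mul y - J.mul y * J.mul w * J.mul x := by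
  ext z
  -- The polarized identity is read as an equation between operators acting on `z`.
  have h := J.jordan_polarized x y z w
  simp only [LinearMap.sub_apply, LinearMap.add_apply, Module.End.mul_apply]
  rw [J.mul_comm (J.mul (J.mul x y) w) z, J.mul_comm (J.mul x y) (J.mul w z), J.mul_comm w z,
    J.mul_comm (J.mul x w) (J.mul y z), J.mul_comm (J.mul y w) (J.mul x z)]
  rw [J.mul_comm w (J.mul y z), J.mul_comm w (J.mul x z), J.mul_comm x z]
  rw [J.mul_comm (J.mul z w)]
  linear_combination (norm := module) h

/-! ### Idempotents -/

variable {J}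

/-- This is `2L³ - 3L² + L = 0` for `L = L(c)`, the Peirce equation with roots `0, 1/2, 1`, obtained
from the triple product formula at `c, c, c`. -/
theorem IsIdempotent.mul_apply {c : V} (hc : J.IsIdempotent c) (v : V) :
    J.mul c v = (3 : ℝ) • J.mul c (J.mul c v) - (2 : ℝ) • J.mul c (J.mul c (J.mul c v)) := by
  have h := LinearMap.congr_fun (J.mul_mul_mul c c c) v
  have hc' : J.mul c c = c := hc
  simp only [hc', LinearMap.sub_apply, LinearMap.add_apply, Module.End.mul_apply] at h
  linear_combination (norm := module) h

/-- The polynomial `λ² + 4(λ - λ²)²` agrees with `λ` at the Peirce values `0, 1/2, 1`. This exhibits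
the quadratic form of `L(c)` as a sum of squares without a Peirce decomposition. -/
theorem IsIdempotent.inner_mul_self {c : V} (hc : J.IsIdempotent c) (v : V) :
    ⟪J.mul c v, v⟫ = ‖J.mul c v‖ ^ 2 + 4 * ‖J.mul c v - J.mul c (J.mul c v)‖ ^ 2 := by
  have h1 := hc.mul_apply v
  have h2 := hc.mul_apply (J.mul c v)
  set w := J.mul c v with hw
  set u := J.mul c w with hu
  have e1 : ⟪w, v⟫ = 3 * ⟪w, w⟫ - 2 * ⟪u, w⟫ := by
    calc ⟪w, v⟫ = ⟪(3 : ℝ) • u - (2 : ℝ) • J.mul c u, v⟫ := by rw [← h1]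
      _ = 3 * ⟪u, v⟫ - 2 * ⟪J.mul c u, v⟫ := by
        rw [inner_sub_left, inner_smul_left, inner_smul_left]; simp
      _ = _ := by rw [J.inner_mul c u, ← hw, hu, J.inner_mul c w, ← hw]
  have e2 : ⟪w, w⟫ = 3 * ⟪u, w⟫ - 2 * ⟪u, u⟫ := by
    calc ⟪w, w⟫ = ⟪u, v⟫ := (J.inner_mul c w v).symm
      _ = ⟪(3 : ℝ) • J.mul c u - (2 : ℝ) • J.mul c (J.mul c u), v⟫ := by rw [← h2]
      _ = 3 * ⟪J.mul c u, v⟫ - 2 * ⟪J.mul c (J.mul c u), v⟫ := by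
        rw [inner_sub_left, inner_smul_left, inner_smul_left]; simp
      _ = _ := by rw [J.inner_mul c u, J.inner_mul c (J.mul c u), ← hw, J.inner_mul c u, ← hu]
  rw [← real_inner_self_eq_norm_sq, ← real_inner_self_eq_norm_sq, e1, inner_sub_left,
    inner_sub_right, inner_sub_right, real_inner_comm u w]
  linarith

theorem IsIdempotent.inner_mul_self_nonneg {c : V} (hc : J.IsIdempotent c) (v : V) :
    0 ≤ ⟪J.mul c v, v⟫ := by
  rw [hc.inner_mul_self]; positivity

theorem IsIdempotent.mul_eq_zero_of_inner {c v : V} (hc : J.IsIdempotent c)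
    (h : ⟪J.mul c v, v⟫ = 0) : J.mul c v = 0 := by
  rw [hc.inner_mul_self] at h
  have := sq_nonneg ‖J.mul c v‖
  have := sq_nonneg ‖J.mul c v - J.mul c (J.mul c v)‖
  have h0 : ‖J.mul c v‖ ^ 2 = 0 := by linarith
  simpa using h0

theorem IsIdempotent.inner_sq {c v : V} : ⟪c, J.mul v v⟫ = ⟪J.mul c v, v⟫ := by
  rw [← J.inner_mul, J.mul_comm]

/-- In the linearized identity at `c`, every term other than `c(vv)` contains the factor `cv`. -/
theorem IsIdempotent.mul_sq_eq_zero {c v : V} (hc : J.IsIdempotent c) (h : J.mul c v = 0) :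
    J.mul c (J.mul v v) = 0 := by
  have hc' : J.mul c c = c := hc
  have := J.jordan_linearized c v v
  simpa [hc', h] using this

theorem IsIdempotent.inner_nonneg {c d : V} (hc : J.IsIdempotent c) (hd : J.IsIdempotent d) :
    0 ≤ ⟪c, d⟫ := by
  have hd' : J.mul d d = d := hd
  rw [← hd', IsIdempotent.inner_sq]
  exact hc.inner_mul_self_nonneg d

theorem IsIdempotent.mul_eq_zero_iff {c d : V} (hc : J.IsIdempotent c) (hd : J.IsIdempotent d) :
    J.mul c d = 0 ↔ ⟪c, d⟫ = 0 := by
  have hd' : J.mul d d = d := hd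
  have h : ⟪c, d⟫ = ⟪J.mul c d, d⟫ := by rw [← IsIdempotent.inner_sq, hd']
  rw [h]
  exact ⟨fun h => by rw [h, inner_zero_left], fun h => hc.mul_eq_zero_of_inner h⟩

theorem IsIdempotent.mul_eq_zero_of_add {a b : V} (ha : J.IsIdempotent a) (hb : J.IsIdempotent b)
    (hab : J.IsIdempotent (a + b)) : J.mul a b = 0 := by
  have ha' : J.mul a a = a := ha
  have hb' : J.mul b b = b := hb
  have h : J.mul (a + b) (a + b) = a + b := hab
  simp only [map_add, LinearMap.add_apply, ha', hb', J.mul_comm b a] at h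
  have h2 : (2 : ℝ) • J.mul a b = 0 := by
    rw [two_smul]
    linear_combination (norm := module) h
  simpa using h2

/-- A complete system of nonzero orthogonal idempotents. -/
structure IsSystem (J : EuclideanJordanAlgebra V) {ι : Type} [Fintype ι] (c : ι → V) : Prop where
  idem : ∀ i, J.IsIdempotent (c i)
  ne_zero : ∀ i, c i ≠ 0
  orthogonal : ∀ i j, i ≠ j → J.mul (c i) (c j) = 0
  sum_eq : ∑ i, c i = J.e

theorem IsSystem.inner_eq_zero {ι : Type} [Fintype ι] {c : ι → V} (hc : J.IsSystem c)
    {i j : ι} (h : i ≠ j) : ⟪c i, c j⟫ = 0 :=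
  ((hc.idem i).mul_eq_zero_iff (hc.idem j)).1 (hc.orthogonal i j h)

theorem IsSystem.linearIndependent {ι : Type} [Fintype ι] {c : ι → V} (hc : J.IsSystem c) :
    LinearIndependent ℝ c :=
  linearIndependent_of_ne_zero_of_inner_eq_zero hc.ne_zero fun _ _ h => hc.inner_eq_zero h

theorem IsSystem.mul_sum {ι : Type} [Fintype ι] {c : ι → V} (hc : J.IsSystem c)
    (l m : ι → ℝ) : J.mul (∑ i, l i • c i) (∑ i, m i • c i) = ∑ i, (l i * m i) • c i := by
  classical
  rw [map_sum J.mul, LinearMap.sum_apply]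
  refine Finset.sum_congr rfl fun i _ => ?_
  rw [map_sum, Finset.sum_eq_single i]
  · have : J.mul (c i) (c i) = c i := hc.idem i
    simp [this, smul_smul, _root_.mul_comm]
  · intro j _ hj
    simp [hc.orthogonal i j hj.symm]
  · simp

/-- Splitting one member of a complete system. -/
theorem IsSystem.split {ι : Type} [Fintype ι] [DecidableEq ι] {c : ι → V} (hc : J.IsSystem c)
    (i : ι) {a b : V} (ha : J.IsIdempotent a) (hb : J.IsIdempotent b) (ha0 : a ≠ 0) (hb0 : b ≠ 0)
    (hab : c i = a + b) :
    J.IsSystem (fun o : Option ι => o.elim b (Function.update c i a)) := by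
  have hidem : J.IsIdempotent (a + b) := hab ▸ hc.idem i
  have hmul := ha.mul_eq_zero_of_add hb hidem
  -- The products `(a|c j)` and `(b|c j)` are nonnegative and add up to `(c i|c j) = 0`, so both
  -- vanish.
  have hother : ∀ j, j ≠ i → J.mul a (c j) = 0 ∧ J.mul b (c j) = 0 := by
    intro j hj
    have h := hc.inner_eq_zero hj.symm
    rw [hab, inner_add_left] at h
    have h1 := ha.inner_nonneg (hc.idem j)
    have h2 := hb.inner_nonneg (hc.idem j)
    exact ⟨(ha.mul_eq_zero_iff (hc.idem j)).2 (by linarith),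
      (hb.mul_eq_zero_iff (hc.idem j)).2 (by linarith)⟩
  refine ⟨?_, ?_, ?_, ?_⟩
  · rintro (_ | j)
    · exact hb
    · by_cases hj : j = i
      · subst hj; simpa using ha
      · simpa [hj] using hc.idem j
  · rintro (_ | j)
    · exact hb0
    · by_cases hj : j = i
      · subst hj; simpa using ha0
      · simpa [hj] using hc.ne_zero j
  · rintro (_ | j) (_ | k) hjk
    · exact absurd rfl hjk
    · by_cases hk : k = i
      · subst hk; simpa [J.mul_comm b a] using hmul
      · simpa [hk] using (hother k hk).2
    · by_cases hk : j = i
      · subst hk; simpa using hmul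
      · simpa [hk, J.mul_comm (c j)] using (hother j hk).2
    · have hjk' : j ≠ k := fun h => hjk (by rw [h])
      by_cases hj : j = i
      · subst hj
        simpa [hjk'.symm] using (hother k hjk'.symm).1
      · by_cases hk : k = i
        · subst hk
          simpa [hj, J.mul_comm (c j)] using (hother j hj).1
        · simpa [hj, hk] using hc.orthogonal j k hjk'
  · rw [Fintype.sum_option, ← hc.sum_eq]
    simp only [Option.elim]
    rw [Finset.sum_update_of_mem (Finset.mem_univ i), ← Finset.add_sum_erase _ _ (Finset.mem_univ i),
      hab, ← Finset.sdiff_singleton_eq_erase]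
    abel

theorem IsJordanFrame.isSystem {r : ℕ} {c : Fin r → V} (hc : J.IsJordanFrame c) : J.IsSystem c :=
  ⟨fun i => (hc.primitive i).1, fun i => (hc.primitive i).2.1, hc.orthogonal, hc.sum_eq⟩

/-! ### Power associativity and spectral decompositions -/

section Spectral

variable (J)

theorem mul_isSymmetric (x : V) : (J.mul x).IsSymmetric := fun u v => J.inner_mul x u v

/-- Multiplication by a power of `x` commutes with multiplication by `x`. -/
theorem commute_mul_pow (x : V) (n : ℕ) :
    Commute (J.mul ((J.mul x ^ n) J.e)) (J.mul x) := by
  have hsq : Commute (J.mul (J.mul x x)) (J.mul x) := by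
    ext y
    exact (J.jordan x y).symm
  induction n using Nat.twoStepInduction with
  | zero =>
    ext y
    simp [J.e_mul]
  | one => simp [J.mul_e]
  | more n h1 h2 =>
    -- Writing the power as `(x x) xⁿ` lets the triple product formula express its operator through
    -- those of `x²`, `x`, `xⁿ` and `xⁿ⁺¹`; hence the two-step induction.
    have h3 : (J.mul x ^ (n + 2)) J.e = J.mul (J.mul x x) ((J.mul x ^ n) J.e) := by
      have := LinearMap.congr_fun (hsq.pow_right n).eq J.e
      simp only [Module.End.mul_apply, J.mul_e] at this
      rw [this, pow_add, Module.End.mul_apply, pow_two, Module.End.mul_apply, J.mul_e]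
    have h4 : J.mul x ((J.mul x ^ n) J.e) = (J.mul x ^ (n + 1)) J.e := by
      rw [pow_succ', Module.End.mul_apply]
    rw [h3, J.mul_mul_mul, h4]
    have hx : Commute (J.mul x) (J.mul x) := Commute.refl _
    exact ((((hsq.mul_left h1).add_left (h2.mul_left hx)).add_left (h2.mul_left hx)).sub_left
      ((hx.mul_left h1).mul_left hx)).sub_left ((hx.mul_left h1).mul_left hx)

open Polynomial in
/-- Power associativity. -/
theorem mul_aeval (x : V) (p q : ℝ[X]) :
    J.mul (aeval (J.mul x) p J.e) (aeval (J.mul x) q J.e) = aeval (J.mul x) (p * q) J.e := by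
  have hp : Commute (J.mul (aeval (J.mul x) p J.e)) (J.mul x) := by
    induction p using Polynomial.induction_on' with
    | add p q hp hq =>
      simp only [map_add, LinearMap.add_apply]
      exact hp.add_left hq
    | monomial n a =>
      simp only [aeval_monomial, Algebra.algebraMap_eq_smul_one, smul_mul_assoc, one_mul,
        LinearMap.smul_apply, map_smul]
      exact (J.commute_mul_pow x n).smul_left a
  have hq : Commute (J.mul (aeval (J.mul x) p J.e)) (aeval (J.mul x) q) := by
    induction q using Polynomial.induction_on' with
    | add p q hp hq => simpa using hp.add_right hq
    | monomial n a =>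
      simp only [aeval_monomial, Algebra.algebraMap_eq_smul_one, smul_mul_assoc, one_mul]
      exact (hp.pow_right n).smul_right a
  have := LinearMap.congr_fun hq.eq J.e
  simp only [Module.End.mul_apply, J.mul_e] at this
  rw [this, _root_.mul_comm p q, map_mul, Module.End.mul_apply]

variable [FiniteDimensional ℝ V]

open Polynomial in
-- `L(x)` is symmetric, hence diagonalizable, so polynomials in it are determined by finitely many
-- values. This reduces the spectral theorem to Lagrange interpolation.
theorem exists_eigenvalue_set (x : V) :
    ∃ S : Finset ℝ, ∀ q : ℝ[X], (∀ l ∈ S, q.eval l = 0) → aeval (J.mul x) q = 0 := by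
  classical
  have hT := J.mul_isSymmetric x
  refine ⟨Finset.univ.image (hT.eigenvalues rfl), fun q hq => ?_⟩
  refine (hT.eigenvectorBasis rfl).toBasis.ext fun i => ?_
  have h := Module.End.aeval_apply_of_hasEigenvector (p := q) (hT.hasEigenvector_eigenvectorBasis rfl i)
  rw [OrthonormalBasis.coe_toBasis, h]
  have := hq (hT.eigenvalues rfl i) (by simp)
  simp [this]

open Polynomial in
-- The idempotents are the Lagrange basis polynomials of the spectrum of `L(x)`, evaluated at `L(x)`
-- and applied to `e`; power associativity turns polynomial products into Jordan products.
theorem exists_system [Nontrivial V] (x : V) : ∃ (ι : Type) (_ : Fintype ι) (c : ι → V) (l : ι → ℝ),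
    J.IsSystem c ∧ x = ∑ i, l i • c i := by
  classical
  obtain ⟨S, hS⟩ := J.exists_eigenvalue_set x
  have hne : S.Nonempty := by
    by_contra h
    rw [Finset.not_nonempty_iff_eq_empty] at h
    have h1 := hS 1 (by simp [h])
    obtain ⟨v, hv⟩ := exists_ne (0 : V)
    apply hv
    simpa using LinearMap.congr_fun h1 v
  have hext : ∀ p q : ℝ[X], (∀ l ∈ S, p.eval l = q.eval l) →
      aeval (J.mul x) p = aeval (J.mul x) q := by
    intro p q h
    rw [← sub_eq_zero, ← map_sub]
    exact hS _ fun l hl => by simp [h l hl]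
  set b : ℝ → ℝ[X] := fun l => Lagrange.basis S id l with hb
  have hbe : ∀ l ∈ S, ∀ m ∈ S, (b l).eval m = if l = m then 1 else 0 := by
    intro l hl m hm
    split_ifs with h
    · subst h
      exact Lagrange.eval_basis_self (v := id) (Function.injective_id.injOn) hl
    · exact Lagrange.eval_basis_of_ne (v := id) h hm
  set d : ℝ → V := fun l => aeval (J.mul x) (b l) J.e with hd
  have hdd : ∀ l ∈ S, ∀ m ∈ S, J.mul (d l) (d m) = if l = m then d l else 0 := by
    intro l hl m hm
    simp only [hd]
    rw [J.mul_aeval]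
    split_ifs with h
    · subst h
      rw [hext _ (b l)]
      intro k hk
      simp [hbe l hl k hk]
    · rw [hext _ 0]
      · simp
      · intro k hk
        simp only [eval_mul, hbe l hl k hk, hbe m hm k hk, eval_zero]
        split_ifs with h1 h2 <;> simp_all
  have hsum : ∑ l ∈ S, d l = J.e := by
    simp only [hd, ← LinearMap.sum_apply, ← map_sum]
    rw [hb, Lagrange.sum_basis (Function.injective_id.injOn) hne]
    simp
  have hx : ∑ l ∈ S, l • d l = x := by
    have h : ∑ l ∈ S, l • d l = aeval (J.mul x) (∑ l ∈ S, l • b l) J.e := by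
      simp [hd, map_sum, LinearMap.sum_apply]
    rw [h, hext _ X]
    · simp [J.mul_e]
    · intro k hk
      simp only [eval_finsetSum, eval_smul, eval_X]
      rw [Finset.sum_eq_single k]
      · simp [hbe k hk k hk]
      · intro m hm hmk
        simp [hbe m hm k hk, hmk]
      · exact fun h => absurd hk h
  -- An eigenvalue of `L(x)` need not be an eigenvalue of `x` (half-sums also occur); the
  -- corresponding idempotents vanish and are discarded.
  set S' := S.filter fun l => d l ≠ 0 with hS'
  have hmem : ∀ i : S', (i : ℝ) ∈ S := fun i => (Finset.mem_filter.1 i.2).1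
  refine ⟨S', inferInstance, fun i => d i, fun i => i, ⟨?_, ?_, ?_, ?_⟩, ?_⟩
  · intro i
    have := hdd i (hmem i) i (hmem i)
    rwa [if_pos rfl] at this
  · exact fun i => (Finset.mem_filter.1 i.2).2
  · intro i j hij
    have := hdd i (hmem i) j (hmem j)
    rwa [if_neg (fun h => hij (Subtype.ext h))] at this
  · rw [← hsum, Finset.sum_coe_sort S' d, hS', Finset.sum_filter_ne_zero]
  · rw [Finset.sum_coe_sort S' fun l => l • d l, ← hx]
    refine (Finset.sum_subset (Finset.filter_subset _ _) fun l hl h => ?_).symm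
    have : d l = 0 := by
      by_contra h0
      exact h (Finset.mem_filter.2 ⟨hl, h0⟩)
    simp [this]

/-- The spectral theorem. -/
theorem exists_isSpectrum [Nontrivial V] (x : V) : ∃ m, J.IsSpectrum x m := by
  classical
  -- A system representing `x` with the largest possible number of members is primitive: splitting a
  -- member and repeating its coefficient would give a larger one. Linear independence bounds the
  -- number by the dimension.
  set Q : Set ℕ := {r | ∃ (ι : Type) (_ : Fintype ι) (c : ι → V) (l : ι → ℝ),
    J.IsSystem c ∧ x = ∑ i, l i • c i ∧ Fintype.card ι = r} with hQ
  have hne : Q.Nonempty := by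
    obtain ⟨ι, h, c, l, hc, hx⟩ := J.exists_system x
    exact ⟨_, ι, h, c, l, hc, hx, rfl⟩
  have hbdd : BddAbove Q := by
    refine ⟨Module.finrank ℝ V, ?_⟩
    rintro r ⟨ι, h, c, l, hc, hx, rfl⟩
    exact hc.linearIndependent.fintype_card_le_finrank
  obtain ⟨ι, h, c, l, hc, hx, hr⟩ := Nat.sSup_mem hne hbdd
  have hprim : ∀ i, J.IsPrimitive (c i) := by
    intro i
    refine ⟨hc.idem i, hc.ne_zero i, fun a b ha hb hab => ?_⟩
    by_contra! hcon
    have hs := hc.split i ha hb hcon.1 hcon.2 hab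
    have hmem : sSup Q + 1 ∈ Q := by
      refine ⟨Option ι, inferInstance, _, fun o => o.elim (l i) l, hs, ?_, ?_⟩
      · rw [hx, Fintype.sum_option]
        simp only [Option.elim]
        rw [← Finset.add_sum_erase _ _ (Finset.mem_univ i),
          ← Finset.add_sum_erase _ (fun j => l j • Function.update c i a j) (Finset.mem_univ i)]
        rw [Function.update_self, hab, smul_add, add_comm (l i • a), add_assoc]
        congr 2
        refine Finset.sum_congr rfl fun j hj => ?_
        rw [Function.update_of_ne (Finset.ne_of_mem_erase hj)]
      · rw [Fintype.card_option, hr]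
    have := le_csSup hbdd hmem
    omega
  refine ⟨_, Fintype.card ι, c ∘ (Fintype.equivFin ι).symm, l ∘ (Fintype.equivFin ι).symm,
    ⟨fun i => hprim _, fun i j hij => hc.orthogonal _ _ (by simpa using hij), ?_⟩, ?_, rfl⟩
  · rw [← hc.sum_eq]
    exact Equiv.sum_comp (Fintype.equivFin ι).symm c
  · rw [hx]
    exact (Equiv.sum_comp (Fintype.equivFin ι).symm fun i => l i • c i).symm

theorem isSpectrum_eigenvalues [Nontrivial V] (x : V) : J.IsSpectrum x (J.eigenvalues x) :=
  Classical.epsilon_spec (J.exists_isSpectrum x)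

variable {J}

/-- A primitive idempotent has trace one. -/
theorem IsPrimitive.tr_eq_one [Nontrivial V] {c : V} (hc : J.IsPrimitive c) : J.tr c = 1 := by
  classical
  -- The trace is read off an arbitrarily chosen spectral decomposition. Its coefficients are `0` or
  -- `1`, and primitivity leaves exactly one equal to `1`.
  obtain ⟨r, d, l, hd, hx, hm⟩ := J.isSpectrum_eigenvalues c
  have hs := hd.isSystem
  have hl : ∀ i, l i * l i = l i := by
    have h1 : J.mul c c = c := hc.1
    rw [hx, hs.mul_sum, ← sub_eq_zero, ← Finset.sum_sub_distrib] at h1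
    simp only [← sub_smul] at h1
    intro i
    have := Fintype.linearIndependent_iff.1 hs.linearIndependent _ h1 i
    linarith
  have hl' : ∀ i, l i = 0 ∨ l i = 1 := by
    intro i
    have : l i * (l i - 1) = 0 := by linarith [hl i]
    rcases mul_eq_zero.1 this with h | h
    · exact Or.inl h
    · exact Or.inr (by linarith)
  obtain ⟨i, hi⟩ : ∃ i, l i ≠ 0 := by
    by_contra! h
    exact hc.2.1 (by simp [hx, h])
  have hi1 : l i = 1 := (hl' i).resolve_left hi
  have hrest : ∑ j ∈ Finset.univ.erase i, l j • d j = 0 := by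
    have hdec : c = d i + ∑ j ∈ Finset.univ.erase i, l j • d j := by
      rw [hx, ← Finset.add_sum_erase _ _ (Finset.mem_univ i), hi1, one_smul]
    have hidem : J.IsIdempotent (∑ j ∈ Finset.univ.erase i, l j • d j) := by
      have e : ∑ j ∈ Finset.univ.erase i, l j • d j = ∑ j, (if j = i then 0 else l j) • d j := by
        rw [← Finset.add_sum_erase Finset.univ (fun j => (if j = i then 0 else l j) • d j)
          (Finset.mem_univ i)]
        simp only [if_true, zero_smul, zero_add]
        refine Finset.sum_congr rfl fun j hj => ?_
        rw [if_neg (Finset.ne_of_mem_erase hj)]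
      rw [IsIdempotent, e, hs.mul_sum]
      refine Finset.sum_congr rfl fun j _ => ?_
      split_ifs
      · simp
      · rw [hl]
    rcases hc.2.2 _ _ (hs.idem i) hidem hdec with h | h
    · exact absurd h (hs.ne_zero i)
    · exact h
  have hzero : ∀ j, j ≠ i → l j = 0 := by
    intro j hj
    have := linearIndependent_iff'.1 hs.linearIndependent (Finset.univ.erase i) l hrest j
    exact this (Finset.mem_erase.2 ⟨hj, Finset.mem_univ j⟩)
  rw [tr, hm]
  change ∑ j, l j = 1
  rw [Finset.sum_eq_single i (fun j _ hj => hzero j hj) (by simp), hi1]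

end Spectral

end EuclideanJordanAlgebra
end ConeLP

namespace ConeLP

/-! ### Exponentials of operators -/

section Exponential

variable {V : Type*} [NormedAddCommGroup V] [InnerProductSpace ℝ V] [FiniteDimensional ℝ V]

theorem exp_mul_exp_neg (A : V →L[ℝ] V) :
    NormedSpace.exp A * NormedSpace.exp (-A) = 1 := by
  let _ : NormedAlgebra ℚ (V →L[ℝ] V) := NormedAlgebra.restrictScalars ℚ ℝ _
  have _ : CompleteSpace V := FiniteDimensional.complete ℝ V
  rw [← NormedSpace.exp_add_of_commute (Commute.neg_right (Commute.refl A)), add_neg_cancel,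
    NormedSpace.exp_zero]

theorem continuous_exp_clm : Continuous (NormedSpace.exp : (V →L[ℝ] V) → (V →L[ℝ] V)) := by
  let _ : NormedAlgebra ℚ (V →L[ℝ] V) := NormedAlgebra.restrictScalars ℚ ℝ _
  have _ : CompleteSpace V := FiniteDimensional.complete ℝ V
  exact NormedSpace.exp_continuous

/-- The exponential of an operator as a linear bijection. -/
def expEquiv (A : V →L[ℝ] V) : V ≃L[ℝ] V :=
  ContinuousLinearEquiv.equivOfInverse (NormedSpace.exp A) (NormedSpace.exp (-A))
    (fun x => by
      have := exp_mul_exp_neg (-A)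
      rw [neg_neg] at this
      exact DFunLike.congr_fun this x)
    (fun x => DFunLike.congr_fun (exp_mul_exp_neg A) x)

theorem expEquiv_apply (A : V →L[ℝ] V) (x : V) : expEquiv A x = NormedSpace.exp A x := rfl

theorem expEquiv_symm_apply (A : V →L[ℝ] V) (x : V) :
    (expEquiv A).symm x = NormedSpace.exp (-A) x := rfl

theorem exp_apply_of_eigenvector (A : V →L[ℝ] V) {v : V} {l : ℝ} (h : A v = l • v) :
    NormedSpace.exp A v = Real.exp l • v := by
  have _ : CompleteSpace V := FiniteDimensional.complete ℝ V
  have h1 := (NormedSpace.exp_series_hasSum_exp' (𝕂 := ℝ) A).mapL (ContinuousLinearMap.apply ℝ V v)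
  have h2 := (NormedSpace.exp_series_hasSum_exp' (𝕂 := ℝ) l).smul_const v
  rw [← Real.exp_eq_exp_ℝ] at h2
  have hpow : ∀ n : ℕ, (A ^ n) v = l ^ n • v := by
    intro n
    induction n with
    | zero => simp
    | succ n ih => rw [pow_succ', mul_apply_eq_comp, ih, map_smul, h, smul_smul, pow_succ]
  refine h1.unique ?_
  convert h2 using 2 with n
  simp [hpow, smul_smul]

theorem exp_det_of_isSymmetric (A : V →L[ℝ] V) (hA : (A : V →ₗ[ℝ] V).IsSymmetric) :
    LinearMap.det ((NormedSpace.exp A : V →L[ℝ] V) : V →ₗ[ℝ] V) =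
      Real.exp (LinearMap.trace ℝ V (A : V →ₗ[ℝ] V)) := by
  classical
  set b := hA.eigenvectorBasis rfl with hb
  have hmat : LinearMap.toMatrix b.toBasis b.toBasis
      ((NormedSpace.exp A : V →L[ℝ] V) : V →ₗ[ℝ] V) =
      Matrix.diagonal fun i => Real.exp (hA.eigenvalues rfl i) := by
    ext i j
    have h1 : A (b j) = hA.eigenvalues rfl j • b j := hA.apply_eigenvectorBasis rfl j
    rw [LinearMap.toMatrix_apply, OrthonormalBasis.coe_toBasis, ContinuousLinearMap.coe_coe,
      exp_apply_of_eigenvector A h1, map_smul, Finsupp.smul_apply]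
    have h2 : b.toBasis.repr (b j) = Finsupp.single j 1 := by
      rw [← OrthonormalBasis.coe_toBasis, Module.Basis.repr_self]
    rw [h2, Finsupp.single_apply, Matrix.diagonal_apply]
    by_cases hij : i = j
    · subst hij; simp
    · simp [hij, Ne.symm hij]
  rw [← LinearMap.det_toMatrix b.toBasis, hmat, Matrix.det_diagonal, ← Real.exp_sum,
    hA.trace_eq_sum_eigenvalues rfl]
  simp

end Exponential

/-! ### The center and the trace form -/

namespace EuclideanJordanAlgebra

variable {V : Type*} [NormedAddCommGroup V] [InnerProductSpace ℝ V] (J : EuclideanJordanAlgebra V)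

/-- In the triple product formula the terms unchanged by exchanging `y` and `w` cancel; the cubic
terms on the two sides are cyclic permutations of each other. -/
theorem trace_mul_mul (x y w : V) :
    LinearMap.trace ℝ V (J.mul (J.mul (J.mul x y) w)) =
      LinearMap.trace ℝ V (J.mul (J.mul (J.mul x w) y)) := by
  rw [J.mul_mul_mul x y w, J.mul_mul_mul x w y, J.mul_comm w y]
  simp only [map_add, map_sub]
  have h1 := LinearMap.trace_mul_comm ℝ (J.mul x) (J.mul w * J.mul y)
  have h2 := LinearMap.trace_mul_comm ℝ (J.mul x) (J.mul y * J.mul w)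
  simp only [← mul_assoc] at h1 h2
  linarith

variable [FiniteDimensional ℝ V]

/-- Multiplication by `a` as a continuous operator. -/
def mulL (a : V) : V →L[ℝ] V := LinearMap.toContinuousLinearMap (J.mul a)

theorem mulL_apply (a x : V) : J.mulL a x = J.mul a x := rfl

theorem mulL_smul (t : ℝ) (a : V) : J.mulL (t • a) = t • J.mulL a := by
  ext x; simp [mulL_apply]

theorem mulL_neg (a : V) : J.mulL (-a) = -J.mulL a := by
  ext x; simp [mulL_apply]

theorem continuous_mulL : Continuous J.mulL := by
  have : J.mulL = (LinearMap.toContinuousLinearMap.toLinearMap.comp J.mul : V →ₗ[ℝ] (V →L[ℝ] V)) := rfl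
  rw [this]
  exact LinearMap.continuous_of_finiteDimensional _

/-- The vector that represents the linear form `x ↦ Tr L(x)`. -/
def traceVector : V :=
  (InnerProductSpace.toDual ℝ V).symm
    (LinearMap.toContinuousLinearMap ((LinearMap.trace ℝ V).comp J.mul))

theorem inner_traceVector (x : V) : ⟪J.traceVector, x⟫ = LinearMap.trace ℝ V (J.mul x) := by
  rw [traceVector, InnerProductSpace.toDual_symm_apply]
  rfl

/-- Associativity of the trace form makes `L(a)` commute with every `L(x)`, where `a` is the trace
vector. Its eigenspaces are therefore ideals. -/
theorem traceVector_central (x y : V) :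
    J.mul J.traceVector (J.mul x y) = J.mul x (J.mul J.traceVector y) := by
  refine ext_inner_right ℝ fun w => ?_
  have h1 : ⟪J.mul J.traceVector (J.mul x y), w⟫ = ⟪J.traceVector, J.mul (J.mul x y) w⟫ := by
    rw [J.mul_comm, J.inner_mul]
  have h2 : ⟪J.mul x (J.mul J.traceVector y), w⟫ = ⟪J.traceVector, J.mul (J.mul x w) y⟫ := by
    rw [J.inner_mul x, J.mul_comm J.traceVector y, J.inner_mul y, J.mul_comm y]
  rw [h1, h2, J.inner_traceVector, J.inner_traceVector, J.trace_mul_mul]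

end EuclideanJordanAlgebra

/-! ### Symmetric cones -/

namespace JordanCone

variable {V : Type*} [NormedAddCommGroup V] [InnerProductSpace ℝ V] (𝒞 : JordanCone V)

theorem sq_mem_closure (v : V) : 𝒞.mul v v ∈ closure 𝒞.Ω := by
  rw [𝒞.closure_eq_squares]; exact ⟨v, rfl⟩

theorem exists_sq {x : V} (hx : x ∈ closure 𝒞.Ω) : ∃ v, x = 𝒞.mul v v := by
  rw [𝒞.closure_eq_squares] at hx
  obtain ⟨v, hv⟩ := hx
  exact ⟨v, hv.symm⟩

theorem mem_iff {x : V} : x ∈ 𝒞.Ω ↔ ∀ y ∈ closure 𝒞.Ω, y ≠ 0 → 0 < ⟪x, y⟫ := by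
  conv_lhs => rw [𝒞.isSymmetricCone.selfDual]
  rfl

theorem inner_e_sq (v : V) : ⟪𝒞.e, 𝒞.mul v v⟫ = ‖v‖ ^ 2 := by
  rw [← 𝒞.inner_mul, 𝒞.mul_e, real_inner_self_eq_norm_sq]

theorem sq_ne_zero {v : V} (hv : v ≠ 0) : 𝒞.mul v v ≠ 0 := by
  intro h
  have := 𝒞.inner_e_sq v
  rw [h, inner_zero_right] at this
  exact hv (by simpa using this.symm)

theorem e_mem : 𝒞.e ∈ 𝒞.Ω := by
  rw [𝒞.mem_iff]
  intro y hy hy0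
  obtain ⟨v, rfl⟩ := 𝒞.exists_sq hy
  have hv : v ≠ 0 := by rintro rfl; simp at hy0
  rw [𝒞.inner_e_sq]
  positivity

theorem inner_pos {x y : V} (hx : x ∈ 𝒞.Ω) (hy : y ∈ closure 𝒞.Ω) (hy0 : y ≠ 0) : 0 < ⟪x, y⟫ :=
  𝒞.mem_iff.1 hx y hy hy0

theorem inner_nonneg {x y : V} (hx : x ∈ closure 𝒞.Ω) (hy : y ∈ closure 𝒞.Ω) : 0 ≤ ⟪x, y⟫ := by
  have hcl : IsClosed {x : V | 0 ≤ ⟪x, y⟫} :=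
    isClosed_le continuous_const (continuous_id.inner continuous_const)
  refine closure_minimal (fun z hz => ?_) hcl hx
  by_cases hy0 : y = 0
  · simp [hy0]
  · exact (𝒞.inner_pos hz hy hy0).le

theorem smul_mem_closure {t : ℝ} (ht : 0 ≤ t) {x : V} (hx : x ∈ closure 𝒞.Ω) :
    t • x ∈ closure 𝒞.Ω := by
  obtain ⟨v, rfl⟩ := 𝒞.exists_sq hx
  have : t • 𝒞.mul v v = 𝒞.mul (√t • v) (√t • v) := by
    simp [smul_smul, Real.mul_self_sqrt ht]
  rw [this]
  exact 𝒞.sq_mem_closure _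

theorem mem_closure_iff {x : V} : x ∈ closure 𝒞.Ω ↔ ∀ y ∈ closure 𝒞.Ω, 0 ≤ ⟪x, y⟫ := by
  refine ⟨fun hx y hy => 𝒞.inner_nonneg hx hy, fun h => ?_⟩
  have hlim : Filter.Tendsto (fun t : ℝ => x + t • 𝒞.e) (nhdsWithin 0 (Ioi 0)) (nhds x) := by
    have : Continuous fun t : ℝ => x + t • 𝒞.e := by fun_prop
    simpa using (this.tendsto 0).mono_left nhdsWithin_le_nhds
  refine mem_closure_of_tendsto hlim ?_
  filter_upwards [self_mem_nhdsWithin] with t ht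
  rw [𝒞.mem_iff]
  intro y hy hy0
  rw [inner_add_left, inner_smul_left]
  have h1 := h y hy
  have h2 : 0 < t * ⟪𝒞.e, y⟫ := mul_pos ht (𝒞.inner_pos 𝒞.e_mem hy hy0)
  simpa using add_pos_of_nonneg_of_pos h1 h2

theorem idem_mem_closure {c : V} (hc : 𝒞.IsIdempotent c) : c ∈ closure 𝒞.Ω := by
  have h : 𝒞.mul c c = c := hc
  rw [← h]
  exact 𝒞.sq_mem_closure c

theorem zero_notMem [Nontrivial V] : (0 : V) ∉ 𝒞.Ω := by
  intro h
  obtain ⟨v, hv⟩ := exists_ne (0 : V)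
  have := 𝒞.inner_pos h (𝒞.sq_mem_closure v) (𝒞.sq_ne_zero hv)
  simp at this

theorem e_ne_zero [Nontrivial V] : 𝒞.e ≠ 0 := fun h => 𝒞.zero_notMem (h ▸ 𝒞.e_mem)

variable [FiniteDimensional ℝ V]

/-- This is where the normalization `(x|y) = tr(xy)` enters the argument. -/
theorem norm_primitive [Nontrivial V] {c : V} (hc : 𝒞.IsPrimitive c) : ‖c‖ = 1 := by
  have h1 : 𝒞.mul c c = c := hc.1
  have h := 𝒞.inner_eq_tr c c
  rw [h1, hc.tr_eq_one, real_inner_self_eq_norm_sq] at h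
  exact (pow_eq_one_iff_of_nonneg (norm_nonneg c) two_ne_zero).1 h

theorem inner_e_primitive [Nontrivial V] {c : V} (hc : 𝒞.IsPrimitive c) : ⟪c, 𝒞.e⟫ = 1 := by
  have h1 : 𝒞.mul c c = c := hc.1
  rw [real_inner_comm, ← h1, 𝒞.inner_e_sq, 𝒞.norm_primitive hc, one_pow]

/-- The spectral decomposition of a point of the cone. -/
theorem exists_frame [Nontrivial V] {x : V} (hx : x ∈ 𝒞.Ω) :
    ∃ (r : ℕ) (c : Fin r → V) (l : Fin r → ℝ), 𝒞.IsJordanFrame c ∧ x = ∑ i, l i • c i ∧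
      (∀ i, 0 < l i) ∧ 𝒞.det x = ∏ i, l i := by
  obtain ⟨r, c, l, hc, hxc, hm⟩ := 𝒞.isSpectrum_eigenvalues x
  refine ⟨r, c, l, hc, hxc, fun i => ?_, ?_⟩
  · have h1 := 𝒞.inner_pos hx (𝒞.idem_mem_closure (hc.primitive i).1) (hc.primitive i).2.1
    rw [hxc, sum_inner, Finset.sum_eq_single i] at h1
    · rw [inner_smul_left, real_inner_self_eq_norm_sq, 𝒞.norm_primitive (hc.primitive i)] at h1
      simpa using h1
    · intro j _ hj
      rw [inner_smul_left, hc.isSystem.inner_eq_zero hj, mul_zero]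
    · simp
  · rw [EuclideanJordanAlgebra.det, hm]
    rfl

/-- Orthogonal elements of the closed cone annihilate each other. -/
theorem mul_eq_zero_of_inner [Nontrivial V] {x z : V} (hx : x ∈ closure 𝒞.Ω)
    (hz : z ∈ closure 𝒞.Ω) (h : ⟪x, z⟫ = 0) : 𝒞.mul x z = 0 := by
  obtain ⟨u, rfl⟩ := 𝒞.exists_sq hx
  obtain ⟨v, rfl⟩ := 𝒞.exists_sq hz
  -- With `x = u²` resolved into idempotents and `z = v²`, each term of `(x|z)` is nonnegative and
  -- so zero. Where the coefficient is nonzero, `(c i v|v) = 0` forces `c i v = 0` and then `c i v²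
  -- = 0`.
  obtain ⟨ι, hι, c, l, hc, rfl⟩ := 𝒞.exists_system u
  rw [hc.mul_sum] at h ⊢
  rw [sum_inner] at h
  have hnn : ∀ i ∈ Finset.univ, 0 ≤ ⟪(l i * l i) • c i, 𝒞.mul v v⟫ := fun i _ =>
    𝒞.inner_nonneg (𝒞.smul_mem_closure (mul_self_nonneg _) (𝒞.idem_mem_closure (hc.idem i)))
      (𝒞.sq_mem_closure v)
  rw [Finset.sum_eq_zero_iff_of_nonneg hnn] at h
  rw [map_sum, LinearMap.sum_apply]
  refine Finset.sum_eq_zero fun i hi => ?_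
  have hi := h i hi
  rw [map_smul, LinearMap.smul_apply]
  by_cases hl : l i * l i = 0
  · rw [hl, zero_smul]
  · rw [inner_smul_left] at hi
    have h0 : ⟪c i, 𝒞.mul v v⟫ = 0 := by simpa [hl] using hi
    rw [EuclideanJordanAlgebra.IsIdempotent.inner_sq] at h0
    rw [(hc.idem i).mul_sq_eq_zero ((hc.idem i).mul_eq_zero_of_inner h0), smul_zero]

/-- The trace form of an irreducible cone is a multiple of the inner product. -/
theorem exists_trace_eq [Nontrivial V] :
    ∃ l : ℝ, 0 < l ∧ ∀ x, LinearMap.trace ℝ V (𝒞.mul x) = l * ⟪x, 𝒞.e⟫ := by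
  set a := 𝒞.traceVector with ha
  have hT := 𝒞.mul_isSymmetric a
  have hpos : 0 < Module.finrank ℝ V := Module.finrank_pos
  set l := hT.eigenvalues rfl ⟨0, hpos⟩ with hl
  have hev : Module.End.HasEigenvalue (𝒞.mul a) l := hT.hasEigenvalue_eigenvalues rfl ⟨0, hpos⟩
  -- This eigenspace and its orthogonal complement are ideals annihilating each other. The
  -- projections respect squares, the cone splits, and irreducibility leaves only one summand.
  set V₁ := Module.End.eigenspace (𝒞.mul a) l with hV₁
  have hideal₁ : ∀ x, ∀ v ∈ V₁, 𝒞.mul x v ∈ V₁ := by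
    intro x v hv
    rw [hV₁, Module.End.mem_eigenspace_iff] at hv ⊢
    rw [𝒞.traceVector_central, ← ha, hv, map_smul]
  have hideal₂ : ∀ x, ∀ v ∈ V₁ᗮ, 𝒞.mul x v ∈ V₁ᗮ := by
    intro x v hv
    rw [Submodule.mem_orthogonal] at hv ⊢
    intro u hu
    rw [← 𝒞.inner_mul]
    exact hv _ (hideal₁ x u hu)
  set P := V₁.starProjection with hP
  set Q := V₁ᗮ.starProjection with hQ
  have hPQ : ∀ w, P w + Q w = w := fun w => Submodule.starProjection_add_starProjection_orthogonal w
  have hsq : ∀ v, P (𝒞.mul v v) = 𝒞.mul (P v) (P v) ∧ Q (𝒞.mul v v) = 𝒞.mul (Q v) (Q v) := by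
    intro v
    have hp1 : P v ∈ V₁ := Submodule.starProjection_apply_mem _ _
    have hq1 : Q v ∈ V₁ᗮ := Submodule.starProjection_apply_mem _ _
    have h0 : 𝒞.mul (P v) (Q v) = 0 := by
      have h1 := hideal₂ (P v) _ hq1
      have h2 := hideal₁ (Q v) _ hp1
      rw [𝒞.mul_comm] at h2
      have := (Submodule.mem_orthogonal _ _).1 h1 _ h2
      exact inner_self_eq_zero.1 this
    have hdec : 𝒞.mul v v = 𝒞.mul (P v) (P v) + 𝒞.mul (Q v) (Q v) := by
      conv_lhs => rw [← hPQ v]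
      simp [h0, 𝒞.mul_comm (Q v) (P v)]
    have hPv : P (𝒞.mul v v) = 𝒞.mul (P v) (P v) :=
      (Submodule.eq_starProjection_of_mem_orthogonal' (hideal₁ _ _ hp1) (hideal₂ _ _ hq1) hdec)
    refine ⟨hPv, ?_⟩
    have h3 := hPQ (𝒞.mul v v)
    rw [hPv] at h3
    exact add_left_cancel (h3.trans hdec)
  have hinnerP : ∀ x v, ⟪P x, 𝒞.mul v v⟫ = ⟪x, 𝒞.mul (P v) (P v)⟫ := fun x v => by
    rw [← (hsq v).1, hP, Submodule.inner_starProjection_left_eq_right]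
  have hinnerQ : ∀ x v, ⟪Q x, 𝒞.mul v v⟫ = ⟪x, 𝒞.mul (Q v) (Q v)⟫ := fun x v => by
    rw [← (hsq v).2, hQ, Submodule.inner_starProjection_left_eq_right]
  have hsplit : 𝒞.Ω = P '' 𝒞.Ω + Q '' 𝒞.Ω := by
    refine Subset.antisymm (fun x hx => ?_) ?_
    · exact ⟨P x, ⟨x, hx, rfl⟩, Q x, ⟨x, hx, rfl⟩, hPQ x⟩
    · rintro _ ⟨_, ⟨x, hx, rfl⟩, _, ⟨y, hy, rfl⟩, rfl⟩
      rw [𝒞.mem_iff]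
      intro z hz hz0
      obtain ⟨v, rfl⟩ := 𝒞.exists_sq hz
      have hv : v ≠ 0 := by rintro rfl; simp at hz0
      rw [inner_add_left, hinnerP, hinnerQ]
      have hn1 := 𝒞.inner_nonneg (subset_closure hx) (𝒞.sq_mem_closure (P v))
      have hn2 := 𝒞.inner_nonneg (subset_closure hy) (𝒞.sq_mem_closure (Q v))
      by_cases hp : P v = 0
      · have hq : Q v ≠ 0 := by
          intro hq
          apply hv
          rw [← hPQ v, hp, hq, add_zero]
        have := 𝒞.inner_pos hy (𝒞.sq_mem_closure (Q v)) (𝒞.sq_ne_zero hq)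
        linarith
      · have := 𝒞.inner_pos hx (𝒞.sq_mem_closure (P v)) (𝒞.sq_ne_zero hp)
        linarith
  have hirr := 𝒞.isIrreducible V₁ V₁ᗮ _ _ (Submodule.isCompl_orthogonal V₁)
    (by rintro _ ⟨x, _, rfl⟩; exact Submodule.starProjection_apply_mem _ _)
    (by rintro _ ⟨x, _, rfl⟩; exact Submodule.starProjection_apply_mem _ _) hsplit
  have htop : V₁ = ⊤ := by
    rcases hirr with h | h
    · exact absurd h hev
    · exact Submodule.orthogonal_eq_bot_iff.1 h
  have hae : a = l • 𝒞.e := by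
    have : 𝒞.e ∈ V₁ := htop ▸ Submodule.mem_top
    rw [hV₁, Module.End.mem_eigenspace_iff, 𝒞.mul_e] at this
    exact this
  have hfin : ∀ x, LinearMap.trace ℝ V (𝒞.mul x) = l * ⟪x, 𝒞.e⟫ := by
    intro x
    rw [← 𝒞.inner_traceVector, ← ha, hae, inner_smul_left, real_inner_comm]
    simp
  refine ⟨l, ?_, hfin⟩
  -- At `e` the trace is the dimension, which determines the sign of `l`.
  have h1 := hfin 𝒞.e
  have h2 : 𝒞.mul 𝒞.e = LinearMap.id := by ext x; simp [𝒞.e_mul]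
  rw [h2, LinearMap.trace_id, real_inner_self_eq_norm_sq] at h1
  have h3 : (0 : ℝ) < Module.finrank ℝ V := by exact_mod_cast hpos
  have h4 : 0 < ‖𝒞.e‖ ^ 2 := by have := norm_pos_iff.2 𝒞.e_ne_zero; positivity
  rw [h1] at h3
  exact (pos_iff_pos_of_mul_pos h3).2 h4

end JordanCone
end ConeLP

namespace ConeLP

/-! ### Automorphisms of the cone -/

section Aut

variable {V : Type*} [NormedAddCommGroup V] [InnerProductSpace ℝ V] {Ω : Set V}

theorem coneAut_apply_mem {g : V ≃L[ℝ] V} (hg : g ∈ coneAut Ω) {x : V} (hx : x ∈ Ω) : g x ∈ Ω := by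
  have h : g '' Ω = Ω := hg
  rw [← h]; exact ⟨x, hx, rfl⟩

theorem coneAut_symm {g : V ≃L[ℝ] V} (hg : g ∈ coneAut Ω) : g.symm ∈ coneAut Ω := by
  have h : g '' Ω = Ω := hg
  change g.symm '' Ω = Ω
  conv_lhs => rw [← h]
  rw [image_image]
  simp

theorem mem_coneAut_of {g : V ≃L[ℝ] V} (h1 : ∀ x ∈ Ω, g x ∈ Ω) (h2 : ∀ x ∈ Ω, g.symm x ∈ Ω) :
    g ∈ coneAut Ω := by
  refine Subset.antisymm ?_ fun x hx => ⟨g.symm x, h2 x hx, by simp⟩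
  rintro _ ⟨x, hx, rfl⟩
  exact h1 x hx

theorem coneAut_refl : ContinuousLinearEquiv.refl ℝ V ∈ coneAut Ω :=
  mem_coneAut_of (fun _ h => h) (fun _ h => h)

theorem coneAut_trans {g h : V ≃L[ℝ] V} (hg : g ∈ coneAut Ω) (hh : h ∈ coneAut Ω) :
    g.trans h ∈ coneAut Ω :=
  mem_coneAut_of (fun _ hx => coneAut_apply_mem hh (coneAut_apply_mem hg hx))
    (fun _ hx => coneAut_apply_mem (coneAut_symm hg) (coneAut_apply_mem (coneAut_symm hh) hx))

theorem coneAut_apply_mem_closure {g : V ≃L[ℝ] V} (hg : g ∈ coneAut Ω) {x : V}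
    (hx : x ∈ closure Ω) : g x ∈ closure Ω := by
  have h : g '' Ω = Ω := hg
  rw [← h, ← g.coe_toHomeomorph, ← g.toHomeomorph.image_closure]
  exact ⟨x, hx, rfl⟩

variable [FiniteDimensional ℝ V]

/-- The adjoint of a linear bijection. -/
def adjointEquiv (g : V ≃L[ℝ] V) : V ≃L[ℝ] V :=
  have := FiniteDimensional.complete ℝ V
  ContinuousLinearEquiv.equivOfInverse (ContinuousLinearMap.adjoint (g : V →L[ℝ] V))
    (ContinuousLinearMap.adjoint (g.symm : V →L[ℝ] V))
    (fun x => ext_inner_right ℝ fun y => by simp [ContinuousLinearMap.adjoint_inner_left])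
    (fun x => ext_inner_right ℝ fun y => by simp [ContinuousLinearMap.adjoint_inner_left])

theorem adjointEquiv_inner_left (g : V ≃L[ℝ] V) (x y : V) : ⟪adjointEquiv g x, y⟫ = ⟪x, g y⟫ := by
  have := FiniteDimensional.complete ℝ V
  exact ContinuousLinearMap.adjoint_inner_left _ _ _

theorem adjointEquiv_inner_right (g : V ≃L[ℝ] V) (x y : V) : ⟪x, adjointEquiv g y⟫ = ⟪g x, y⟫ := by
  rw [real_inner_comm, adjointEquiv_inner_left, real_inner_comm]

theorem adjointEquiv_symm_inner_left (g : V ≃L[ℝ] V) (x y : V) :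
    ⟪(adjointEquiv g).symm x, y⟫ = ⟪x, g.symm y⟫ := by
  have := FiniteDimensional.complete ℝ V
  exact ContinuousLinearMap.adjoint_inner_left (g.symm : V →L[ℝ] V) _ _

theorem det_adjointEquiv (g : V ≃L[ℝ] V) :
    LinearMap.det ((adjointEquiv g : V →L[ℝ] V) : V →ₗ[ℝ] V) =
      LinearMap.det ((g : V →L[ℝ] V) : V →ₗ[ℝ] V) := by
  have h : ((adjointEquiv g : V →L[ℝ] V) : V →ₗ[ℝ] V) =
      LinearMap.adjoint ((g : V →L[ℝ] V) : V →ₗ[ℝ] V) := by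
    rw [LinearMap.eq_adjoint_iff]
    exact fun x y => adjointEquiv_inner_left g x y
  classical
  set b := stdOrthonormalBasis ℝ V
  rw [h, ← LinearMap.det_toMatrix b.toBasis, LinearMap.toMatrix_adjoint, ← LinearMap.det_toMatrix b.toBasis,
    Matrix.det_conjTranspose]
  simp

/-- The absolute value of the determinant of a linear bijection. -/
def absDet (g : V ≃L[ℝ] V) : ℝ := |LinearMap.det ((g : V →L[ℝ] V) : V →ₗ[ℝ] V)|

theorem absDet_trans (g h : V ≃L[ℝ] V) : absDet (g.trans h) = absDet g * absDet h := by
  rw [absDet, absDet, absDet, ← abs_mul, mul_comm, ← LinearMap.det_comp]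
  rfl

theorem absDet_refl : absDet (ContinuousLinearEquiv.refl ℝ V) = 1 := by
  have : ((ContinuousLinearEquiv.refl ℝ V : V →L[ℝ] V) : V →ₗ[ℝ] V) = LinearMap.id := rfl
  rw [absDet, this, LinearMap.det_id, abs_one]

theorem absDet_symm_mul (g : V ≃L[ℝ] V) : absDet g.symm * absDet g = 1 := by
  rw [← absDet_trans, ContinuousLinearEquiv.symm_trans_self, absDet_refl]

theorem absDet_pos (g : V ≃L[ℝ] V) : 0 < absDet g := by
  refine lt_of_le_of_ne (abs_nonneg _) fun h => ?_
  have := absDet_symm_mul g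
  rw [← h, mul_zero] at this
  exact zero_ne_one this

theorem absDet_adjointEquiv (g : V ≃L[ℝ] V) : absDet (adjointEquiv g) = absDet g := by
  rw [absDet, det_adjointEquiv, absDet]

theorem exists_abs_det_le (R : ℝ) :
    ∃ B : ℝ, 0 < B ∧ ∀ g : V ≃L[ℝ] V, ‖(g : V →L[ℝ] V)‖ ≤ R → absDet g ≤ B := by
  have := FiniteDimensional.proper ℝ (V →L[ℝ] V)
  have hdet : Continuous fun A : V →L[ℝ] V => LinearMap.det (A : V →ₗ[ℝ] V) :=
    ContinuousLinearMap.continuous_det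
  obtain ⟨B, hB⟩ := (isCompact_closedBall (0 : V →L[ℝ] V) R).exists_bound_of_continuousOn
    hdet.continuousOn
  refine ⟨max B 1, by positivity, fun g hg => (hB g ?_).trans (le_max_left _ _)⟩
  simpa using hg

end Aut

namespace JordanCone

variable {V : Type*} [NormedAddCommGroup V] [InnerProductSpace ℝ V] (𝒞 : JordanCone V)

theorem interior_closure : interior (closure 𝒞.Ω) = 𝒞.Ω := by
  have ho := 𝒞.isSymmetricCone.isOpen
  rw [𝒞.isSymmetricCone.convex.interior_closure_eq_interior_of_nonempty_interior, ho.interior_eq]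
  rw [ho.interior_eq]
  exact ⟨_, 𝒞.e_mem⟩

variable [FiniteDimensional ℝ V]

theorem adjointEquiv_mem {g : V ≃L[ℝ] V} (hg : g ∈ coneAut 𝒞.Ω) :
    adjointEquiv g ∈ coneAut 𝒞.Ω := by
  refine mem_coneAut_of (fun x hx => ?_) (fun x hx => ?_)
  · rw [𝒞.mem_iff]
    intro y hy hy0
    rw [adjointEquiv_inner_left]
    exact 𝒞.inner_pos hx (coneAut_apply_mem_closure hg hy) (by simpa using hy0)
  · rw [𝒞.mem_iff]
    intro y hy hy0
    rw [adjointEquiv_symm_inner_left]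
    exact 𝒞.inner_pos hx (coneAut_apply_mem_closure (coneAut_symm hg) hy) (by simpa using hy0)

/-! ### Flows of multiplication operators preserve the cone -/

variable [Nontrivial V]

/-- At a first exit time the orbit is orthogonal to some nonzero `z` in the closed cone. The
hypothesis makes the derivative of `(y(t)|z)` positive there, although this function decreases to
zero from positive values. -/
theorem exp_apply_mem_of_pos {B : V →L[ℝ] V}
    (hB : ∀ y ∈ closure 𝒞.Ω, ∀ z ∈ closure 𝒞.Ω, y ≠ 0 → z ≠ 0 → ⟪y, z⟫ = 0 → 0 < ⟪B y, z⟫)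
    {x : V} (hx : x ∈ 𝒞.Ω) : NormedSpace.exp B x ∈ 𝒞.Ω := by
  have := FiniteDimensional.complete ℝ V
  by_contra hcon
  set y : ℝ → V := fun t => NormedSpace.exp (t • B) x with hy
  have hyc : Continuous y := by
    have h1 : Continuous fun t : ℝ => NormedSpace.exp (t • B) :=
      continuous_exp_clm.comp (continuous_id.smul continuous_const)
    exact h1.clm_apply continuous_const
  have hyd : ∀ t, HasDerivAt y (B (y t)) t := by
    intro t
    have h1 := (hasDerivAt_exp_smul_const' B t).clm_apply (hasDerivAt_const t x)
    simpa using h1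
  set S := {t : ℝ | t ∈ Icc (0 : ℝ) 1 ∧ y t ∉ 𝒞.Ω} with hS
  have hSne : S.Nonempty := ⟨1, by simp, by simpa [hy] using hcon⟩
  have hScl : IsClosed S :=
    isClosed_Icc.inter ((𝒞.isSymmetricCone.isOpen.preimage hyc).isClosed_compl)
  have hSbdd : BddBelow S := ⟨0, fun t ht => ht.1.1⟩
  set t₀ := sInf S with ht₀
  have ht₀S : t₀ ∈ S := hScl.csInf_mem hSne hSbdd
  have hy0 : y 0 = x := by simp [hy]
  have ht₀pos : 0 < t₀ := by
    refine lt_of_le_of_ne ht₀S.1.1 fun h => ht₀S.2 ?_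
    rw [← h, hy0]; exact hx
  have hbefore : ∀ t ∈ Ioo 0 t₀, y t ∈ 𝒞.Ω := by
    intro t ht
    by_contra hn
    have : t₀ ≤ t := csInf_le hSbdd ⟨⟨ht.1.le, ht.2.le.trans ht₀S.1.2⟩, hn⟩
    exact absurd ht.2 (not_lt.2 this)
  have hmem : ∀ᶠ t in nhdsWithin t₀ (Iio t₀), y t ∈ 𝒞.Ω := by
    filter_upwards [Ioo_mem_nhdsLT ht₀pos] with t ht using hbefore t ht
  have hcl : y t₀ ∈ closure 𝒞.Ω :=
    mem_closure_of_tendsto ((hyc.tendsto t₀).mono_left nhdsWithin_le_nhds) hmem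
  have hyne : y t₀ ≠ 0 := by
    intro h
    have h1 := DFunLike.congr_fun (exp_mul_exp_neg (-(t₀ • B))) x
    rw [neg_neg, mul_apply_eq_comp] at h1
    have h2 : NormedSpace.exp (t₀ • B) x = 0 := h
    rw [h2, map_zero] at h1
    exact 𝒞.zero_notMem (by rw [h1]; exact hx)
  obtain ⟨z, hz, hz0, hle⟩ : ∃ z ∈ closure 𝒞.Ω, z ≠ 0 ∧ ⟪y t₀, z⟫ ≤ 0 := by
    have := ht₀S.2
    rw [𝒞.mem_iff] at this
    push Not at this
    exact this
  have hzero : ⟪y t₀, z⟫ = 0 := le_antisymm hle (𝒞.inner_nonneg hcl hz)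
  have hpos := hB _ hcl _ hz hyne hz0 hzero
  have hder : HasDerivAt (fun t => ⟪y t, z⟫) ⟪B (y t₀), z⟫ t₀ := by
    simpa using (hyd t₀).inner ℝ (hasDerivAt_const t₀ z)
  have hslope := (hasDerivAt_iff_tendsto_slope.1 hder).mono_left
    (nhdsWithin_mono t₀ (show Iio t₀ ⊆ {t₀}ᶜ from fun t ht => (ne_of_lt ht)))
  refine absurd hpos (not_lt.2 (le_of_tendsto hslope ?_))
  filter_upwards [hmem, self_mem_nhdsWithin] with t ht htlt
  rw [slope_def_field, hzero, sub_zero]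
  exact div_nonpos_of_nonneg_of_nonpos (𝒞.inner_pos ht hz hz0).le (sub_nonpos.2 (le_of_lt htlt))

/-- Adding `t (e|·) e` with `t > 0` makes the boundary condition strict; then `t` tends to zero. -/
theorem exp_apply_mem_closure {A : V →L[ℝ] V}
    (hA : ∀ y ∈ closure 𝒞.Ω, ∀ z ∈ closure 𝒞.Ω, ⟪y, z⟫ = 0 → ⟪A y, z⟫ = 0)
    {x : V} (hx : x ∈ 𝒞.Ω) : NormedSpace.exp A x ∈ closure 𝒞.Ω := by
  set E : V →L[ℝ] V := (innerSL ℝ 𝒞.e).smulRight 𝒞.e with hE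
  have hlim : Filter.Tendsto (fun t : ℝ => NormedSpace.exp (A + t • E) x)
      (nhdsWithin 0 (Ioi 0)) (nhds (NormedSpace.exp A x)) := by
    have h1 : Continuous fun t : ℝ => NormedSpace.exp (A + t • E) x :=
      (continuous_exp_clm.comp (continuous_const.add (continuous_id.smul continuous_const))).clm_apply
        continuous_const
    simpa using (h1.tendsto 0).mono_left nhdsWithin_le_nhds
  refine mem_closure_of_tendsto hlim ?_
  filter_upwards [self_mem_nhdsWithin] with t ht
  refine 𝒞.exp_apply_mem_of_pos (fun y hy z hz hy0 hz0 hyz => ?_) hx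
  have h1 := 𝒞.inner_pos 𝒞.e_mem hy hy0
  have h2 := 𝒞.inner_pos 𝒞.e_mem hz hz0
  have h3 : ⟪(A + t • E) y, z⟫ = t * (⟪𝒞.e, y⟫ * ⟪𝒞.e, z⟫) := by
    simp [inner_add_left, inner_smul_left, hA y hy z hz hyz, hE]
  rw [h3]
  exact mul_pos ht (mul_pos h1 h2)

/-- If `(y|z) = 0` in the closed cone then `yz = 0`, so `(ay|z) = (a|yz) = 0` and the flow preserves
the closed cone. The same for `-a` gives a bijection of the closure, hence of its interior. -/
theorem expEquiv_mem (a : V) : expEquiv (𝒞.mulL a) ∈ coneAut 𝒞.Ω := by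
  have key : ∀ b : V, ∀ x ∈ closure 𝒞.Ω, expEquiv (𝒞.mulL b) x ∈ closure 𝒞.Ω := by
    intro b x hx
    have h1 : MapsTo (expEquiv (𝒞.mulL b)) 𝒞.Ω (closure 𝒞.Ω) := fun x hx => by
      refine 𝒞.exp_apply_mem_closure (fun y hy z hz hyz => ?_) hx
      rw [EuclideanJordanAlgebra.mulL_apply, 𝒞.mul_comm, 𝒞.inner_mul,
        𝒞.mul_eq_zero_of_inner hy hz hyz, inner_zero_right]
    have := h1.closure (expEquiv (𝒞.mulL b)).continuous hx
    rwa [closure_closure] at this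
  have hsymm : ∀ x, (expEquiv (𝒞.mulL a)).symm x = expEquiv (𝒞.mulL (-a)) x := fun x => by
    rw [expEquiv_symm_apply, expEquiv_apply, EuclideanJordanAlgebra.mulL_neg]
  have himg : expEquiv (𝒞.mulL a) '' closure 𝒞.Ω = closure 𝒞.Ω := by
    refine Subset.antisymm ?_ fun x hx => ⟨(expEquiv (𝒞.mulL a)).symm x, ?_, by simp⟩
    · rintro _ ⟨x, hx, rfl⟩
      exact key a x hx
    · rw [hsymm]
      exact key (-a) x hx
  change expEquiv (𝒞.mulL a) '' 𝒞.Ω = 𝒞.Ω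
  conv_lhs => rw [← 𝒞.interior_closure]
  rw [← ContinuousLinearEquiv.coe_toHomeomorph, Homeomorph.image_interior,
    ContinuousLinearEquiv.coe_toHomeomorph, himg, 𝒞.interior_closure]

/-- The constant in `Tr L(x) = κ (x|e)`. -/
def traceConst : ℝ := 𝒞.exists_trace_eq.choose

theorem traceConst_pos : 0 < 𝒞.traceConst := 𝒞.exists_trace_eq.choose_spec.1

theorem trace_mul (x : V) : LinearMap.trace ℝ V (𝒞.mul x) = 𝒞.traceConst * ⟪x, 𝒞.e⟫ :=
  𝒞.exists_trace_eq.choose_spec.2 x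

theorem absDet_expEquiv (a : V) :
    absDet (expEquiv (𝒞.mulL a)) = Real.exp (𝒞.traceConst * ⟪a, 𝒞.e⟫) := by
  rw [← 𝒞.trace_mul]
  have h := exp_det_of_isSymmetric (𝒞.mulL a) (𝒞.mul_isSymmetric a)
  rw [absDet]
  exact (congrArg abs h).trans (abs_of_pos (Real.exp_pos _))

/-! ### Order intervals and the stabilizer of the identity -/

theorem norm_sq_sum_frame {r : ℕ} {c : Fin r → V} (hc : 𝒞.IsJordanFrame c) (l : Fin r → ℝ) :
    ‖∑ i, l i • c i‖ ^ 2 = ∑ i, l i ^ 2 := by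
  rw [← real_inner_self_eq_norm_sq, sum_inner]
  refine Finset.sum_congr rfl fun i _ => ?_
  rw [inner_sum, Finset.sum_eq_single i]
  · rw [inner_smul_left, inner_smul_right, real_inner_self_eq_norm_sq,
      𝒞.norm_primitive (hc.primitive i)]
    simp [pow_two]
  · intro j _ hj
    rw [inner_smul_left, inner_smul_right, hc.isSystem.inner_eq_zero hj.symm]
    simp
  · simp

/-- The squares of the eigenvalues of `v` add up to `‖v‖²`, so no eigenvalue is below `-1`. -/
theorem e_add_mem_closure {v : V} (hv : ‖v‖ ≤ 1) : 𝒞.e + v ∈ closure 𝒞.Ω := by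
  obtain ⟨r, c, l, hc, hxc, -⟩ := 𝒞.isSpectrum_eigenvalues v
  have h1 : ∑ i, l i ^ 2 ≤ 1 := by
    rw [← 𝒞.norm_sq_sum_frame hc, ← hxc]
    exact pow_le_one₀ (norm_nonneg v) hv
  have h2 : ∀ i, 0 ≤ 1 + l i := by
    intro i
    have h3 : l i ^ 2 ≤ 1 :=
      (Finset.single_le_sum (fun j _ => sq_nonneg (l j)) (Finset.mem_univ i)).trans h1
    have := (abs_le.1 ((sq_le_one_iff_abs_le_one (l i)).1 h3)).1
    linarith
  have h4 : 𝒞.e + v = ∑ i, (1 + l i) • c i := by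
    simp only [add_smul, one_smul, Finset.sum_add_distrib]
    rw [hc.sum_eq, ← hxc]
  rw [h4, 𝒞.mem_closure_iff]
  intro y hy
  rw [sum_inner]
  refine Finset.sum_nonneg fun i _ => ?_
  rw [inner_smul_left]
  exact mul_nonneg (h2 i) (𝒞.inner_nonneg (𝒞.idem_mem_closure (hc.primitive i).1) hy)

theorem abs_inner_le (v : V) {z : V} (hz : z ∈ closure 𝒞.Ω) : |⟪v, z⟫| ≤ ‖v‖ * ⟪𝒞.e, z⟫ := by
  have key : ∀ w : V, ‖w‖ ≤ 1 → -⟪w, z⟫ ≤ ⟪𝒞.e, z⟫ := by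
    intro w hw
    have := 𝒞.inner_nonneg (𝒞.e_add_mem_closure hw) hz
    rw [inner_add_left] at this
    linarith
  by_cases hv : v = 0
  · simp [hv]
  have hn : 0 < ‖v‖ := norm_pos_iff.2 hv
  have hw : ‖‖v‖⁻¹ • v‖ ≤ 1 := by rw [norm_smul, norm_inv, norm_norm, inv_mul_cancel₀ hn.ne']
  have h1 := key _ hw
  have h2 := key (-(‖v‖⁻¹ • v)) (by rwa [norm_neg])
  rw [inner_neg_left, inner_smul_left] at h2
  rw [inner_smul_left] at h1
  simp only [conj_trivial] at h1 h2
  have h3 : ⟪v, z⟫ = ‖v‖ * (‖v‖⁻¹ * ⟪v, z⟫) := by rw [← mul_assoc, mul_inv_cancel₀ hn.ne', one_mul]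
  rw [h3, abs_mul, abs_of_pos hn]
  exact mul_le_mul_of_nonneg_left (abs_le.2 ⟨by linarith, by linarith⟩) hn.le

/-- Both `M e + w` and `M e - w` lie in the closed self-dual cone, so their inner product `M²‖e‖² -
‖w‖²` is nonnegative. -/
theorem norm_le_of_abs_inner_le {w : V} {M : ℝ} (hM : 0 ≤ M)
    (h : ∀ z ∈ closure 𝒞.Ω, |⟪w, z⟫| ≤ M * ⟪𝒞.e, z⟫) : ‖w‖ ≤ M * ‖𝒞.e‖ := by
  have h1 : M • 𝒞.e + w ∈ closure 𝒞.Ω := 𝒞.mem_closure_iff.2 fun z hz => by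
    rw [inner_add_left, inner_smul_left]
    have := (abs_le.1 (h z hz)).1
    simp only [conj_trivial]; linarith
  have h2 : M • 𝒞.e - w ∈ closure 𝒞.Ω := 𝒞.mem_closure_iff.2 fun z hz => by
    rw [inner_sub_left, inner_smul_left]
    have := (abs_le.1 (h z hz)).2
    simp only [conj_trivial]; linarith
  have h3 := 𝒞.inner_nonneg h1 h2
  rw [inner_add_left, inner_sub_right, inner_sub_right, real_inner_comm, real_inner_comm w (M • 𝒞.e),
    real_inner_self_eq_norm_sq, real_inner_self_eq_norm_sq, norm_smul, Real.norm_of_nonneg hM] at h3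
  rw [real_inner_comm] at h3
  exact abs_le_of_sq_le_sq' (by linarith) (by positivity) |>.2

/-- A positive map is controlled by its value at the order unit `e`; order bounds and norm bounds
are interchangeable up to the factor `‖e‖`. -/
theorem norm_apply_le {h : V ≃L[ℝ] V} (hh : h ∈ coneAut 𝒞.Ω) {M : ℝ} (hM : 0 ≤ M)
    (hle : ∀ z ∈ closure 𝒞.Ω, ⟪h 𝒞.e, z⟫ ≤ M * ⟪𝒞.e, z⟫) (v : V) : ‖h v‖ ≤ M * ‖𝒞.e‖ * ‖v‖ := by
  have h1 : ‖h v‖ ≤ (M * ‖v‖) * ‖𝒞.e‖ := by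
    refine 𝒞.norm_le_of_abs_inner_le (by positivity) fun z hz => ?_
    have hz' := coneAut_apply_mem_closure (𝒞.adjointEquiv_mem hh) hz
    rw [← adjointEquiv_inner_right]
    refine (𝒞.abs_inner_le v hz').trans ?_
    rw [adjointEquiv_inner_right]
    have := mul_le_mul_of_nonneg_left (hle z hz) (norm_nonneg v)
    linarith
  linarith

theorem norm_stabilizer_le {k : V ≃L[ℝ] V} (hk : k ∈ coneAut 𝒞.Ω) (hke : k 𝒞.e = 𝒞.e) :
    ‖(k : V →L[ℝ] V)‖ ≤ ‖𝒞.e‖ := by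
  refine ContinuousLinearMap.opNorm_le_bound _ (norm_nonneg _) fun v => ?_
  have := 𝒞.norm_apply_le hk zero_le_one (fun z _ => by rw [hke, one_mul]) v
  simpa using this

/-- All powers of `k` and of its inverse fix `e` and are uniformly bounded, so their determinants
cannot grow. -/
theorem absDet_stabilizer {k : V ≃L[ℝ] V} (hk : k ∈ coneAut 𝒞.Ω) (hke : k 𝒞.e = 𝒞.e) :
    absDet k = 1 := by
  obtain ⟨B, -, hB⟩ := exists_abs_det_le (V := V) ‖𝒞.e‖
  have key : ∀ k : V ≃L[ℝ] V, k ∈ coneAut 𝒞.Ω → k 𝒞.e = 𝒞.e → absDet k ≤ 1 := by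
    intro k hk hke
    have hpow : ∀ n : ℕ, ∃ k' : V ≃L[ℝ] V, k' ∈ coneAut 𝒞.Ω ∧ k' 𝒞.e = 𝒞.e ∧
        absDet k' = absDet k ^ n := by
      intro n
      induction n with
      | zero => exact ⟨ContinuousLinearEquiv.refl ℝ V, coneAut_refl, rfl, by simp [absDet_refl]⟩
      | succ n ih =>
        obtain ⟨k', h1, h2, h3⟩ := ih
        exact ⟨k'.trans k, coneAut_trans h1 hk, by simp [h2, hke], by
          rw [absDet_trans, h3, pow_succ]⟩
    by_contra! hgt
    obtain ⟨n, hn⟩ := pow_unbounded_of_one_lt B hgt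
    obtain ⟨k', h1, h2, h3⟩ := hpow n
    have := hB k' (𝒞.norm_stabilizer_le h1 h2)
    linarith
  refine le_antisymm (key k hk hke) ?_
  have h1 := key k.symm (coneAut_symm hk) (by rw [ContinuousLinearEquiv.symm_apply_eq, hke])
  have h2 := absDet_symm_mul k
  nlinarith [absDet_pos k]

theorem absDet_eq_of_apply_e {g h : V ≃L[ℝ] V} (hg : g ∈ coneAut 𝒞.Ω) (hh : h ∈ coneAut 𝒞.Ω)
    (hgh : g 𝒞.e = h 𝒞.e) : absDet g = absDet h := by
  have h1 := 𝒞.absDet_stabilizer (coneAut_trans hg (coneAut_symm hh)) (by simp [hgh])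
  rw [absDet_trans] at h1
  have h2 := absDet_symm_mul h
  have h3 := absDet_pos h.symm
  have : absDet h.symm * absDet g = absDet h.symm * absDet h := by rw [h2, mul_comm, h1]
  exact mul_left_cancel₀ h3.ne' this

theorem exp_mulL_frame {r : ℕ} {c : Fin r → V} (hc : 𝒞.IsJordanFrame c) (t : Fin r → ℝ) :
    expEquiv (𝒞.mulL (∑ i, t i • c i)) 𝒞.e = ∑ i, Real.exp (t i) • c i := by
  conv_lhs => rw [← hc.sum_eq]
  rw [map_sum]
  refine Finset.sum_congr rfl fun i _ => ?_
  rw [expEquiv_apply]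
  refine exp_apply_of_eigenvector _ ?_
  rw [EuclideanJordanAlgebra.mulL_apply, map_sum 𝒞.mul, LinearMap.sum_apply, Finset.sum_eq_single i]
  · have : 𝒞.mul (c i) (c i) = c i := (hc.primitive i).1
    rw [map_smul, LinearMap.smul_apply, this]
  · intro j _ hj
    rw [map_smul, LinearMap.smul_apply, hc.orthogonal j i hj, smul_zero]
  · simp

/-- The logarithm of a point of the cone. -/
theorem exists_log {x : V} (hx : x ∈ 𝒞.Ω) :
    ∃ a, expEquiv (𝒞.mulL a) 𝒞.e = x ∧ 𝒞.det x = Real.exp ⟪a, 𝒞.e⟫ ∧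
      ⟪a, 𝒞.e⟫ ≤ ⟪x - 𝒞.e, 𝒞.e⟫ ∧ (‖x - 𝒞.e‖ ≤ 1 / 2 → ‖a‖ ≤ 2 * ‖x - 𝒞.e‖) := by
  obtain ⟨r, c, l, hc, hxc, hl, hdet⟩ := 𝒞.exists_frame hx
  have hinner : ∀ t : Fin r → ℝ, ⟪∑ i, t i • c i, 𝒞.e⟫ = ∑ i, t i := by
    intro t
    rw [sum_inner]
    refine Finset.sum_congr rfl fun i _ => ?_
    rw [inner_smul_left, 𝒞.inner_e_primitive (hc.primitive i)]
    simp
  have hsub : x - 𝒞.e = ∑ i, (l i - 1) • c i := by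
    simp only [sub_smul, one_smul, Finset.sum_sub_distrib]
    rw [hc.sum_eq, ← hxc]
  refine ⟨∑ i, Real.log (l i) • c i, ?_, ?_, ?_, ?_⟩
  · rw [𝒞.exp_mulL_frame hc, hxc]
    refine Finset.sum_congr rfl fun i _ => ?_
    rw [Real.exp_log (hl i)]
  · rw [hinner, Real.exp_sum, hdet]
    exact Finset.prod_congr rfl fun i _ => (Real.exp_log (hl i)).symm
  -- The inequality `log λ ≤ λ - 1`, summed over the eigenvalues.
  · rw [hinner, hsub, hinner]
    exact Finset.sum_le_sum fun i _ => Real.log_le_sub_one_of_pos (hl i)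
  · intro hsmall
    have h1 : ∑ i, (l i - 1) ^ 2 ≤ (1 / 2) ^ 2 := by
      rw [← 𝒞.norm_sq_sum_frame hc, ← hsub]
      exact pow_le_pow_left₀ (norm_nonneg _) hsmall 2
    refine abs_le_of_sq_le_sq' ?_ (by positivity) |>.2
    rw [mul_pow, 𝒞.norm_sq_sum_frame hc, hsub, 𝒞.norm_sq_sum_frame hc, Finset.mul_sum]
    refine Finset.sum_le_sum fun i _ => ?_
    have h2 : (l i - 1) ^ 2 ≤ (1 / 2) ^ 2 :=
      (Finset.single_le_sum (fun j _ => sq_nonneg (l j - 1)) (Finset.mem_univ i)).trans h1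
    have h3 := abs_le.1 (abs_le_of_sq_le_sq h2 (by norm_num))
    have h4 := Real.log_le_sub_one_of_pos (hl i)
    have h5 := Real.one_sub_inv_le_log_of_pos (hl i)
    rw [← mul_pow, sq_le_sq]
    rcases le_total 1 (l i) with h6 | h6
    · rw [abs_of_nonneg (Real.log_nonneg h6), abs_of_nonneg (by linarith)]
      linarith
    · rw [abs_of_nonpos (Real.log_nonpos (hl i).le h6), abs_of_nonpos (by linarith)]
      have h7 : (l i)⁻¹ - 1 = (1 - l i) * (l i)⁻¹ := by
        rw [sub_mul, one_mul, mul_inv_cancel₀ (hl i).ne']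
      have h8 : (l i)⁻¹ ≤ 2 := by
        rw [inv_le_comm₀ (hl i) two_pos]
        linarith [h3.1]
      nlinarith

/-- Elements of the stabilizer of `e` preserve the trace. -/
theorem inner_stabilizer_e {k : V ≃L[ℝ] V} (hk : k ∈ coneAut 𝒞.Ω) (hke : k 𝒞.e = 𝒞.e) (a : V) :
    ⟪k a, 𝒞.e⟫ = ⟪a, 𝒞.e⟫ := by
  have := FiniteDimensional.complete ℝ V
  -- If `b` is a logarithm of `k exp(tL(a)) e`, comparing determinants gives `(b|e) = t (a|e)`. The
  -- bound `(b|e) ≤ (x - e|e)` then makes `t = 0` a minimum, and its critical equation is the claim.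
  set F : ℝ → ℝ := fun t => ⟪k (NormedSpace.exp (t • 𝒞.mulL a) 𝒞.e) - 𝒞.e, 𝒞.e⟫ - t * ⟪a, 𝒞.e⟫
    with hF
  have hF0 : F 0 = 0 := by simp [hF, hke]
  have hmin : ∀ t, F 0 ≤ F t := by
    intro t
    rw [hF0]
    have hta := 𝒞.expEquiv_mem (t • a)
    have hmem := coneAut_apply_mem hk (coneAut_apply_mem hta 𝒞.e_mem)
    obtain ⟨b, hb1, -, hb2, -⟩ := 𝒞.exists_log hmem
    have h1 := 𝒞.absDet_eq_of_apply_e (𝒞.expEquiv_mem b) (coneAut_trans hta hk) hb1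
    rw [absDet_trans, 𝒞.absDet_stabilizer hk hke, mul_one, absDet_expEquiv, absDet_expEquiv,
      Real.exp_eq_exp] at h1
    have h2 := mul_left_cancel₀ 𝒞.traceConst_pos.ne' h1
    rw [h2, inner_smul_left, expEquiv_apply, EuclideanJordanAlgebra.mulL_smul] at hb2
    simp only [conj_trivial] at hb2
    simp only [hF]
    linarith
  have hder : HasDerivAt F (⟪k a, 𝒞.e⟫ - ⟪a, 𝒞.e⟫) 0 := by
    have h1 := (hasDerivAt_exp_smul_const' (𝒞.mulL a) (0 : ℝ)).clm_apply (hasDerivAt_const 0 𝒞.e)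
    have h2 : HasDerivAt (fun t : ℝ => NormedSpace.exp (t • 𝒞.mulL a) 𝒞.e) a 0 := by
      convert h1 using 1
      simp [EuclideanJordanAlgebra.mulL_apply, 𝒞.mul_e]
    have h3 : HasDerivAt (fun t : ℝ => k (NormedSpace.exp (t • 𝒞.mulL a) 𝒞.e)) (k a) 0 :=
      (k : V →L[ℝ] V).hasFDerivAt.comp_hasDerivAt 0 h2
    have h4 : HasDerivAt (fun t : ℝ => ⟪k (NormedSpace.exp (t • 𝒞.mulL a) 𝒞.e) - 𝒞.e, 𝒞.e⟫)
        ⟪k a, 𝒞.e⟫ 0 := by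
      simpa using (h3.sub_const 𝒞.e).inner ℝ (hasDerivAt_const 0 𝒞.e)
    have h5 := h4.sub ((hasDerivAt_id (0 : ℝ)).mul_const ⟪a, 𝒞.e⟫)
    rw [one_mul] at h5
    exact h5
  have hloc : IsLocalMin F 0 := Filter.Eventually.of_forall hmin
  linarith [hloc.hasDerivAt_eq_zero hder]

/-- The stabilizer of the identity consists of isometries. -/
theorem norm_stabilizer {k : V ≃L[ℝ] V} (hk : k ∈ coneAut 𝒞.Ω) (hke : k 𝒞.e = 𝒞.e) (v : V) :
    ‖k v‖ = ‖v‖ := by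
  have := FiniteDimensional.complete ℝ V
  -- Trace preservation puts the adjoint of `k` in the stabilizer too, and the norm of `k* k` is
  -- `‖k‖²`. Thus squares of elements of this bounded set remain in it, so its supremum is at most
  -- one.
  set S : Set ℝ := {t | ∃ k : V ≃L[ℝ] V, k ∈ coneAut 𝒞.Ω ∧ k 𝒞.e = 𝒞.e ∧ t = ‖(k : V →L[ℝ] V)‖}
    with hS
  have hbdd : BddAbove S := ⟨‖𝒞.e‖, by
    rintro _ ⟨k, h1, h2, rfl⟩
    exact 𝒞.norm_stabilizer_le h1 h2⟩
  have hne : S.Nonempty := ⟨_, ContinuousLinearEquiv.refl ℝ V, coneAut_refl, rfl, rfl⟩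
  have hadj : ∀ k : V ≃L[ℝ] V, k ∈ coneAut 𝒞.Ω → k 𝒞.e = 𝒞.e → adjointEquiv k 𝒞.e = 𝒞.e :=
    fun k h1 h2 => ext_inner_right ℝ fun a => by
      rw [adjointEquiv_inner_left, real_inner_comm, 𝒞.inner_stabilizer_e h1 h2, real_inner_comm]
  have hsq : ∀ t ∈ S, t ^ 2 ≤ sSup S := by
    rintro _ ⟨k, h1, h2, rfl⟩
    refine le_csSup hbdd ⟨k.trans (adjointEquiv k), coneAut_trans h1 (𝒞.adjointEquiv_mem h1), ?_, ?_⟩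
    · simp [h2, hadj k h1 h2]
    · rw [pow_two, ← ContinuousLinearMap.norm_adjoint_comp_self]
      rfl
  have hle1 : sSup S ≤ 1 := by
    by_contra! hgt
    have h0 : ∀ t ∈ S, t ≤ √(sSup S) := fun t ht => Real.le_sqrt_of_sq_le (hsq t ht)
    have h1 := csSup_le hne h0
    have h2 : √(sSup S) < sSup S := by
      rw [Real.sqrt_lt' (by linarith)]
      nlinarith
    linarith
  have key : ∀ k : V ≃L[ℝ] V, k ∈ coneAut 𝒞.Ω → k 𝒞.e = 𝒞.e → ∀ v, ‖k v‖ ≤ ‖v‖ := by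
    intro k h1 h2 v
    have h3 : ‖(k : V →L[ℝ] V)‖ ≤ 1 := (le_csSup hbdd ⟨k, h1, h2, rfl⟩).trans hle1
    simpa using (k : V →L[ℝ] V).le_of_opNorm_le h3 v
  refine le_antisymm (key k hk hke v) ?_
  have := key k.symm (coneAut_symm hk) (by rw [ContinuousLinearEquiv.symm_apply_eq, hke]) (k v)
  simpa using this

/-! ### The determinant and the tangent norm under automorphisms -/

/-- For a logarithm `a` of `g e`, `Δ(g e)` is `exp (a|e)` and `|det exp L(a)|` is `exp (κ (a|e))`,
while `|det g|` depends only on `g e`. No uniqueness of the spectrum is needed. -/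
theorem det_apply_e {g : V ≃L[ℝ] V} (hg : g ∈ coneAut 𝒞.Ω) :
    𝒞.det (g 𝒞.e) = absDet g ^ (1 / 𝒞.traceConst) := by
  obtain ⟨a, ha, hdet, -⟩ := 𝒞.exists_log (coneAut_apply_mem hg 𝒞.e_mem)
  rw [𝒞.absDet_eq_of_apply_e hg (𝒞.expEquiv_mem a) ha.symm, absDet_expEquiv, hdet, ← Real.exp_mul]
  have := 𝒞.traceConst_pos.ne'
  congr 1
  field_simp

theorem exists_apply_e_eq {x : V} (hx : x ∈ 𝒞.Ω) : ∃ g ∈ coneAut 𝒞.Ω, g 𝒞.e = x :=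
  𝒞.isSymmetricCone.homogeneous _ 𝒞.e_mem _ hx

theorem det_apply {g : V ≃L[ℝ] V} (hg : g ∈ coneAut 𝒞.Ω) {x : V} (hx : x ∈ 𝒞.Ω) :
    𝒞.det (g x) = absDet g ^ (1 / 𝒞.traceConst) * 𝒞.det x := by
  obtain ⟨h, hh, rfl⟩ := 𝒞.exists_apply_e_eq hx
  have h1 := 𝒞.det_apply_e (coneAut_trans hh hg)
  rw [ContinuousLinearEquiv.trans_apply] at h1
  rw [h1, 𝒞.det_apply_e hh, absDet_trans, mul_comm,
    Real.mul_rpow (absDet_pos g).le (absDet_pos h).le]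

theorem det_pos {x : V} (hx : x ∈ 𝒞.Ω) : 0 < 𝒞.det x := by
  obtain ⟨h, hh, rfl⟩ := 𝒞.exists_apply_e_eq hx
  rw [𝒞.det_apply_e hh]
  exact Real.rpow_pos_of_pos (absDet_pos h) _

theorem tangentNorm_apply_e {g : V ≃L[ℝ] V} (hg : g ∈ coneAut 𝒞.Ω) (v : V) :
    𝒞.tangentNorm (g 𝒞.e) v = ‖g.symm v‖ := by
  have h : ∃ g' ∈ coneAut 𝒞.Ω, g' 𝒞.e = g 𝒞.e := ⟨g, hg, rfl⟩
  rw [tangentNorm, dif_pos h]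
  obtain ⟨h1, h2⟩ := h.choose_spec
  have h3 := 𝒞.norm_stabilizer (coneAut_trans hg (coneAut_symm h1))
    (by rw [ContinuousLinearEquiv.trans_apply, ContinuousLinearEquiv.symm_apply_eq, h2]) (g.symm v)
  simpa using h3

theorem tangentNorm_apply {g : V ≃L[ℝ] V} (hg : g ∈ coneAut 𝒞.Ω) {y : V} (hy : y ∈ 𝒞.Ω) (v : V) :
    𝒞.tangentNorm (g y) (g v) = 𝒞.tangentNorm y v := by
  obtain ⟨h, hh, rfl⟩ := 𝒞.exists_apply_e_eq hy
  have h1 := 𝒞.tangentNorm_apply_e (coneAut_trans hh hg) (g v)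
  rw [ContinuousLinearEquiv.trans_apply] at h1
  rw [h1, 𝒞.tangentNorm_apply_e hh]
  simp

theorem tangentNorm_nonneg (y v : V) : 0 ≤ 𝒞.tangentNorm y v := by
  unfold tangentNorm
  split_ifs <;> positivity

/-- Since the tangent norm does not depend on the chosen automorphism, near `e` one may use `exp
L(a)` with a logarithm `a` tending to zero. -/
theorem continuousAt_tangentNorm_e (v₀ : V) :
    ContinuousAt (fun q : V × V => 𝒞.tangentNorm q.1 q.2) (𝒞.e, v₀) := by
  classical
  have hex : ∀ y ∈ 𝒞.Ω, ∃ a, expEquiv (𝒞.mulL a) 𝒞.e = y ∧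
      (‖y - 𝒞.e‖ ≤ 1 / 2 → ‖a‖ ≤ 2 * ‖y - 𝒞.e‖) := fun y hy => by
    obtain ⟨a, h1, -, -, h2⟩ := 𝒞.exists_log hy
    exact ⟨a, h1, h2⟩
  choose! lg hlg1 hlg2 using hex
  have hΩ : ∀ᶠ y in nhds 𝒞.e, y ∈ 𝒞.Ω := 𝒞.isSymmetricCone.isOpen.mem_nhds 𝒞.e_mem
  have hlim : Filter.Tendsto lg (nhds 𝒞.e) (nhds 0) := by
    rw [tendsto_zero_iff_norm_tendsto_zero]
    have h1 : Filter.Tendsto (fun y => 2 * ‖y - 𝒞.e‖) (nhds 𝒞.e) (nhds 0) := by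
      have : Continuous fun y => 2 * ‖y - 𝒞.e‖ := by fun_prop
      simpa using this.tendsto 𝒞.e
    refine squeeze_zero' (Filter.Eventually.of_forall fun _ => norm_nonneg _) ?_ h1
    filter_upwards [hΩ, Metric.closedBall_mem_nhds 𝒞.e (show (0 : ℝ) < 1 / 2 by norm_num)]
      with y hy hy2
    exact hlg2 y hy (by simpa [dist_eq_norm] using hy2)
  have heq : (fun q : V × V => ‖NormedSpace.exp (-𝒞.mulL (lg q.1)) q.2‖) =ᶠ[nhds (𝒞.e, v₀)]
      fun q => 𝒞.tangentNorm q.1 q.2 := by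
    filter_upwards [(continuous_fst.tendsto (𝒞.e, v₀)).eventually hΩ] with q hq
    have h1 := 𝒞.tangentNorm_apply_e (𝒞.expEquiv_mem (lg q.1)) q.2
    rw [hlg1 _ hq] at h1
    rw [h1, expEquiv_symm_apply]
  have hval : 𝒞.tangentNorm 𝒞.e v₀ = ‖v₀‖ := by
    simpa using 𝒞.tangentNorm_apply_e coneAut_refl v₀
  refine Filter.Tendsto.congr' heq ?_
  simp only [hval]
  have h2 : Filter.Tendsto (fun q : V × V => NormedSpace.exp (-𝒞.mulL (lg q.1)))
      (nhds (𝒞.e, v₀)) (nhds 1) := by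
    have hc : Continuous fun a => NormedSpace.exp (-𝒞.mulL a) :=
      continuous_exp_clm.comp 𝒞.continuous_mulL.neg
    have h3 := (hc.tendsto 0).comp (hlim.comp (continuous_fst.tendsto (𝒞.e, v₀)))
    have h4 : 𝒞.mulL 0 = 0 := by ext x; simp [EuclideanJordanAlgebra.mulL_apply]
    simpa [h4, Function.comp_def] using h3
  have h5 := ((isBoundedBilinearMap_apply (𝕜 := ℝ) (E := V) (F := V)).continuous.tendsto (1, v₀)).comp
    (h2.prodMk_nhds (continuous_snd.tendsto (𝒞.e, v₀)))
  simpa [Function.comp_def] using h5.norm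

theorem continuousAt_tangentNorm {y : V} (hy : y ∈ 𝒞.Ω) (v : V) :
    ContinuousAt (fun q : V × V => 𝒞.tangentNorm q.1 q.2) (y, v) := by
  obtain ⟨g, hg, rfl⟩ := 𝒞.exists_apply_e_eq hy
  have h1 : ContinuousAt (fun q : V × V => (g.symm q.1, g.symm q.2)) (g 𝒞.e, v) := by fun_prop
  have h2 := 𝒞.continuousAt_tangentNorm_e (g.symm v)
  have h3 : ContinuousAt (fun q : V × V => 𝒞.tangentNorm (g.symm q.1) (g.symm q.2)) (g 𝒞.e, v) :=
    ContinuousAt.comp_of_eq h2 h1 (by simp)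
  refine h3.congr ?_
  have hΩ : ∀ᶠ y in nhds (g 𝒞.e), y ∈ 𝒞.Ω := 𝒞.isSymmetricCone.isOpen.mem_nhds hy
  filter_upwards [(continuous_fst.tendsto (g 𝒞.e, v)).eventually hΩ] with q hq
  exact 𝒞.tangentNorm_apply (coneAut_symm hg) hq q.2

end JordanCone
end ConeLP

namespace ConeLP

namespace JordanCone

variable {V : Type*} [NormedAddCommGroup V] [InnerProductSpace ℝ V] (𝒞 : JordanCone V)

/-! ### Comparability with respect to the order of the cone -/

/-- `x` and `y` are comparable with constant `M` in the order defined by the cone. -/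
def Comparable (M : ℝ) (x y : V) : Prop :=
  ∀ z ∈ closure 𝒞.Ω, ⟪x, z⟫ ≤ M * ⟪y, z⟫ ∧ ⟪y, z⟫ ≤ M * ⟪x, z⟫

variable {𝒞}

theorem Comparable.symm {M : ℝ} {x y : V} (h : 𝒞.Comparable M x y) : 𝒞.Comparable M y x :=
  fun z hz => ⟨(h z hz).2, (h z hz).1⟩

theorem Comparable.trans {M N : ℝ} (hM : 0 ≤ M) (hN : 0 ≤ N) {x y w : V}
    (h : 𝒞.Comparable M x y) (h' : 𝒞.Comparable N y w) : 𝒞.Comparable (M * N) x w := by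
  intro z hz
  have h1 := h z hz
  have h2 := h' z hz
  constructor
  · calc ⟪x, z⟫ ≤ M * ⟪y, z⟫ := h1.1
      _ ≤ M * (N * ⟪w, z⟫) := mul_le_mul_of_nonneg_left h2.1 hM
      _ = _ := by ring
  · calc ⟪w, z⟫ ≤ N * ⟪y, z⟫ := h2.2
      _ ≤ N * (M * ⟪x, z⟫) := mul_le_mul_of_nonneg_left h1.2 hN
      _ = _ := by ring

theorem Comparable.mem {M : ℝ} (hM : 0 ≤ M) {x y : V} (hx : x ∈ 𝒞.Ω) (h : 𝒞.Comparable M x y) :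
    y ∈ 𝒞.Ω := by
  rw [𝒞.mem_iff]
  intro z hz hz0
  have h1 := 𝒞.inner_pos hx hz hz0
  have h2 := (h z hz).1
  exact pos_of_mul_pos_right (lt_of_lt_of_le h1 h2) hM

variable [FiniteDimensional ℝ V]

theorem Comparable.apply {M : ℝ} {x y : V} (h : 𝒞.Comparable M x y) {g : V ≃L[ℝ] V}
    (hg : g ∈ coneAut 𝒞.Ω) : 𝒞.Comparable M (g x) (g y) := by
  intro z hz
  have := h _ (coneAut_apply_mem_closure (𝒞.adjointEquiv_mem hg) hz)
  simpa [adjointEquiv_inner_right] using this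

variable [Nontrivial V] (𝒞)

theorem norm_le_inner_e {z : V} (hz : z ∈ closure 𝒞.Ω) : ‖z‖ ≤ ⟪𝒞.e, z⟫ := by
  by_cases h0 : z = 0
  · simp [h0]
  have hn : 0 < ‖z‖ := norm_pos_iff.2 h0
  have := 𝒞.abs_inner_le z hz
  rw [real_inner_self_eq_norm_sq, abs_of_nonneg (by positivity), pow_two] at this
  exact le_of_mul_le_mul_left this hn

theorem isCompact_comparable {M : ℝ} (hM : 0 < M) : IsCompact {y | 𝒞.Comparable M 𝒞.e y} := by
  have := FiniteDimensional.proper ℝ V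
  refine Metric.isCompact_of_isClosed_isBounded ?_ ?_
  · have : {y | 𝒞.Comparable M 𝒞.e y} = ⋂ z ∈ closure 𝒞.Ω,
        ({y | ⟪𝒞.e, z⟫ ≤ M * ⟪y, z⟫} ∩ {y | ⟪y, z⟫ ≤ M * ⟪𝒞.e, z⟫}) := by
      ext y
      simp [Comparable]
    rw [this]
    refine isClosed_biInter fun z _ => IsClosed.inter ?_ ?_
    · exact isClosed_le continuous_const (continuous_const.mul (continuous_id.inner continuous_const))
    · exact isClosed_le (continuous_id.inner continuous_const) continuous_const
  · refine (Metric.isBounded_closedBall (x := (0 : V)) (r := M * ‖𝒞.e‖)).subset fun y hy => ?_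
    rw [mem_closedBall_zero_iff]
    have hyΩ := Comparable.mem hM.le 𝒞.e_mem hy
    refine 𝒞.norm_le_of_abs_inner_le hM.le fun z hz => ?_
    rw [abs_of_nonneg (𝒞.inner_nonneg (subset_closure hyΩ) hz)]
    exact (hy z hz).2

theorem norm_apply_le_of_comparable {h : V ≃L[ℝ] V} (hh : h ∈ coneAut 𝒞.Ω) {M : ℝ} (hM : 0 ≤ M)
    (hc : 𝒞.Comparable M 𝒞.e (h 𝒞.e)) (v : V) : ‖h v‖ ≤ M * ‖𝒞.e‖ * ‖v‖ :=
  𝒞.norm_apply_le hh hM (fun z hz => (hc z hz).2) v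

theorem comparable_symm_e {h : V ≃L[ℝ] V} (hh : h ∈ coneAut 𝒞.Ω) {M : ℝ}
    (hc : 𝒞.Comparable M 𝒞.e (h 𝒞.e)) : 𝒞.Comparable M 𝒞.e (h.symm 𝒞.e) := by
  simpa using (hc.apply (coneAut_symm hh)).symm

/-- If `g e` and `k e` are comparable, `g⁻¹ k` is a bounded operator, so its determinant is bounded.
-/
theorem exists_det_le {M : ℝ} (hM : 0 ≤ M) :
    ∃ C : ℝ, 0 < C ∧ ∀ x ∈ 𝒞.Ω, ∀ y, 𝒞.Comparable M x y → 𝒞.det y ≤ C * 𝒞.det x := by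
  obtain ⟨B, hB0, hB⟩ := exists_abs_det_le (V := V) (M * ‖𝒞.e‖)
  refine ⟨B ^ (1 / 𝒞.traceConst), Real.rpow_pos_of_pos hB0 _, fun x hx y hxy => ?_⟩
  obtain ⟨g, hg, rfl⟩ := 𝒞.exists_apply_e_eq hx
  obtain ⟨k, hk, rfl⟩ := 𝒞.exists_apply_e_eq (hxy.mem hM hx)
  have h1 := hxy.apply (coneAut_symm hg)
  rw [ContinuousLinearEquiv.symm_apply_apply] at h1
  have hkg := coneAut_trans hk (coneAut_symm hg)
  have h2 : absDet (k.trans g.symm) ≤ B := by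
    refine hB _ (ContinuousLinearMap.opNorm_le_bound _ (by positivity) fun v => ?_)
    exact 𝒞.norm_apply_le_of_comparable hkg hM h1 v
  have h3 : absDet k = absDet (k.trans g.symm) * absDet g := by
    rw [absDet_trans, mul_assoc, absDet_symm_mul, mul_one]
  rw [𝒞.det_apply_e hg, 𝒞.det_apply_e hk, h3, Real.mul_rpow (absDet_pos _).le (absDet_pos _).le]
  have h4 := 𝒞.traceConst_pos
  have h5 := absDet_pos (k.trans g.symm)
  have h6 := absDet_pos g
  gcongr

/-- Negative powers of the determinant are comparable at comparable points. -/
theorem exists_det_rpow_le {M : ℝ} (hM : 0 ≤ M) {μ : ℝ} (hμ : 0 ≤ μ) :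
    ∃ C : ℝ, 0 < C ∧ ∀ x ∈ 𝒞.Ω, ∀ y, 𝒞.Comparable M x y →
      𝒞.det y ^ (-μ) ≤ C * 𝒞.det x ^ (-μ) := by
  obtain ⟨C, hC0, hC⟩ := 𝒞.exists_det_le hM
  refine ⟨C ^ μ, Real.rpow_pos_of_pos hC0 _, fun x hx y hxy => ?_⟩
  have hy := hxy.mem hM hx
  have h1 := hC y hy x hxy.symm
  have hdx := 𝒞.det_pos hx
  have hdy := 𝒞.det_pos hy
  rw [Real.rpow_neg hdx.le, Real.rpow_neg hdy.le]
  have h2 : 𝒞.det x ^ μ ≤ C ^ μ * 𝒞.det y ^ μ := by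
    rw [← Real.mul_rpow hC0.le hdy.le]
    exact Real.rpow_le_rpow hdx.le h1 hμ
  have h3 := Real.rpow_pos_of_pos hdx μ
  have h4 := Real.rpow_pos_of_pos hdy μ
  rw [inv_le_iff_one_le_mul₀ h4, mul_assoc, mul_comm, mul_assoc]
  rw [← div_eq_inv_mul, one_le_div h3]
  linarith

/-! ### The invariant distance -/

theorem abs_inner_le_tangentNorm {y : V} (hy : y ∈ 𝒞.Ω) (v : V) {z : V} (hz : z ∈ closure 𝒞.Ω) :
    |⟪v, z⟫| ≤ 𝒞.tangentNorm y v * ⟪y, z⟫ := by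
  obtain ⟨g, hg, rfl⟩ := 𝒞.exists_apply_e_eq hy
  have h1 := 𝒞.abs_inner_le (g.symm v) (coneAut_apply_mem_closure (𝒞.adjointEquiv_mem hg) hz)
  rw [adjointEquiv_inner_right, adjointEquiv_inner_right, ContinuousLinearEquiv.apply_symm_apply] at h1
  rwa [𝒞.tangentNorm_apply_e hg]

theorem continuousOn_tangentNorm_curve {γ : ℝ → V} (hγ : ContDiff ℝ 1 γ)
    (hγΩ : ∀ t ∈ Icc (0 : ℝ) 1, γ t ∈ 𝒞.Ω) :
    ContinuousOn (fun t => 𝒞.tangentNorm (γ t) (deriv γ t)) (Icc 0 1) := by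
  intro t ht
  have h1 : Continuous (deriv γ) := hγ.continuous_deriv_one
  have h2 : ContinuousAt (fun t => (γ t, deriv γ t)) t :=
    (hγ.continuous.prodMk h1).continuousAt
  exact (ContinuousAt.comp (f := fun t => (γ t, deriv γ t))
    (𝒞.continuousAt_tangentNorm (hγΩ t ht) (deriv γ t)) h2).continuousWithinAt

/-- By `abs_inner_le_tangentNorm` the logarithmic derivative of `(γ|z)` is at most the invariant
speed; integrate it. -/
theorem comparable_of_curve {γ : ℝ → V} (hγ : ContDiff ℝ 1 γ)
    (hγΩ : ∀ t ∈ Icc (0 : ℝ) 1, γ t ∈ 𝒞.Ω) :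
    𝒞.Comparable (Real.exp (∫ t in (0 : ℝ)..1, 𝒞.tangentNorm (γ t) (deriv γ t))) (γ 0) (γ 1) := by
  set L := ∫ t in (0 : ℝ)..1, 𝒞.tangentNorm (γ t) (deriv γ t) with hL
  intro z hz
  by_cases hz0 : z = 0
  · simp [hz0]
  have hpos : ∀ t ∈ Icc (0 : ℝ) 1, 0 < ⟪γ t, z⟫ := fun t ht => 𝒞.inner_pos (hγΩ t ht) hz hz0
  have hIcc : uIcc (0 : ℝ) 1 = Icc 0 1 := uIcc_of_le zero_le_one
  have hder : ∀ t ∈ uIcc (0 : ℝ) 1, HasDerivAt (fun t => Real.log ⟪γ t, z⟫)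
      (⟪deriv γ t, z⟫ / ⟪γ t, z⟫) t := by
    intro t ht
    rw [hIcc] at ht
    have h1 : HasDerivAt γ (deriv γ t) t :=
      ((hγ.differentiable one_ne_zero) t).hasDerivAt
    have h2 : HasDerivAt (fun t => ⟪γ t, z⟫) ⟪deriv γ t, z⟫ t := by
      simpa using h1.inner ℝ (hasDerivAt_const t z)
    exact h2.log (hpos t ht).ne'
  have hcont : ContinuousOn (fun t => ⟪deriv γ t, z⟫ / ⟪γ t, z⟫) (uIcc (0 : ℝ) 1) := by
    rw [hIcc]
    refine ContinuousOn.div ?_ ?_ fun t ht => (hpos t ht).ne'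
    · exact (hγ.continuous_deriv_one.inner continuous_const).continuousOn
    · exact (hγ.continuous.inner continuous_const).continuousOn
  have hFTC := intervalIntegral.integral_eq_sub_of_hasDerivAt hder hcont.intervalIntegrable
  have hbound : |Real.log ⟪γ 1, z⟫ - Real.log ⟪γ 0, z⟫| ≤ L := by
    rw [← hFTC, hL, ← Real.norm_eq_abs]
    refine intervalIntegral.norm_integral_le_of_norm_le zero_le_one ?_ ?_
    · filter_upwards with t ht
      have ht' : t ∈ Icc (0 : ℝ) 1 := Ioc_subset_Icc_self ht
      rw [Real.norm_eq_abs, abs_div, abs_of_pos (hpos t ht'), div_le_iff₀ (hpos t ht')]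
      exact 𝒞.abs_inner_le_tangentNorm (hγΩ t ht') _ hz
    · refine ContinuousOn.intervalIntegrable ?_
      rw [hIcc]
      exact 𝒞.continuousOn_tangentNorm_curve hγ hγΩ
  have hb := abs_le.1 hbound
  have p0 := hpos 0 (by simp)
  have p1 := hpos 1 (by simp)
  constructor
  · rw [← Real.log_le_log_iff p0 (by positivity), Real.log_mul (by positivity) p1.ne', Real.log_exp]
    linarith
  · rw [← Real.log_le_log_iff p1 (by positivity), Real.log_mul (by positivity) p0.ne', Real.log_exp]
    linarith

theorem comparable_of_mem_ball {R : ℝ} {x y : V} (hx : x ∈ 𝒞.Ω) (hy : y ∈ 𝒞.ball R x) :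
    𝒞.Comparable (Real.exp R) x y := by
  obtain ⟨hyΩ, hd⟩ := hy
  rw [JordanCone.dist] at hd
  -- The segment from `x` to `y` shows that the set of lengths is nonempty, so the infimum is not
  -- the default value for an empty set.
  obtain ⟨L, ⟨γ, hγ, hγΩ, h0, h1, rfl⟩, hlt⟩ := exists_lt_of_csInf_lt (by
    refine ⟨_, fun t : ℝ => x + t • (y - x), by fun_prop, fun t ht => ?_, by simp, by simp, rfl⟩
    exact 𝒞.isSymmetricCone.convex.add_smul_sub_mem hx hyΩ ht) hd
  intro z hz
  have h2 := 𝒞.comparable_of_curve hγ hγΩ z hz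
  rw [h0, h1] at h2
  have h3 := Real.exp_le_exp.2 hlt.le
  have hxz := 𝒞.inner_nonneg (subset_closure hx) hz
  have hyz := 𝒞.inner_nonneg (subset_closure hyΩ) hz
  exact ⟨h2.1.trans (mul_le_mul_of_nonneg_right h3 hyz),
    h2.2.trans (mul_le_mul_of_nonneg_right h3 hxz)⟩

theorem dist_apply_le {g : V ≃L[ℝ] V} (hg : g ∈ coneAut 𝒞.Ω) {x y : V} {R : ℝ} (hx : x ∈ 𝒞.Ω)
    (hy : y ∈ 𝒞.ball R x) : g y ∈ 𝒞.ball R (g x) := by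
  obtain ⟨hyΩ, hd⟩ := hy
  refine ⟨coneAut_apply_mem hg hyΩ, ?_⟩
  rw [JordanCone.dist] at hd ⊢
  obtain ⟨L, ⟨γ, hγ, hγΩ, h0, h1, rfl⟩, hlt⟩ := exists_lt_of_csInf_lt (by
    refine ⟨_, fun t : ℝ => x + t • (y - x), by fun_prop, fun t ht => ?_, by simp, by simp, rfl⟩
    exact 𝒞.isSymmetricCone.convex.add_smul_sub_mem hx hyΩ ht) hd
  refine lt_of_le_of_lt (csInf_le ?_ ?_) hlt
  · refine ⟨0, ?_⟩
    rintro _ ⟨γ, -, -, -, -, rfl⟩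
    exact intervalIntegral.integral_nonneg zero_le_one fun t _ => 𝒞.tangentNorm_nonneg _ _
  · refine ⟨fun t => g (γ t), g.contDiff.comp hγ, fun t ht => coneAut_apply_mem hg (hγΩ t ht),
      by simp [h0], by simp [h1], ?_⟩
    refine intervalIntegral.integral_congr fun t ht => ?_
    rw [uIcc_of_le zero_le_one] at ht
    have h2 : deriv (fun t => g (γ t)) t = g (deriv γ t) :=
      ((g : V →L[ℝ] V).hasFDerivAt.comp_hasDerivAt t
        ((hγ.differentiable one_ne_zero) t).hasDerivAt).deriv
    simp only
    rw [h2, 𝒞.tangentNorm_apply hg (hγΩ t ht)]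

/-- By continuity of the tangent norm at `(e, 0)`, a short segment from `e` has speed below `1/4`.
This lets Euclidean distances near `e` detect the disjointness of lattice balls. -/
theorem exists_subset_ball : ∃ ε : ℝ, 0 < ε ∧ ∀ y, ‖y - 𝒞.e‖ < ε → y ∈ 𝒞.ball (1 / 2) 𝒞.e := by
  have h1 := 𝒞.continuousAt_tangentNorm_e 0
  have h0 : 𝒞.tangentNorm 𝒞.e 0 = 0 := by
    simpa using 𝒞.tangentNorm_apply_e coneAut_refl 0
  have h2 : ∀ᶠ q in nhds (𝒞.e, (0 : V)), 𝒞.tangentNorm q.1 q.2 < 1 / 4 := by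
    refine h1.eventually_lt continuousAt_const ?_
    simp only [h0]; norm_num
  have h3 : ∀ᶠ q in nhds (𝒞.e, (0 : V)), q.1 ∈ 𝒞.Ω :=
    (continuous_fst.tendsto (𝒞.e, (0 : V))).eventually
      (𝒞.isSymmetricCone.isOpen.mem_nhds 𝒞.e_mem)
  obtain ⟨ε, hε, hball⟩ := Metric.eventually_nhds_iff_ball.1 (h2.and h3)
  have key : ∀ y v : V, ‖y - 𝒞.e‖ < ε → ‖v‖ < ε → 𝒞.tangentNorm y v < 1 / 4 ∧ y ∈ 𝒞.Ω := by
    intro y v hy hv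
    refine hball (y, v) ?_
    rw [Metric.mem_ball, Prod.dist_eq, max_lt_iff]
    exact ⟨by simpa [dist_eq_norm] using hy, by simpa using hv⟩
  refine ⟨ε, hε, fun y hy => ⟨(key y 0 hy (by simpa using hε)).2, ?_⟩⟩
  set γ : ℝ → V := fun t => 𝒞.e + t • (y - 𝒞.e) with hγ
  have hγd : ∀ t, deriv γ t = y - 𝒞.e := fun t => by
    have : HasDerivAt γ ((1 : ℝ) • (y - 𝒞.e)) t :=
      ((hasDerivAt_id t).smul_const (y - 𝒞.e)).const_add 𝒞.e
    rw [this.deriv, one_smul]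
  have hγn : ∀ t ∈ Icc (0 : ℝ) 1, ‖γ t - 𝒞.e‖ < ε := fun t ht => by
    simp only [hγ, add_sub_cancel_left, norm_smul, Real.norm_of_nonneg ht.1]
    exact (mul_le_of_le_one_left (norm_nonneg _) ht.2).trans_lt hy
  have hle : 𝒞.dist 𝒞.e y ≤ ∫ t in (0 : ℝ)..1, 𝒞.tangentNorm (γ t) (deriv γ t) := by
    refine csInf_le ⟨0, ?_⟩ ⟨γ, by simp only [hγ]; fun_prop, fun t ht => (key _ 0 (hγn t ht) (by simpa using hε)).2,
      by simp [hγ], by simp [hγ], rfl⟩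
    rintro _ ⟨γ, -, -, -, -, rfl⟩
    exact intervalIntegral.integral_nonneg zero_le_one fun t _ => 𝒞.tangentNorm_nonneg _ _
  have hint : ‖∫ t in (0 : ℝ)..1, 𝒞.tangentNorm (γ t) (deriv γ t)‖ ≤ 1 / 4 * |(1 : ℝ) - 0| := by
    refine intervalIntegral.norm_integral_le_of_norm_le_const fun t ht => ?_
    rw [uIoc_of_le zero_le_one] at ht
    rw [Real.norm_of_nonneg (𝒞.tangentNorm_nonneg _ _), hγd]
    exact (key _ _ (hγn t (Ioc_subset_Icc_self ht)) hy).1.le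
  have := (le_abs_self _).trans hint
  norm_num at this
  linarith

/-- A compact subset of the cone is uniformly comparable to the identity. -/
theorem exists_comparable_of_isCompact {K : Set V} (hK : IsCompact K) (hKΩ : K ⊆ 𝒞.Ω) :
    ∃ M : ℝ, 1 ≤ M ∧ ∀ x ∈ K, 𝒞.Comparable M 𝒞.e x := by
  have := FiniteDimensional.proper ℝ V
  obtain ⟨R, hR⟩ := hK.isBounded.exists_norm_le
  obtain ⟨δ, hδ, hsub⟩ := hK.exists_cthickening_subset_open 𝒞.isSymmetricCone.isOpen hKΩ
  have hne : 0 < ‖𝒞.e‖ := norm_pos_iff.2 𝒞.e_ne_zero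
  set t := δ / ‖𝒞.e‖ with ht
  have ht0 : 0 < t := by positivity
  refine ⟨max (max R t⁻¹) 1, le_max_right _ _, fun x hx z hz => ?_⟩
  have hez := 𝒞.inner_nonneg (subset_closure 𝒞.e_mem) hz
  have hxz := 𝒞.inner_nonneg (subset_closure (hKΩ hx)) hz
  constructor
  -- A neighbourhood of the compact set of radius `δ` stays in `Ω`, and `t` is chosen with `‖t e‖ =
  -- δ`.
  · have h1 : x - t • 𝒞.e ∈ 𝒞.Ω := by
      refine hsub (Metric.mem_cthickening_of_dist_le _ x δ K hx ?_)
      rw [dist_eq_norm, sub_sub_cancel_left, norm_neg, norm_smul, Real.norm_of_nonneg ht0.le, ht,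
        div_mul_cancel₀ _ hne.ne']
    have h2 := 𝒞.inner_nonneg (subset_closure h1) hz
    rw [inner_sub_left, inner_smul_left] at h2
    simp only [conj_trivial] at h2
    calc ⟪𝒞.e, z⟫ = t⁻¹ * (t * ⟪𝒞.e, z⟫) := by rw [← mul_assoc, inv_mul_cancel₀ ht0.ne', one_mul]
      _ ≤ t⁻¹ * ⟪x, z⟫ := mul_le_mul_of_nonneg_left (by linarith) (by positivity)
      _ ≤ _ := mul_le_mul_of_nonneg_right ((le_max_right R _).trans (le_max_left _ _)) hxz
  · calc ⟪x, z⟫ ≤ |⟪x, z⟫| := le_abs_self _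
      _ ≤ ‖x‖ * ⟪𝒞.e, z⟫ := 𝒞.abs_inner_le x hz
      _ ≤ _ := mul_le_mul_of_nonneg_right ((hR x hx).trans
        ((le_max_left R _).trans (le_max_left _ _))) hez

/-- A smooth cutoff function that is one near the points comparable to the identity. -/
theorem exists_cutoff {M : ℝ} (hM : 0 < M) : ∃ χ : V → ℝ, ContDiff ℝ ∞ χ ∧ HasCompactSupport χ ∧
    tsupport χ ⊆ 𝒞.Ω ∧ ∀ x, 𝒞.Comparable M 𝒞.e x → ∀ᶠ y in nhds x, χ y = 1 := by
  have := FiniteDimensional.proper ℝ V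
  have hK := 𝒞.isCompact_comparable hM
  obtain ⟨δ, hδ, hsub⟩ := hK.exists_cthickening_subset_open 𝒞.isSymmetricCone.isOpen
    (fun x hx => Comparable.mem hM.le 𝒞.e_mem hx)
  set T := Metric.cthickening δ {y | 𝒞.Comparable M 𝒞.e y} with hT
  have hTc : IsCompact T := hK.cthickening
  have hint : {y | 𝒞.Comparable M 𝒞.e y} ⊆ interior T :=
    (Metric.self_subset_thickening hδ _).trans
      ((Metric.isOpen_thickening.subset_interior_iff).2 (Metric.thickening_subset_cthickening _ _))
  obtain ⟨f, h1, h2, -⟩ := exists_contMDiffMap_one_nhds_of_subset_interior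
    (n := ⊤) (modelWithCornersSelf ℝ V) hK.isClosed hint
  have hsupp : tsupport f ⊆ T := closure_minimal (fun x hx => by
    by_contra h
    exact hx (h2 x h)) hTc.isClosed
  refine ⟨f, f.contMDiff.contDiff, hTc.of_isClosed_subset (isClosed_tsupport _) hsupp,
    hsupp.trans hsub, fun x hx => ?_⟩
  exact Filter.eventually_iff_exists_mem.2 ((Filter.eventually_iff_exists_mem.1 h1).imp
    fun s hs => ⟨mem_nhdsSet_iff_forall.1 hs.1 x hx, hs.2⟩)

end JordanCone
end ConeLP

namespace ConeLP

namespace JordanCone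

/-! ### Finite overlap of lattice points -/

namespace LittlewoodPaley

variable {V : Type*} [NormedAddCommGroup V] [InnerProductSpace ℝ V] [FiniteDimensional ℝ V]
  [Nontrivial V] {𝒞 : JordanCone V} (P : 𝒞.LittlewoodPaley)

theorem ξ_mem (j : ℕ) : P.ξ j ∈ 𝒞.Ω := P.isLattice.mem j

/-- Lattice points that are comparable to a common point are few in number. -/
theorem exists_count {M : ℝ} (hM : 0 < M) : ∃ N : ℕ, ∀ η ∈ 𝒞.Ω, ∃ A : Finset ℕ, A.card ≤ N ∧
    ∀ j, j ∈ A ↔ 𝒞.Comparable M η (P.ξ j) := by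
  obtain ⟨ε, hε, hball⟩ := 𝒞.exists_subset_ball
  have hne : 0 < ‖𝒞.e‖ := norm_pos_iff.2 𝒞.e_ne_zero
  -- After moving the base point to `e`, the inverse of `g⁻¹ g j` has norm at most `M ‖e‖`. Two
  -- image points closer than `ρ` would therefore put one lattice point in the `1/2`-ball of
  -- another. Balls of radius `ρ/2` covering the compact comparability set then give the count.
  set ρ := ε / (M * ‖𝒞.e‖) with hρ
  have hρ0 : 0 < ρ := by positivity
  obtain ⟨t, ht⟩ := (𝒞.isCompact_comparable hM).elim_nhds_subcover (fun x => Metric.ball x (ρ / 2))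
    (fun x _ => Metric.ball_mem_nhds x (by positivity))
  refine ⟨t.card, fun η hη => ?_⟩
  obtain ⟨g, hg, rfl⟩ := 𝒞.exists_apply_e_eq hη
  have hcomp : ∀ j, 𝒞.Comparable M (g 𝒞.e) (P.ξ j) →
      𝒞.Comparable M 𝒞.e (g.symm (P.ξ j)) := fun j hj => by
    simpa using hj.apply (coneAut_symm hg)
  have hsep : ∀ i j, 𝒞.Comparable M (g 𝒞.e) (P.ξ j) → i ≠ j →
      ρ ≤ ‖g.symm (P.ξ i) - g.symm (P.ξ j)‖ := by
    intro i j hj hij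
    by_contra! hlt
    set h := (P.g j).trans g.symm with hh
    have hhm : h ∈ coneAut 𝒞.Ω := coneAut_trans (P.g_mem j) (coneAut_symm hg)
    have hhe : h 𝒞.e = g.symm (P.ξ j) := by simp [hh, P.g_e]
    have hc := hcomp j hj
    rw [← hhe] at hc
    have h1 := 𝒞.norm_apply_le_of_comparable (coneAut_symm hhm) hM.le
      (𝒞.comparable_symm_e hhm hc) (g.symm (P.ξ i) - g.symm (P.ξ j))
    rw [map_sub, ← hhe, ContinuousLinearEquiv.symm_apply_apply, hhe] at h1
    have h2 : ‖h.symm (g.symm (P.ξ i)) - 𝒞.e‖ < ε := by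
      refine h1.trans_lt ?_
      calc M * ‖𝒞.e‖ * ‖g.symm (P.ξ i) - g.symm (P.ξ j)‖ < M * ‖𝒞.e‖ * ρ := by gcongr
        _ = ε := by rw [hρ]; field_simp
    have h3 := 𝒞.dist_apply_le (P.g_mem j) 𝒞.e_mem (hball _ h2)
    rw [P.g_e] at h3
    have h4 : P.g j (h.symm (g.symm (P.ξ i))) = P.ξ i := by simp [hh]
    rw [h4] at h3
    have h5 : P.ξ i ∈ 𝒞.ball (1 / 2) (P.ξ i) := by
      have := 𝒞.dist_apply_le (P.g_mem i) 𝒞.e_mem (hball 𝒞.e (by simpa using hε))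
      rwa [P.g_e] at this
    exact Set.disjoint_left.1 (P.isLattice.disjoint i j hij) h5 h3
  have hex : ∀ j, ∃ x, 𝒞.Comparable M (g 𝒞.e) (P.ξ j) →
      x ∈ t ∧ g.symm (P.ξ j) ∈ Metric.ball x (ρ / 2) := by
    intro j
    by_cases hj : 𝒞.Comparable M (g 𝒞.e) (P.ξ j)
    · obtain ⟨x, hx⟩ := mem_iUnion.1 (ht.2 (hcomp j hj))
      obtain ⟨hx1, hx2⟩ := mem_iUnion.1 hx
      exact ⟨x, fun _ => ⟨hx1, hx2⟩⟩
    · exact ⟨0, fun h => absurd h hj⟩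
  choose x hx using hex
  have hinj : Set.InjOn x {j | 𝒞.Comparable M (g 𝒞.e) (P.ξ j)} := by
    intro i hi j hj hij
    by_contra hne'
    have h1 := (hx i hi).2
    have h2 := (hx j hj).2
    rw [hij] at h1
    have h3 := hsep i j hj hne'
    have h4 := dist_triangle_right (g.symm (P.ξ i)) (g.symm (P.ξ j)) (x j)
    rw [Metric.mem_ball] at h1 h2
    rw [← dist_eq_norm] at h3
    linarith
  have hmaps : MapsTo x {j | 𝒞.Comparable M (g 𝒞.e) (P.ξ j)} t := fun j hj => (hx j hj).1
  have hfin : {j | 𝒞.Comparable M (g 𝒞.e) (P.ξ j)}.Finite :=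
    Set.Finite.of_injOn hmaps hinj t.finite_toSet
  refine ⟨hfin.toFinset, ?_, fun j => by simp⟩
  refine Finset.card_le_card_of_injOn x ?_ ?_
  · intro j hj
    exact hmaps (by simpa using hj)
  · intro i hi j hj
    exact hinj (by simpa using hi) (by simpa using hj)

/-! ### The Littlewood–Paley functions -/

theorem contDiff_φ (j : ℕ) : ContDiff ℝ ∞ (P.φ j) := P.smooth.comp (P.g j).symm.contDiff

theorem φ_nonneg (j : ℕ) (η : V) : 0 ≤ P.φ j η := P.nonneg _

theorem tsupport_φ (j : ℕ) : tsupport (P.φ j) = (P.g j).symm ⁻¹' tsupport P.φ₀ :=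
  tsupport_comp_eq_preimage P.φ₀ (P.g j).symm.toHomeomorph

theorem hasCompactSupport_φ (j : ℕ) : HasCompactSupport (P.φ j) :=
  P.compactSupport.comp_homeomorph (P.g j).symm.toHomeomorph

theorem tsupport_φ_subset (j : ℕ) : tsupport (P.φ j) ⊆ 𝒞.ball 2 (P.ξ j) := by
  intro η hη
  rw [P.tsupport_φ] at hη
  have := 𝒞.dist_apply_le (P.g_mem j) 𝒞.e_mem (P.tsupport_subset hη)
  rwa [P.g_e, ContinuousLinearEquiv.apply_symm_apply] at this

theorem comparable_of_mem_tsupport {j : ℕ} {η : V} (h : η ∈ tsupport (P.φ j)) :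
    𝒞.Comparable (Real.exp 2) (P.ξ j) η :=
  𝒞.comparable_of_mem_ball (P.ξ_mem j) (P.tsupport_φ_subset j h)

theorem exists_φ_eq_one {η : V} (h : η ∈ 𝒞.Ω) : ∃ j, P.φ j η = 1 := by
  obtain ⟨j, hj⟩ := mem_iUnion.1 (P.isLattice.cover h)
  refine ⟨j, P.eq_one _ ?_⟩
  have := 𝒞.dist_apply_le (coneAut_symm (P.g_mem j)) (P.ξ_mem j) hj
  rw [← P.g_e j, ContinuousLinearEquiv.symm_apply_apply] at this
  norm_num at this
  exact this

theorem Φ_eq_sum {η : V} {A : Finset ℕ} (hA : ∀ j, P.φ j η ≠ 0 → j ∈ A) :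
    P.Φ η = ∑ j ∈ A, P.φ j η :=
  tsum_eq_sum fun j hj => by
    by_contra h
    exact hj (hA j h)

theorem exists_finset_φ {η : V} (h : η ∈ 𝒞.Ω) : ∃ A : Finset ℕ, ∀ j, P.φ j η ≠ 0 → j ∈ A := by
  obtain ⟨N, hN⟩ := P.exists_count (Real.exp_pos 2)
  obtain ⟨A, -, hA⟩ := hN η h
  exact ⟨A, fun j hj => (hA j).2 (P.comparable_of_mem_tsupport (subset_tsupport _ hj)).symm⟩

theorem one_le_Φ {η : V} (h : η ∈ 𝒞.Ω) : 1 ≤ P.Φ η := by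
  obtain ⟨A, hA⟩ := P.exists_finset_φ h
  obtain ⟨j, hj⟩ := P.exists_φ_eq_one h
  rw [P.Φ_eq_sum hA, ← hj]
  exact Finset.single_le_sum (fun i _ => P.φ_nonneg i η) (hA j (by rw [hj]; exact one_ne_zero))

/-- Points near `η` are comparable to it, so a single finite set of indices serves a whole
neighbourhood and the series is locally a finite sum. -/
theorem contDiffAt_Φ {η : V} (h : η ∈ 𝒞.Ω) : ContDiffAt ℝ ∞ P.Φ η := by
  obtain ⟨g, hg, rfl⟩ := 𝒞.exists_apply_e_eq h
  obtain ⟨ε, hε, hball⟩ := 𝒞.exists_subset_ball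
  obtain ⟨N, hN⟩ := P.exists_count (mul_pos (Real.exp_pos (1 / 2)) (Real.exp_pos 2))
  obtain ⟨A, -, hA⟩ := hN _ h
  have hev : ∀ᶠ y in nhds (g 𝒞.e), P.Φ y = ∑ j ∈ A, P.φ j y := by
    have h1 : ∀ᶠ y in nhds (g 𝒞.e), ‖g.symm y - 𝒞.e‖ < ε := by
      have hc : Continuous fun y => ‖g.symm y - 𝒞.e‖ := by fun_prop
      exact (hc.tendsto (g 𝒞.e)).eventually (gt_mem_nhds (by simpa using hε))
    filter_upwards [h1] with y hy
    have h2 := 𝒞.dist_apply_le hg 𝒞.e_mem (hball _ hy)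
    rw [ContinuousLinearEquiv.apply_symm_apply] at h2
    have h3 := 𝒞.comparable_of_mem_ball h h2
    refine P.Φ_eq_sum fun j hj => (hA j).2 ?_
    exact h3.trans (Real.exp_pos _).le (Real.exp_pos _).le
      (P.comparable_of_mem_tsupport (subset_tsupport _ hj)).symm
  refine ContDiffAt.congr_of_eventuallyEq ?_ hev
  exact ContDiffAt.sum fun j _ => (P.contDiff_φ j).contDiffAt

theorem tsupport_ψHat_subset (j : ℕ) : tsupport (P.ψHat j) ⊆ tsupport (P.φ j) := by
  refine closure_mono fun η hη h => hη ?_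
  have h' : P.φ j η = 0 := h
  simp [ψHat, h']

theorem tsupport_ψHat_subset_ball (j : ℕ) : tsupport (P.ψHat j) ⊆ 𝒞.ball 2 (P.ξ j) :=
  (P.tsupport_ψHat_subset j).trans (P.tsupport_φ_subset j)

theorem hasCompactSupport_ψHat (j : ℕ) : HasCompactSupport (P.ψHat j) :=
  (P.hasCompactSupport_φ j).of_isClosed_subset (isClosed_tsupport _) (P.tsupport_ψHat_subset j)

theorem comparable_of_ψHat_ne_zero {j : ℕ} {η : V} (h : P.ψHat j η ≠ 0) :
    𝒞.Comparable (Real.exp 2) (P.ξ j) η :=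
  P.comparable_of_mem_tsupport (P.tsupport_ψHat_subset j (subset_tsupport _ h))

theorem contDiff_ψHat (j : ℕ) : ContDiff ℝ ∞ (P.ψHat j) := by
  rw [contDiff_iff_contDiffAt]
  intro η
  by_cases h : η ∈ tsupport (P.φ j)
  · have hΩ := (P.tsupport_φ_subset j h).1
    exact (P.contDiff_φ j).contDiffAt.div (P.contDiffAt_Φ hΩ)
      (by have := P.one_le_Φ hΩ; linarith)
  · have h1 : η ∉ tsupport (P.ψHat j) := fun h' => h (P.tsupport_ψHat_subset j h')
    exact contDiffAt_const.congr_of_eventuallyEq (notMem_tsupport_iff_eventuallyEq.1 h1)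

theorem sum_ψHat {η : V} (h : η ∈ 𝒞.Ω) {A : Finset ℕ} (hA : ∀ j, P.ψHat j η ≠ 0 → j ∈ A) :
    ∑ j ∈ A, P.ψHat j η = 1 := by
  have h1 := P.one_le_Φ h
  have h2 : P.Φ η = ∑ j ∈ A, P.φ j η := P.Φ_eq_sum fun j hj => hA j (by
    rw [ψHat]
    exact div_ne_zero hj (by linarith))
  simp only [ψHat]
  rw [← Finset.sum_div, ← h2, div_self (by linarith)]

/-- The functions `ψHat k`, transported to the identity, form a compact family. -/
theorem exists_ψHat_family : ∃ (N : ℕ) (C : ℝ), ∀ k, ∃ h : Fin N → (V →L[ℝ] V), ‖h‖ ≤ C ∧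
    (∀ ξ ∈ tsupport P.φ₀, 1 ≤ ∑ i, P.φ₀ (h i ξ)) ∧
    ∀ ξ, P.ψHat k (P.g k ξ) = P.φ₀ ξ / ∑ i, P.φ₀ (h i ξ) := by
  classical
  obtain ⟨N, hN⟩ := P.exists_count (mul_pos (Real.exp_pos 2) (Real.exp_pos 2))
  set M := Real.exp 2 * Real.exp 2 with hMdef
  have hM : 0 < M := by positivity
  have hφ0 : P.φ₀ 0 = 0 := by
    by_contra h0
    exact 𝒞.zero_notMem (P.tsupport_subset (subset_tsupport _ h0)).1
  refine ⟨N, M * ‖𝒞.e‖, fun k => ?_⟩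
  obtain ⟨A, hcard, hA⟩ := hN _ (P.ξ_mem k)
  obtain ⟨emb⟩ : Nonempty (A ↪ Fin N) := by
    rw [Function.Embedding.nonempty_iff_card_le]
    simpa using hcard
  set f : A → (V →L[ℝ] V) := fun j => (((P.g k).trans (P.g j).symm : V ≃L[ℝ] V) : V →L[ℝ] V) with hf
  have hfnorm : ∀ j, ‖f j‖ ≤ M * ‖𝒞.e‖ := by
    intro j
    refine ContinuousLinearMap.opNorm_le_bound _ (by positivity) fun v => ?_
    refine 𝒞.norm_apply_le_of_comparable (h := (P.g k).trans (P.g j).symm)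
      (coneAut_trans (P.g_mem k) (coneAut_symm (P.g_mem j))) hM.le ?_ v
    have h1 := ((hA j).1 j.2).symm.apply (coneAut_symm (P.g_mem j))
    rw [← P.g_e j, ContinuousLinearEquiv.symm_apply_apply, ← P.g_e k] at h1
    exact h1
  -- Unused slots are filled with the zero map. They contribute `φ₀(0) = 0`, since the origin is
  -- outside the cone.
  set h : Fin N → (V →L[ℝ] V) := Function.extend emb f 0 with hh
  have hsum : ∀ ξ, ∑ i, P.φ₀ (h i ξ) = ∑ j : A, P.φ j (P.g k ξ) := by
    intro ξ
    refine (Fintype.sum_of_injective emb emb.injective _ _ ?_ ?_).symm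
    · intro i hi
      rw [hh, Function.extend_apply' _ _ _ (by simpa using hi)]
      simpa using hφ0
    · intro j
      rw [hh, emb.injective.extend_apply]
      rfl
  have hφk : ∀ ξ, P.φ k (P.g k ξ) = P.φ₀ ξ := fun ξ => by simp [φ]
  have hΦ : ∀ ξ ∈ tsupport P.φ₀, P.g k ξ ∈ 𝒞.Ω ∧ P.Φ (P.g k ξ) = ∑ i, P.φ₀ (h i ξ) := by
    intro ξ hξ
    have hmem : P.g k ξ ∈ tsupport (P.φ k) := by
      rw [P.tsupport_φ]; simpa using hξ
    refine ⟨(P.tsupport_φ_subset k hmem).1, ?_⟩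
    rw [hsum, Finset.sum_coe_sort A fun j => P.φ j (P.g k ξ)]
    refine P.Φ_eq_sum fun j hj => (hA j).2 ?_
    exact (P.comparable_of_mem_tsupport hmem).trans (Real.exp_pos _).le (Real.exp_pos _).le
      (P.comparable_of_mem_tsupport (subset_tsupport _ hj)).symm
  refine ⟨h, ?_, fun ξ hξ => ?_, fun ξ => ?_⟩
  · refine (pi_norm_le_iff_of_nonneg (by positivity)).2 fun i => ?_
    by_cases hi : ∃ j, emb j = i
    · obtain ⟨j, rfl⟩ := hi
      rw [hh, emb.injective.extend_apply]
      exact hfnorm j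
    · rw [hh, Function.extend_apply' _ _ _ hi]
      simp only [Pi.zero_apply, norm_zero]
      positivity
  · obtain ⟨h1, h2⟩ := hΦ ξ hξ
    rw [← h2]
    exact P.one_le_Φ h1
  · rw [ψHat, hφk]
    by_cases hξ : ξ ∈ tsupport P.φ₀
    · rw [(hΦ ξ hξ).2]
    · rw [image_eq_zero_of_notMem_tsupport hξ, zero_div, zero_div]

end LittlewoodPaley
end JordanCone
end ConeLP

namespace ConeLP

/-! ### The Fourier transform of Schwartz functions -/

section FourierSchwartz

variable {V : Type*} [NormedAddCommGroup V] [InnerProductSpace ℝ V] [FiniteDimensional ℝ V]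
  [MeasurableSpace V] [BorelSpace V]

theorem fourierHat_eq_fourier (f : 𝓢(V, ℂ)) (ξ : V) :
    fourierHat V f ξ = (((2 * Real.pi : ℝ) : ℂ) ^ Module.finrank ℝ V)⁻¹ *
      (𝓕 f) ((2 * Real.pi)⁻¹ • ξ) := rfl

theorem two_pi_pow_ne_zero : (((2 * Real.pi : ℝ) : ℂ) ^ Module.finrank ℝ V) ≠ 0 :=
  pow_ne_zero _ (Complex.ofReal_ne_zero.2 (by positivity))

variable (V) in
/-- The inverse of `fourierHat`. -/
def invHat : 𝓢(V, ℂ) →L[ℂ] 𝓢(V, ℂ) :=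
  (((2 * Real.pi : ℝ) : ℂ) ^ Module.finrank ℝ V) •
    ((FourierTransform.fourierInvCLM ℂ 𝓢(V, ℂ)).comp
      (SchwartzMap.compCLMOfContinuousLinearEquiv ℂ (dil V).symm))

theorem fourierHat_invHat (u : 𝓢(V, ℂ)) : fourierHat V (invHat V u) = u := by
  ext ξ
  have h : invHat V u = (((2 * Real.pi : ℝ) : ℂ) ^ Module.finrank ℝ V) •
      𝓕⁻ (SchwartzMap.compCLMOfContinuousLinearEquiv ℂ (dil V).symm u) := rfl
  rw [fourierHat_eq_fourier, h, FourierTransform.fourier_smul, FourierTransform.fourier_fourierInv_eq]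
  have h3 : (dil V).symm ((2 * Real.pi)⁻¹ • ξ) = ξ := (dil V).symm_apply_apply ξ
  simp only [smul_apply, smul_eq_mul]
  rw [← mul_assoc, inv_mul_cancel₀ two_pi_pow_ne_zero, one_mul,
    SchwartzMap.compCLMOfContinuousLinearEquiv_apply, Function.comp_apply, h3]

theorem fourierHat_injective : Function.Injective (fourierHat V) := by
  intro f f' h
  have h1 : 𝓕 f = 𝓕 f' := by
    ext ξ
    have h2 := congrArg (fun u : 𝓢(V, ℂ) => u ((2 * Real.pi) • ξ)) h
    simp only [fourierHat_eq_fourier] at h2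
    have h3 := mul_left_cancel₀ (inv_ne_zero two_pi_pow_ne_zero) h2
    rwa [smul_smul, inv_mul_cancel₀ (by positivity), one_smul] at h3
  have h4 := congrArg (fun u : 𝓢(V, ℂ) => (𝓕⁻ u : 𝓢(V, ℂ))) h1
  simpa using h4

theorem invHat_fourierHat (f : 𝓢(V, ℂ)) : invHat V (fourierHat V f) = f :=
  fourierHat_injective (fourierHat_invHat _)

theorem invHat_apply (u : 𝓢(V, ℂ)) (x : V) : invHat V u x = fourierInvInt u x := by
  have h : invHat V u x = (((2 * Real.pi : ℝ) : ℂ) ^ Module.finrank ℝ V) *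
      (𝓕⁻ (SchwartzMap.compCLMOfContinuousLinearEquiv ℂ (dil V).symm u)) x := rfl
  have hpi : (0 : ℝ) < 2 * Real.pi := by positivity
  rw [h, SchwartzMap.fourierInv_coe, Real.fourierInv_eq', fourierInvInt]
  have h1 := MeasureTheory.Measure.integral_comp_smul (volume : Measure V)
    (fun ξ => Complex.exp (Complex.I * (⟪x, ξ⟫ : ℝ)) * u ξ) (2 * Real.pi)
  have h2 : (fun v : V => Complex.exp (↑(2 * Real.pi * ⟪v, x⟫) * Complex.I) •
      (SchwartzMap.compCLMOfContinuousLinearEquiv ℂ (dil V).symm u) v) =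
      fun v => Complex.exp (Complex.I * (⟪x, (2 * Real.pi) • v⟫ : ℝ)) * u ((2 * Real.pi) • v) := by
    ext v
    have h3 : (dil V).symm v = (2 * Real.pi) • v := by
      rw [ContinuousLinearEquiv.symm_apply_eq]
      change v = (2 * Real.pi)⁻¹ • (2 * Real.pi) • v
      rw [smul_smul, inv_mul_cancel₀ hpi.ne', one_smul]
    rw [SchwartzMap.compCLMOfContinuousLinearEquiv_apply, Function.comp_apply, h3, smul_eq_mul,
      inner_smul_right, real_inner_comm, mul_comm Complex.I]
  rw [h2, h1, abs_of_pos (by positivity), Complex.real_smul, ← mul_assoc, Complex.ofReal_inv,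
    Complex.ofReal_pow, mul_inv_cancel₀ two_pi_pow_ne_zero, one_mul]

theorem integral_fourierHat_mul (f φ : 𝓢(V, ℂ)) :
    ∫ x, fourierHat V φ x * f x = ∫ x, φ x * fourierHat V f x := by
  have key : ∀ f φ : 𝓢(V, ℂ), ∫ x, fourierHat V φ x * f x =
      ∫ x, (𝓕 φ) x * f ((2 * Real.pi) • x) := by
    intro f φ
    have hpi : (0 : ℝ) < 2 * Real.pi := by positivity
    have h1 := MeasureTheory.Measure.integral_comp_smul (volume : Measure V)
      (fun ξ => fourierHat V φ ξ * f ξ) (2 * Real.pi)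
    rw [abs_of_pos (by positivity), Complex.real_smul, Complex.ofReal_inv, Complex.ofReal_pow,
      eq_inv_mul_iff_mul_eq₀ two_pi_pow_ne_zero] at h1
    rw [← h1, ← integral_const_mul]
    refine integral_congr_ae (Filter.Eventually.of_forall fun x => ?_)
    simp only [fourierHat_eq_fourier]
    rw [smul_smul, inv_mul_cancel₀ hpi.ne', one_smul, ← mul_assoc, ← mul_assoc,
      mul_inv_cancel₀ two_pi_pow_ne_zero, one_mul]
  have h5 : ∀ f : 𝓢(V, ℂ), ∃ f' : 𝓢(V, ℂ), (∀ x, f' x = f ((2 * Real.pi) • x)) ∧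
      ∀ x, (𝓕 f') x = fourierHat V f x := by
    intro f
    refine ⟨SchwartzMap.compCLMOfContinuousLinearEquiv ℂ (dil V).symm f, fun x => ?_, fun x => ?_⟩
    · have h3 : (dil V).symm x = (2 * Real.pi) • x := by
        rw [ContinuousLinearEquiv.symm_apply_eq]
        change x = (2 * Real.pi)⁻¹ • (2 * Real.pi) • x
        rw [smul_smul, inv_mul_cancel₀ (by positivity), one_smul]
      rw [SchwartzMap.compCLMOfContinuousLinearEquiv_apply, Function.comp_apply, h3]
    · rw [SchwartzMap.fourier_coe, Real.fourier_eq', fourierHat_apply]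
      have h1 := MeasureTheory.Measure.integral_comp_smul (volume : Measure V)
        (fun y => Complex.exp (-(Complex.I * (⟪y, x⟫ : ℝ))) * f y) (2 * Real.pi)
      rw [abs_of_pos (by positivity), Complex.real_smul, Complex.ofReal_inv,
        Complex.ofReal_pow] at h1
      rw [← h1]
      refine integral_congr_ae (Filter.Eventually.of_forall fun y => ?_)
      have h3 : (dil V).symm y = (2 * Real.pi) • y := by
        rw [ContinuousLinearEquiv.symm_apply_eq]
        change y = (2 * Real.pi)⁻¹ • (2 * Real.pi) • y
        rw [smul_smul, inv_mul_cancel₀ (by positivity), one_smul]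
      simp only [SchwartzMap.compCLMOfContinuousLinearEquiv_apply, Function.comp_apply, h3,
        smul_eq_mul, real_inner_smul_left]
      congr 2
      push_cast
      ring
  rw [key]
  obtain ⟨f', hf', hF⟩ := h5 f
  simp only [← hf', ← hF]
  exact SchwartzMap.integral_fourier_mul_eq φ f'

end FourierSchwartz
end ConeLP

namespace ConeLP

/-! ### Fourier multipliers on Schwartz functions -/

section Multiplier

variable {V : Type*} [NormedAddCommGroup V] [InnerProductSpace ℝ V] [FiniteDimensional ℝ V]
  [MeasurableSpace V] [BorelSpace V]

/-- The composition `f ∘ A`. -/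
abbrev compEquiv (A : V ≃L[ℝ] V) (f : 𝓢(V, ℂ)) : 𝓢(V, ℂ) :=
  SchwartzMap.compCLMOfContinuousLinearEquiv ℂ A f

theorem compEquiv_apply (A : V ≃L[ℝ] V) (f : 𝓢(V, ℂ)) (x : V) : compEquiv A f x = f (A x) := rfl

theorem map_volume_eq (A : V ≃L[ℝ] V) :
    Measure.map A (volume : Measure V) = ENNReal.ofReal (absDet A)⁻¹ • volume := by
  have h := Measure.map_linearMap_addHaar_eq_smul_addHaar (volume : Measure V)
    (f := ((A : V →L[ℝ] V) : V →ₗ[ℝ] V)) (abs_pos.1 (absDet_pos A))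
  rw [abs_inv] at h
  exact h

theorem fourierHat_compEquiv (g : V ≃L[ℝ] V) (f : 𝓢(V, ℂ)) (ξ : V) :
    fourierHat V (compEquiv (adjointEquiv g) f) ξ =
      ((absDet g)⁻¹ : ℝ) * fourierHat V f (g.symm ξ) := by
  rw [fourierHat_apply, fourierHat_apply]
  have h1 : ∫ x, Complex.exp (-(Complex.I * (⟪x, ξ⟫ : ℝ))) * compEquiv (adjointEquiv g) f x =
      ∫ x, Complex.exp (-(Complex.I * (⟪x, g.symm ξ⟫ : ℝ))) * f x
        ∂(Measure.map (adjointEquiv g) volume) := by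
    have h2 : MeasurableEmbedding (adjointEquiv g) :=
      (adjointEquiv g).toHomeomorph.measurableEmbedding
    rw [h2.integral_map]
    refine integral_congr_ae (Filter.Eventually.of_forall fun x => ?_)
    simp only [compEquiv_apply]
    rw [adjointEquiv_inner_left, g.apply_symm_apply]
  rw [h1, map_volume_eq, integral_smul_measure, absDet_adjointEquiv,
    ENNReal.toReal_ofReal (inv_nonneg.2 (absDet_pos g).le), Complex.real_smul]
  ring

theorem norm_toLp_compEquiv {p : ℝ≥0∞} (hp : p ≠ ⊤) (A : V ≃L[ℝ] V) (f : 𝓢(V, ℂ)) :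
    ‖(compEquiv A f).toLp p‖ = (absDet A)⁻¹ ^ (1 / p).toReal * ‖f.toLp p‖ := by
  have h2 : MeasurableEmbedding A := A.toHomeomorph.measurableEmbedding
  have h3 : (compEquiv A f : V → ℂ) = f ∘ A := rfl
  rw [norm_toLp, norm_toLp, h3, ← h2.eLpNorm_map_measure, map_volume_eq,
    eLpNorm_smul_measure_of_ne_top hp, smul_eq_mul, ENNReal.toReal_mul, ← ENNReal.toReal_rpow,
    ENNReal.toReal_ofReal (inv_nonneg.2 (absDet_pos A).le)]

/-- `B` bounds the operator norm on `Lᵖ` of the Fourier multiplier with symbol `m`. -/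
def MultiplierBound (p : ℝ≥0∞) (m : V → ℝ) (B : ℝ) : Prop :=
  ∀ f f' : 𝓢(V, ℂ), (∀ ξ, fourierHat V f' ξ = m ξ * fourierHat V f ξ) →
    ‖f'.toLp p‖ ≤ B * ‖f.toLp p‖

theorem MultiplierBound.mono {p : ℝ≥0∞} [Fact (1 ≤ p)] {m : V → ℝ} {B B' : ℝ} (h : MultiplierBound p m B)
    (hB : B ≤ B') : MultiplierBound p m B' := fun f f' hf =>
  (h f f' hf).trans (mul_le_mul_of_nonneg_right hB (norm_nonneg _))

theorem MultiplierBound.const_mul {p : ℝ≥0∞} [Fact (1 ≤ p)] {m : V → ℝ} {B : ℝ} (h : MultiplierBound p m B)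
    (c : ℝ) : MultiplierBound p (fun ξ => c * m ξ) (|c| * B) := by
  intro f f' hf
  by_cases hc : c = 0
  · have h1 : f' = 0 := by
      apply fourierHat_injective
      ext ξ
      simp [hf, hc]
    have h0 : (0 : 𝓢(V, ℂ)).toLp p (volume : Measure V) = 0 := rfl
    rw [h1, hc, h0]
    simp
  · have h1 := h f ((c : ℂ)⁻¹ • f') fun ξ => by
      rw [map_smul, smul_apply, smul_eq_mul, hf]
      push_cast
      rw [mul_assoc, ← mul_assoc, inv_mul_cancel₀ (Complex.ofReal_ne_zero.2 hc), one_mul]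
    have h2 : ((c : ℂ)⁻¹ • f').toLp p (volume : Measure V) = (c : ℂ)⁻¹ • f'.toLp p volume := rfl
    rw [h2, norm_smul, norm_inv, Complex.norm_real, Real.norm_eq_abs,
      inv_mul_le_iff₀ (abs_pos.2 hc)] at h1
    rwa [mul_assoc]

/-- Composition with a linear bijection multiplies all `Lᵖ` norms by the same factor, which cancels.
-/
theorem MultiplierBound.of_comp {p : ℝ≥0∞} (hp : p ≠ ⊤) {m : V → ℝ} {B : ℝ} (g : V ≃L[ℝ] V)
    (h : MultiplierBound p (fun ξ => m (g ξ)) B) : MultiplierBound p m B := by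
  intro f f' hf
  have h1 := h (compEquiv (adjointEquiv g.symm) f) (compEquiv (adjointEquiv g.symm) f') fun ξ => by
    rw [fourierHat_compEquiv, fourierHat_compEquiv, hf]
    simp only [ContinuousLinearEquiv.symm_symm]
    ring
  rw [norm_toLp_compEquiv hp, norm_toLp_compEquiv hp] at h1
  have h2 : 0 < (absDet (adjointEquiv g.symm))⁻¹ ^ (1 / p).toReal :=
    Real.rpow_pos_of_pos (inv_pos.2 (absDet_pos _)) _
  rw [mul_left_comm] at h1
  exact le_of_mul_le_mul_left h1 h2

/-- Young's inequality for the convolution of continuous functions with an integrable one. -/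
theorem eLpNorm_convolution_le {p : ℝ≥0∞} (hp1 : 1 ≤ p) (hp : p ≠ ⊤) {K f : V → ℂ}
    (hK : Continuous K) (hKi : eLpNorm K 1 volume ≠ ⊤) (hf : Continuous f) :
    eLpNorm (fun x => ∫ y, K y * f (x - y)) p volume ≤
      eLpNorm K 1 volume * eLpNorm f p volume := by
  have hp0 : p ≠ 0 := (zero_lt_one.trans_le hp1).ne'
  have hpr : 1 ≤ p.toReal := by
    rw [← ENNReal.toReal_one]
    exact ENNReal.toReal_mono hp hp1
  have hpr0 : 0 < p.toReal := zero_lt_one.trans_le hpr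
  -- Hölder against the finite measure `|K| dy` costs its total mass to the power `1 - 1/p`;
  -- integration in `x` by Tonelli supplies the remaining power.
  set ν : Measure V := volume.withDensity fun y => ‖K y‖ₑ with hν
  have hKm : Measurable fun y => ‖K y‖ₑ := hK.enorm.measurable
  have hν1 : ν univ = eLpNorm K 1 volume := by
    rw [hν, withDensity_apply _ MeasurableSet.univ, setLIntegral_univ,
      eLpNorm_one_eq_lintegral_enorm]
  set N := eLpNorm K 1 volume
  have h1 : ∀ x, ‖∫ y, K y * f (x - y)‖ₑ ^ p.toReal ≤
      N ^ (p.toReal - 1) * ∫⁻ y, ‖K y‖ₑ * ‖f (x - y)‖ₑ ^ p.toReal := by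
    intro x
    have hfm : Continuous fun y => f (x - y) := hf.comp (continuous_const.sub continuous_id)
    have h2 : ‖∫ y, K y * f (x - y)‖ₑ ≤ eLpNorm (fun y => f (x - y)) 1 ν := by
      refine (enorm_integral_le_lintegral_enorm _).trans (le_of_eq ?_)
      rw [eLpNorm_one_eq_lintegral_enorm, hν,
        lintegral_withDensity_eq_lintegral_mul _ hKm hfm.enorm.measurable]
      simp [enorm_mul]
    have h3 := h2.trans (eLpNorm_le_eLpNorm_mul_rpow_measure_univ hp1
      (hfm.aestronglyMeasurable (μ := ν)))
    have h4 := ENNReal.rpow_le_rpow h3 hpr0.le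
    rw [ENNReal.mul_rpow_of_nonneg _ _ hpr0.le, ← ENNReal.rpow_mul, hν1] at h4
    have h5 : (1 / (1 : ℝ≥0∞).toReal - 1 / p.toReal) * p.toReal = p.toReal - 1 := by
      rw [ENNReal.toReal_one]
      field_simp
    rw [h5, eLpNorm_eq_lintegral_rpow_enorm_toReal hp0 hp, ← ENNReal.rpow_mul,
      one_div_mul_cancel hpr0.ne', ENNReal.rpow_one, hν,
      lintegral_withDensity_eq_lintegral_mul _ hKm
        (hfm.enorm.measurable.pow_const _), mul_comm] at h4
    exact h4
  have h6 : ∫⁻ x, ‖∫ y, K y * f (x - y)‖ₑ ^ p.toReal ≤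
      (N * eLpNorm f p volume) ^ p.toReal := by
    refine (lintegral_mono h1).trans ?_
    rw [lintegral_const_mul' _ _ (ENNReal.rpow_ne_top_of_nonneg (by linarith) hKi)]
    have hm : Continuous fun q : V × V => f (q.1 - q.2) := hf.comp (continuous_fst.sub continuous_snd)
    rw [lintegral_lintegral_swap ((hKm.comp measurable_snd).mul
      (hm.enorm.measurable.pow_const _)).aemeasurable]
    have h7 : ∀ y, ∫⁻ x, ‖K y‖ₑ * ‖f (x - y)‖ₑ ^ p.toReal =
        ‖K y‖ₑ * eLpNorm f p volume ^ p.toReal := by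
      intro y
      rw [lintegral_const_mul' _ _ enorm_ne_top,
        lintegral_sub_right_eq_self (fun x => ‖f x‖ₑ ^ p.toReal) y,
        eLpNorm_eq_lintegral_rpow_enorm_toReal hp0 hp, ← ENNReal.rpow_mul,
        one_div_mul_cancel hpr0.ne', ENNReal.rpow_one]
    simp_rw [h7]
    rw [lintegral_mul_const _ hKm, ← eLpNorm_one_eq_lintegral_enorm,
      ENNReal.mul_rpow_of_nonneg _ _ hpr0.le, ← mul_assoc]
    change N ^ (p.toReal - 1) * N * _ ≤ _
    gcongr
    by_cases hN : N = 0
    · simp [hN]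
    · rw [ENNReal.rpow_sub _ _ hN hKi, ENNReal.rpow_one, ENNReal.div_mul_cancel hN hKi]
  rw [eLpNorm_eq_lintegral_rpow_enorm_toReal hp0 hp, one_div,
    ENNReal.rpow_inv_le_iff hpr0]
  exact h6

theorem MultiplierBound.of_kernel {p : ℝ≥0∞} [hp1 : Fact (1 ≤ p)] (hp : p ≠ ⊤) {m : V → ℝ} (K : 𝓢(V, ℂ))
    (hK : ∀ ξ, fourierHat V K ξ = m ξ) : MultiplierBound p m ‖K.toLp 1‖ := by
  intro f f' hf
  set c : ℂ := (((2 * Real.pi : ℝ) : ℂ) ^ Module.finrank ℝ V)⁻¹ with hc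
  -- In this normalization convolution corresponds to the product of transforms up to `(2π)⁻ⁿ`,
  -- which is at most one and is dropped.
  have hcle : ‖c‖ ≤ 1 := by
    rw [hc, norm_inv, norm_pow, Complex.norm_real, Real.norm_eq_abs]
    refine inv_le_one_of_one_le₀ (one_le_pow₀ ?_)
    rw [abs_of_pos (by positivity)]
    nlinarith [Real.pi_gt_three]
  have h1 : f' = c • SchwartzMap.convolution (ContinuousLinearMap.mul ℂ ℂ) K f := by
    apply fourierHat_injective
    ext ξ
    rw [hf, ← hK, map_smul, smul_apply, smul_eq_mul,
      fourierHat_eq_fourier (SchwartzMap.convolution _ K f), SchwartzMap.fourier_convolution,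
      SchwartzMap.pairing_apply_apply, fourierHat_eq_fourier, fourierHat_eq_fourier,
      ContinuousLinearMap.mul_apply', ← hc]
    ring
  have h2 : (SchwartzMap.convolution (ContinuousLinearMap.mul ℂ ℂ) K f : V → ℂ) =
      fun x => ∫ y, K y * f (x - y) := by
    ext x
    rw [SchwartzMap.convolution_apply]
    rfl
  have h3 := eLpNorm_convolution_le hp1.out hp K.continuous (K.memLp 1 volume).2.ne f.continuous
  rw [← h2] at h3
  have h4 : f'.toLp p (volume : Measure V) =
      c • (SchwartzMap.convolution (ContinuousLinearMap.mul ℂ ℂ) K f).toLp p volume := by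
    rw [h1]
    rfl
  rw [h4, norm_smul]
  refine (mul_le_of_le_one_left (norm_nonneg _) hcle).trans ?_
  rw [norm_toLp, norm_toLp, norm_toLp, ← ENNReal.toReal_mul]
  exact ENNReal.toReal_mono (ENNReal.mul_ne_top (K.memLp 1 volume).2.ne (f.memLp p volume).2.ne) h3

end Multiplier
end ConeLP

namespace ConeLP

section Approximation

variable {V : Type*} [NormedAddCommGroup V] [InnerProductSpace ℝ V] [FiniteDimensional ℝ V]
  [MeasurableSpace V] [BorelSpace V]

/-! ### Uniform multiplier bounds for compact families -/

theorem exists_norm_toLp_invHat_le : ∃ (S : Finset (ℕ × ℕ)) (C : NNReal), ∀ u : 𝓢(V, ℂ),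
    ‖(invHat V u).toLp 1‖ ≤ C * (S.sup (schwartzSeminormFamily ℂ V ℂ)) u := by
  set q : Seminorm ℂ 𝓢(V, ℂ) :=
    (normSeminorm ℂ (Lp ℂ 1 (volume : Measure V))).comp
      ((SchwartzMap.toLpCLM ℂ ℂ 1 (volume : Measure V)).comp (invHat V)).toLinearMap with hq
  have hc : Continuous q :=
    continuous_norm.comp ((SchwartzMap.toLpCLM ℂ ℂ 1 (volume : Measure V)).comp (invHat V)).continuous
  obtain ⟨S, C, -, h⟩ := Seminorm.bound_of_continuous (schwartz_withSeminorms ℂ V ℂ) q hc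
  exact ⟨S, C, fun u => h u⟩

theorem norm_iteratedFDeriv_slice_le {E F : Type*} [NormedAddCommGroup E] [NormedSpace ℝ E]
    [NormedAddCommGroup F] [NormedSpace ℝ F]
    {G : E × V → F} (hG : ContDiff ℝ ∞ G) (w : E) (ξ : V) (n : ℕ) :
    ‖iteratedFDeriv ℝ n (fun η => G (w, η)) ξ‖ ≤ ‖iteratedFDeriv ℝ n G (w, ξ)‖ := by
  have h1 : (fun η => G (w, η)) = (fun z => G ((w, 0) + z)) ∘ ContinuousLinearMap.inr ℝ E V := by
    ext η
    simp
  have h2 : ContDiff ℝ ∞ fun z => G ((w, 0) + z) := hG.comp (contDiff_const.add contDiff_id)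
  rw [h1, ContinuousLinearMap.iteratedFDeriv_comp_right _ h2 ξ (i := n) (by exact_mod_cast le_top),
    iteratedFDeriv_comp_add_left]
  have h3 : (w, (0 : V)) + ContinuousLinearMap.inr ℝ E V ξ = (w, ξ) := by simp
  rw [h3]
  refine (ContinuousMultilinearMap.norm_compContinuousLinearMap_le _ _).trans ?_
  refine mul_le_of_le_one_right (norm_nonneg _) (Finset.prod_le_one (fun _ _ => norm_nonneg _)
    fun _ _ => ?_)
  exact ContinuousLinearMap.norm_inr_le_one ℝ E V

/-- The `L¹` norm of the kernel is bounded by finitely many Schwartz seminorms of the symbol. These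
are uniformly bounded because parameters and frequencies range over compact sets. -/
theorem exists_multiplierBound {p : ℝ≥0∞} [Fact (1 ≤ p)] (hp : p ≠ ⊤) {E : Type*}
    [NormedAddCommGroup E] [NormedSpace ℝ E] {F : E × V → ℝ} (hF : ContDiff ℝ ∞ F) {K : Set E}
    (hK : IsCompact K) {B : Set V} (hB : IsCompact B)
    (hFB : ∀ w ∈ K, ∀ ξ, F (w, ξ) ≠ 0 → ξ ∈ B) :
    ∃ C : ℝ, 0 ≤ C ∧ ∀ w ∈ K, MultiplierBound p (fun ξ => F (w, ξ)) C := by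
  obtain ⟨S, C, hSC⟩ := exists_norm_toLp_invHat_le (V := V)
  set G : E × V → ℂ := fun z => (F z : ℂ) with hGdef
  have hG : ContDiff ℝ ∞ G := Complex.ofRealCLM.contDiff.comp hF
  have h1 : ∀ kn : ℕ × ℕ, ∃ R : ℝ, 0 ≤ R ∧ ∀ w ∈ K, ∀ ξ ∈ B,
      ‖ξ‖ ^ kn.1 * ‖iteratedFDeriv ℝ kn.2 G (w, ξ)‖ ≤ R := by
    intro kn
    have hc : Continuous fun z : E × V => ‖z.2‖ ^ kn.1 * ‖iteratedFDeriv ℝ kn.2 G z‖ :=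
      (continuous_snd.norm.pow _).mul
        (hG.continuous_iteratedFDeriv (m := kn.2) (by exact_mod_cast le_top)).norm
    obtain ⟨R, hR⟩ := (hK.prod hB).bddAbove_image hc.continuousOn
    exact ⟨max R 0, le_max_right _ _, fun w hw ξ hξ =>
      (hR ⟨(w, ξ), ⟨hw, hξ⟩, rfl⟩).trans (le_max_left _ _)⟩
  choose R hR0 hR using h1
  refine ⟨C * ∑ kn ∈ S, R kn, mul_nonneg C.2 (Finset.sum_nonneg fun kn _ => hR0 kn),
    fun w hw => ?_⟩
  have hsupp : tsupport (fun ξ => G (w, ξ)) ⊆ B := by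
    refine closure_minimal (fun ξ hξ => hFB w hw ξ fun h0 => hξ ?_) hB.isClosed
    simp [G, h0]
  have hcs : HasCompactSupport fun ξ => G (w, ξ) := hB.of_isClosed_subset (isClosed_tsupport _) hsupp
  have hsm : ContDiff ℝ ∞ fun ξ => G (w, ξ) := hG.comp (contDiff_const.prodMk contDiff_id)
  set u : 𝓢(V, ℂ) := hcs.toSchwartzMap hsm with hu
  have hK1 := MultiplierBound.of_kernel (p := p) hp (m := fun ξ => F (w, ξ)) (invHat V u)
    fun ξ => by rw [fourierHat_invHat]; rfl
  refine hK1.mono ((hSC u).trans (mul_le_mul_of_nonneg_left ?_ C.2))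
  refine Seminorm.finset_sup_apply_le (Finset.sum_nonneg fun kn _ => hR0 kn) fun kn hkn => ?_
  refine le_trans ?_ (Finset.single_le_sum (fun kn _ => hR0 kn) hkn)
  refine SchwartzMap.seminorm_le_bound ℂ kn.1 kn.2 u (hR0 kn) fun ξ => ?_
  by_cases hξ : ξ ∈ B
  · refine (mul_le_mul_of_nonneg_left ?_ (by positivity)).trans (hR kn w hw ξ hξ)
    exact norm_iteratedFDeriv_slice_le hG w ξ kn.2
  · have h0 : iteratedFDeriv ℝ kn.2 u ξ = 0 := by
      by_contra hne
      exact hξ (hsupp (support_iteratedFDeriv_subset (𝕜 := ℝ) kn.2 hne))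
    rw [h0, norm_zero, mul_zero]
    exact hR0 kn

/-! ### Supports of tempered distributions -/

/-- Multiplication by a smooth function of compact support. -/
abbrev smulCutoff (χ : V → ℝ) (φ : 𝓢(V, ℂ)) : 𝓢(V, ℂ) := SchwartzMap.smulLeftCLM ℂ χ φ

theorem smulCutoff_apply {χ : V → ℝ} (hχ : ContDiff ℝ ∞ χ) (hχc : HasCompactSupport χ)
    (φ : 𝓢(V, ℂ)) (x : V) : smulCutoff χ φ x = χ x * φ x := by
  rw [smulCutoff, SchwartzMap.smulLeftCLM_apply_apply (hχc.hasTemperateGrowth hχ),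
    Complex.real_smul]

theorem apply_eq_zero_of_disjoint_dsupport (T : 𝓢'(V, ℂ)) {φ : 𝓢(V, ℂ)}
    (hφ : HasCompactSupport φ) (hd : Disjoint (tsupport φ) (dsupport T)) : T φ = 0 := by
  have key : ∃ χ : V → ℝ, ContDiff ℝ ∞ χ ∧ HasCompactSupport χ ∧ (∀ x ∈ tsupport φ, χ x = 1) ∧
      ∀ w : 𝓢(V, ℂ), T (smulCutoff χ w) = 0 := by
    refine IsCompact.induction_on (p := fun S => ∃ χ : V → ℝ, ContDiff ℝ ∞ χ ∧
      HasCompactSupport χ ∧ (∀ x ∈ S, χ x = 1) ∧ ∀ w : 𝓢(V, ℂ), T (smulCutoff χ w) = 0) hφ ?_ ?_ ?_ ?_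
    · have h0 : ContDiff ℝ ∞ (0 : V → ℝ) := contDiff_const
      refine ⟨0, h0, HasCompactSupport.zero, fun x hx => hx.elim, fun w => ?_⟩
      have : smulCutoff (0 : V → ℝ) w = 0 := by
        ext x
        rw [smulCutoff_apply h0 HasCompactSupport.zero]
        simp
      rw [this, map_zero]
    · rintro S S' hSS' ⟨χ, h1, h2, h3, h4⟩
      exact ⟨χ, h1, h2, fun x hx => h3 x (hSS' hx), h4⟩
    -- The combination `χ + χ' - χ χ'` is one wherever either cutoff is one, and the distribution
    -- still kills its multiples.
    · rintro S S' ⟨χ, h1, h2, h3, h4⟩ ⟨χ', h1', h2', h3', h4'⟩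
      have hs : ContDiff ℝ ∞ (χ + χ' - χ * χ') := (h1.add h1').sub (h1.mul h1')
      have hc : HasCompactSupport (χ + χ' - χ * χ') := (h2.add h2').sub (h2.mul_right)
      refine ⟨χ + χ' - χ * χ', hs, hc, ?_, fun w => ?_⟩
      · rintro x (hx | hx)
        · simp [h3 x hx]
        · simp [h3' x hx]
      · have : smulCutoff (χ + χ' - χ * χ') w =
            smulCutoff χ w + smulCutoff χ' w - smulCutoff χ (smulCutoff χ' w) := by
          ext x
          rw [sub_apply, add_apply, smulCutoff_apply hs hc, smulCutoff_apply h1 h2,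
            smulCutoff_apply h1 h2, smulCutoff_apply h1' h2']
          simp only [Pi.add_apply, Pi.sub_apply, Pi.mul_apply]
          push_cast
          ring
        rw [this, map_sub, map_add, h4, h4', h4]
        simp
    · intro x hx
      obtain ⟨U, hU, hUo, hxU⟩ := (notMem_dsupport_iff (f := (T : 𝓢(V, ℂ) → ℂ)) x).1
        (disjoint_left.1 hd hx)
      obtain ⟨ε, hε, hεU⟩ := Metric.isOpen_iff.1 hUo x hxU
      set b : ContDiffBump x := ⟨ε / 4, ε / 2, by positivity, by linarith⟩ with hb
      have hbs : ContDiff ℝ ∞ b := b.contDiff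
      refine ⟨Metric.closedBall x (ε / 4), mem_nhdsWithin_of_mem_nhds
        (Metric.closedBall_mem_nhds x (by positivity)), b, hbs, b.hasCompactSupport,
        fun y hy => b.one_of_mem_closedBall hy, fun w => hU _ ?_⟩
      refine (SchwartzMap.tsupport_smulLeftCLM_subset (F := ℂ) b w).trans ?_
      refine inter_subset_right.trans ?_
      rw [b.tsupport_eq]
      refine (Metric.closedBall_subset_ball ?_).trans hεU
      change ε / 2 < ε
      linarith
  obtain ⟨χ, h1, h2, h3, h4⟩ := key
  have h5 : smulCutoff χ φ = φ := by
    ext x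
    rw [smulCutoff_apply h1 h2]
    by_cases hx : x ∈ tsupport φ
    · rw [h3 x hx]
      simp
    · rw [image_eq_zero_of_notMem_tsupport hx, mul_zero]
  rw [← h5, h4]

end Approximation
end ConeLP

namespace ConeLP

/-! ### Density of compactly supported Schwartz functions -/

section Density

variable {V : Type*} [NormedAddCommGroup V] [InnerProductSpace ℝ V] [FiniteDimensional ℝ V]
  [MeasurableSpace V] [BorelSpace V]

theorem norm_iteratedFDeriv_comp_smul_le {f : V → ℝ} (hf : ContDiff ℝ ∞ f) {c : ℝ} (hc0 : 0 ≤ c)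
    (hc : c ≤ 1) (n : ℕ) (x : V) :
    ‖iteratedFDeriv ℝ n (fun y => f (c • y)) x‖ ≤ ‖iteratedFDeriv ℝ n f (c • x)‖ := by
  have h1 : (fun y => f (c • y)) = f ∘ (c • ContinuousLinearMap.id ℝ V) := rfl
  rw [h1, ContinuousLinearMap.iteratedFDeriv_comp_right _ hf x (i := n) (by exact_mod_cast le_top)]
  refine (ContinuousMultilinearMap.norm_compContinuousLinearMap_le _ _).trans ?_
  refine mul_le_of_le_one_right (norm_nonneg _) (Finset.prod_le_one (fun _ _ => norm_nonneg _)
    fun _ _ => ?_)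
  rw [norm_smul, Real.norm_of_nonneg hc0]
  exact mul_le_one₀ hc (norm_nonneg _) ContinuousLinearMap.norm_id_le

/-- Compactly supported functions are dense in the Schwartz space. -/
theorem exists_tendsto_hasCompactSupport (w : 𝓢(V, ℂ)) : ∃ u : ℕ → 𝓢(V, ℂ),
    (∀ N, HasCompactSupport (u N)) ∧ (∀ N, tsupport (u N) ⊆ tsupport w) ∧
      Filter.Tendsto u Filter.atTop (nhds w) := by
  set θ : ContDiffBump (0 : V) := ⟨1, 2, one_pos, one_lt_two⟩ with hθ
  have hθs : ContDiff ℝ ∞ θ := θ.contDiff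
  set κ : V → ℝ := fun x => 1 - θ x with hκ
  have hκs : ContDiff ℝ ∞ κ := contDiff_const.sub hθs
  set c : ℕ → ℝ := fun N => ((N : ℝ) + 1)⁻¹ with hcdef
  have hc0 : ∀ N, 0 < c N := fun N => by positivity
  have hc1 : ∀ N, c N ≤ 1 := fun N => inv_le_one_of_one_le₀ (by linarith [Nat.cast_nonneg (α := ℝ) N])
  have hθN : ∀ N, ContDiff ℝ ∞ fun x => θ (c N • x) := fun N =>
    hθs.comp (contDiff_const_smul (c N))
  have hθNc : ∀ N, HasCompactSupport fun x => θ (c N • x) := fun N => by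
    have := θ.hasCompactSupport.comp_homeomorph (Homeomorph.smulOfNeZero (c N) (hc0 N).ne')
    exact this
  have hbd : ∀ i, ∃ R : ℝ, 0 ≤ R ∧ ∀ x, ‖iteratedFDeriv ℝ i κ x‖ ≤ R := by
    intro i
    obtain ⟨R, hR⟩ := (θ.hasCompactSupport.iteratedFDeriv (𝕜 := ℝ) i).exists_bound_of_continuous
      (hθs.continuous_iteratedFDeriv (m := i) (by exact_mod_cast le_top))
    refine ⟨1 + |R|, by positivity, fun x => ?_⟩
    have h1 : κ = (fun _ : V => (1 : ℝ)) - (fun y : V => θ y) := rfl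
    rw [h1, iteratedFDeriv_sub_apply (contDiff_const.contDiffAt)
      ((hθs.of_le (by exact_mod_cast le_top)).contDiffAt)]
    refine (norm_sub_le _ _).trans (add_le_add ?_ ((hR x).trans (le_abs_self R)))
    rcases Nat.eq_zero_or_pos i with rfl | hi
    · rw [norm_iteratedFDeriv_zero]
      simp
    · rw [iteratedFDeriv_const_of_ne hi.ne']
      simp
  choose R hR0 hR using hbd
  set u : ℕ → 𝓢(V, ℂ) := fun N => smulCutoff (fun x => θ (c N • x)) w with hu
  have huapp : ∀ N x, u N x = (θ (c N • x) : ℝ) * w x := fun N x =>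
    smulCutoff_apply (hθN N) (hθNc N) w x
  refine ⟨u, fun N => ?_, fun N => ?_, ?_⟩
  · refine (hθNc N).mono fun x hx => ?_
    rw [Function.mem_support] at hx ⊢
    intro h0
    exact hx (by rw [huapp, h0]; simp)
  · exact (SchwartzMap.tsupport_smulLeftCLM_subset (F := ℂ) _ w).trans inter_subset_left
  rw [(schwartz_withSeminorms ℝ V ℂ).tendsto_nhds]
  rintro ⟨k, n⟩ ε hε
  set A : ℝ := ∑ i ∈ Finset.range (n + 1), (n.choose i : ℝ) * R i *
    SchwartzMap.seminorm ℝ (k + 1) (n - i) w with hA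
  have hA0 : 0 ≤ A := Finset.sum_nonneg fun i _ =>
    mul_nonneg (mul_nonneg (Nat.cast_nonneg _) (hR0 i)) (apply_nonneg _ _)
  have hmain : ∀ N, SchwartzMap.seminorm ℝ k n (u N - w) ≤ c N * A := by
    intro N
    rw [map_sub_rev]
    refine SchwartzMap.seminorm_le_bound ℝ k n _ (mul_nonneg (hc0 N).le hA0) fun x => ?_
    have h1 : ((w - u N : 𝓢(V, ℂ)) : V → ℂ) = fun y => κ (c N • y) • w y := by
      ext y
      rw [sub_apply, huapp, hκ, Complex.real_smul]
      push_cast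
      ring
    rw [h1]
    by_cases hx : ‖c N • x‖ < 1
    · have h3 : (fun y => κ (c N • y) • w y) =ᶠ[nhds x] fun _ => 0 := by
        have hopen : IsOpen {y : V | ‖c N • y‖ < 1} :=
          isOpen_lt (continuous_const_smul (c N)).norm continuous_const
        filter_upwards [hopen.mem_nhds hx] with y hy
        have : θ (c N • y) = 1 := θ.one_of_mem_closedBall (by simpa using le_of_lt hy)
        simp [hκ, this]
      rw [(Filter.EventuallyEq.iteratedFDeriv ℝ h3 n).eq_of_nhds]
      have h4 : iteratedFDeriv ℝ n (fun _ : V => (0 : ℂ)) x = 0 := by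
        simp
      rw [h4, norm_zero, mul_zero]
      exact mul_nonneg (hc0 N).le hA0
    -- Away from the region where the cutoff is locally one, this factor may be inserted: it trades
    -- one more power of `‖x‖` in the seminorm for the small constant `c N`.
    · have hx1 : 1 ≤ c N * ‖x‖ := by
        rw [norm_smul, Real.norm_of_nonneg (hc0 N).le] at hx
        exact not_lt.1 hx
      have h5 := norm_iteratedFDeriv_smul_le (𝕜 := ℝ) (hκs.comp (contDiff_const_smul (c N)))
        (w.smooth ⊤) x (n := n) (by exact_mod_cast le_top)
      calc ‖x‖ ^ k * ‖iteratedFDeriv ℝ n (fun y => κ (c N • y) • w y) x‖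
          ≤ ‖x‖ ^ k * ∑ i ∈ Finset.range (n + 1), (n.choose i : ℝ) *
              ‖iteratedFDeriv ℝ i (fun y => κ (c N • y)) x‖ * ‖iteratedFDeriv ℝ (n - i) w x‖ := by
            gcongr
            exact h5
        _ ≤ (c N * ‖x‖) * (‖x‖ ^ k * ∑ i ∈ Finset.range (n + 1), (n.choose i : ℝ) *
              ‖iteratedFDeriv ℝ i (fun y => κ (c N • y)) x‖ * ‖iteratedFDeriv ℝ (n - i) w x‖) := by
            refine le_mul_of_one_le_left ?_ hx1
            positivity
        _ = c N * ∑ i ∈ Finset.range (n + 1), (n.choose i : ℝ) *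
              ‖iteratedFDeriv ℝ i (fun y => κ (c N • y)) x‖ *
              (‖x‖ ^ (k + 1) * ‖iteratedFDeriv ℝ (n - i) w x‖) := by
            rw [mul_assoc, pow_succ, Finset.mul_sum, Finset.mul_sum]
            congr 1
            refine Finset.sum_congr rfl fun i _ => ?_
            ring
        _ ≤ c N * A := by
            refine mul_le_mul_of_nonneg_left (Finset.sum_le_sum fun i _ => ?_) (hc0 N).le
            refine mul_le_mul (mul_le_mul_of_nonneg_left ?_ (Nat.cast_nonneg _))
              (SchwartzMap.le_seminorm ℝ (k + 1) (n - i) w x) (by positivity)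
              (mul_nonneg (Nat.cast_nonneg _) (hR0 i))
            exact (norm_iteratedFDeriv_comp_smul_le hκs (hc0 N).le (hc1 N) i x).trans (hR i _)
  have hlim : Filter.Tendsto (fun N => c N * A) Filter.atTop (nhds 0) := by
    have := (tendsto_one_div_add_atTop_nhds_zero_nat (𝕜 := ℝ)).mul_const A
    simpa [hcdef] using this
  filter_upwards [hlim.eventually (gt_mem_nhds hε)] with N hN
  exact (hmain N).trans_lt hN

theorem apply_eq_zero_of_disjoint_dsupport' (T : 𝓢'(V, ℂ)) {φ : 𝓢(V, ℂ)}
    (hd : Disjoint (tsupport φ) (dsupport T)) : T φ = 0 := by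
  obtain ⟨u, h1, h2, h3⟩ := exists_tendsto_hasCompactSupport φ
  have h4 : Filter.Tendsto (fun N => T (u N)) Filter.atTop (nhds (T φ)) :=
    (T.continuous.tendsto φ).comp h3
  have h5 : (fun N => T (u N)) = fun _ => 0 := by
    ext N
    exact apply_eq_zero_of_disjoint_dsupport T (h1 N) (hd.mono_left (h2 N))
  rw [h5] at h4
  exact tendsto_nhds_unique h4 tendsto_const_nhds

/-! ### Approximation of band-limited functions -/

variable {p : ℝ≥0∞} [Fact (1 ≤ p)]

theorem toTemperedDistribution_toLp_apply (f φ : 𝓢(V, ℂ)) :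
    ((f.toLp p (volume : Measure V) : Lp ℂ p (volume : Measure V)) : 𝓢'(V, ℂ)) φ =
      ∫ x, φ x * f x := by
  have h := Lp.toTemperedDistribution_toLp_eq (p := p) (μ := (volume : Measure V)) f
  rw [h, SchwartzMap.toTemperedDistributionCLM_apply_apply (volume : Measure V)]
  rfl

theorem temperedHat_toLp_apply (f φ : 𝓢(V, ℂ)) :
    temperedHat ((f.toLp p (volume : Measure V) : Lp ℂ p (volume : Measure V)) : 𝓢'(V, ℂ)) φ =
      ∫ x, φ x * fourierHat V f x := by
  rw [temperedHat_apply, toTemperedDistribution_toLp_apply, integral_fourierHat_mul]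

theorem fourierSupport_toLp_subset (f : 𝓢(V, ℂ)) :
    fourierSupport (f.toLp p (volume : Measure V)) ⊆ tsupport (fourierHat V f) := by
  intro x hx
  by_contra hxt
  refine (notMem_dsupport_iff _).2 ⟨(tsupport (fourierHat V f))ᶜ, fun φ hφ => ?_,
    (isClosed_tsupport _).isOpen_compl, hxt⟩ hx
  rw [temperedHat_toLp_apply]
  refine integral_eq_zero_of_ae (Filter.Eventually.of_forall fun y => ?_)
  by_cases hy : y ∈ tsupport φ
  · simp [image_eq_zero_of_notMem_tsupport (hφ hy)]
  · simp [image_eq_zero_of_notMem_tsupport hy]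

/-- Schwartz approximants of `f` are filtered by the multiplier `χ`. Boundedness on `Lᵖ` makes the
filtered sequence Cauchy, and its limit is `f` because `χ` is one near the spectrum and `Lᵖ` embeds
in the tempered distributions. -/
theorem exists_tendsto_of_fourierSupport_subset (hp : p ≠ ⊤) (f : Lp ℂ p (volume : Measure V))
    {χ : V → ℝ} (hχ : ContDiff ℝ ∞ χ) (hχc : HasCompactSupport χ)
    (hf : ∀ x ∈ fourierSupport f, ∀ᶠ y in nhds x, χ y = 1) :
    ∃ h : ℕ → 𝓢(V, ℂ), (∀ n, ∃ u : 𝓢(V, ℂ), ∀ ξ, fourierHat V (h n) ξ = χ ξ * u ξ) ∧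
      Filter.Tendsto (fun n => (h n).toLp p (volume : Measure V)) Filter.atTop (nhds f) := by
  obtain ⟨B, hB0, hB⟩ := exists_multiplierBound (p := p) hp (E := ℝ) (F := fun z => χ z.2)
    (hχ.comp contDiff_snd) (isCompact_singleton (x := (0 : ℝ))) hχc
    (fun w _ ξ hξ => subset_tsupport _ hξ)
  have hMB : MultiplierBound p χ B := hB 0 rfl
  have hdense := SchwartzMap.denseRange_toLpCLM (E := V) (F := ℂ) (p := p) hp
    (μ := (volume : Measure V))
  obtain ⟨a, ha, hlim⟩ := mem_closure_iff_seq_limit.1 (hdense f)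
  choose v hv using ha
  have hv' : ∀ n, (v n).toLp p (volume : Measure V) = a n := hv
  set h : ℕ → 𝓢(V, ℂ) := fun n => invHat V (smulCutoff χ (fourierHat V (v n))) with hh
  have hhat : ∀ n, fourierHat V (h n) = smulCutoff χ (fourierHat V (v n)) := fun n =>
    fourierHat_invHat _
  refine ⟨h, fun n => ⟨fourierHat V (v n), fun ξ => ?_⟩, ?_⟩
  · rw [hhat, smulCutoff_apply hχ hχc]
  have hdiff : ∀ m n, dist ((h m).toLp p (volume : Measure V)) ((h n).toLp p volume) ≤
      B * dist (a m) (a n) := by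
    intro m n
    rw [dist_eq_norm, dist_eq_norm, ← hv', ← hv']
    refine hMB (v m - v n) (h m - h n) fun ξ => ?_
    rw [map_sub, map_sub, hhat, hhat, sub_apply, sub_apply, smulCutoff_apply hχ hχc,
      smulCutoff_apply hχ hχc]
    ring
  have hcauchy : CauchySeq fun n => (h n).toLp p (volume : Measure V) := by
    rw [Metric.cauchySeq_iff]
    intro ε hε
    obtain ⟨N, hN⟩ := Metric.cauchySeq_iff.1 hlim.cauchySeq (ε / (B + 1)) (by positivity)
    refine ⟨N, fun m hm n hn => (hdiff m n).trans_lt ?_⟩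
    have h1 := hN m hm n hn
    rw [lt_div_iff₀ (by positivity)] at h1
    nlinarith [dist_nonneg (x := a m) (y := a n)]
  obtain ⟨F, hF⟩ := cauchySeq_tendsto_of_complete hcauchy
  have hcont : ∀ φ : 𝓢(V, ℂ), Continuous fun g : Lp ℂ p (volume : Measure V) =>
      (g : 𝓢'(V, ℂ)) φ := by
    intro φ
    have h1 := (Lp.toTemperedDistributionCLM ℂ (volume : Measure V) p).continuous
    exact (PointwiseConvergenceCLM.evalCLM (RingHom.id ℂ) ℂ φ).continuous.comp h1
  have hvanish : ∀ φ : 𝓢(V, ℂ), temperedHat (f : 𝓢'(V, ℂ)) (φ - smulCutoff χ φ) = 0 := by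
    intro φ
    refine apply_eq_zero_of_disjoint_dsupport' _ (disjoint_left.2 fun x hx hxf => ?_)
    have h1 : (fun y => (φ - smulCutoff χ φ) y) =ᶠ[nhds x] 0 := by
      filter_upwards [hf x hxf] with y hy
      rw [sub_apply, smulCutoff_apply hχ hχc, hy]
      simp
    exact (notMem_tsupport_iff_eventuallyEq.2 h1) hx
  have hEq : F = f := by
    have hker := Lp.ker_toTemperedDistributionCLM_eq_bot (F := ℂ) (μ := (volume : Measure V))
      (p := p)
    refine LinearMap.ker_eq_bot.1 hker ?_
    ext w
    obtain ⟨φ, rfl⟩ : ∃ φ, fourierHat V φ = w := ⟨invHat V w, fourierHat_invHat w⟩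
    change (F : 𝓢'(V, ℂ)) (fourierHat V φ) = (f : 𝓢'(V, ℂ)) (fourierHat V φ)
    have h1 : Filter.Tendsto (fun n => (((h n).toLp p (volume : Measure V) :
        Lp ℂ p (volume : Measure V)) : 𝓢'(V, ℂ)) (fourierHat V φ)) Filter.atTop
        (nhds ((F : 𝓢'(V, ℂ)) (fourierHat V φ))) := ((hcont (fourierHat V φ)).tendsto F).comp hF
    have h2 : Filter.Tendsto (fun n => ((a n : Lp ℂ p (volume : Measure V)) : 𝓢'(V, ℂ))
        (fourierHat V (smulCutoff χ φ))) Filter.atTop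
        (nhds ((f : 𝓢'(V, ℂ)) (fourierHat V (smulCutoff χ φ)))) :=
      ((hcont _).tendsto f).comp hlim
    have h3 : ∀ n, (((h n).toLp p (volume : Measure V) :
        Lp ℂ p (volume : Measure V)) : 𝓢'(V, ℂ)) (fourierHat V φ) =
        ((a n : Lp ℂ p (volume : Measure V)) : 𝓢'(V, ℂ)) (fourierHat V (smulCutoff χ φ)) := by
      intro n
      rw [← hv', ← temperedHat_apply, ← temperedHat_apply, temperedHat_toLp_apply,
        temperedHat_toLp_apply]
      refine integral_congr_ae (Filter.Eventually.of_forall fun x => ?_)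
      simp only [hhat, smulCutoff_apply hχ hχc]
      ring
    simp only [h3] at h1
    rw [tendsto_nhds_unique h1 h2]
    have h4 := hvanish φ
    rw [map_sub, sub_eq_zero] at h4
    exact h4.symm
  rwa [hEq] at hF

end Density
end ConeLP

namespace ConeLP

/-! ### Multiplier bounds for the Littlewood–Paley functions -/

/-- A positive smooth function on the line that coincides with the identity on `[1, ∞)`. -/
def softPos (t : ℝ) : ℝ := Real.smoothTransition t * t + (1 - Real.smoothTransition t)

theorem softPos_pos (t : ℝ) : 0 < softPos t := by
  rw [softPos]
  rcases le_or_gt t 0 with h | h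
  · rw [Real.smoothTransition.zero_of_nonpos h]
    simp
  · have h1 := Real.smoothTransition.pos_of_pos h
    have h2 := Real.smoothTransition.le_one t
    have := mul_pos h1 h
    linarith

theorem softPos_eq {t : ℝ} (h : 1 ≤ t) : softPos t = t := by
  rw [softPos, Real.smoothTransition.one_of_one_le h]
  ring

theorem contDiff_softPos : ContDiff ℝ ∞ softPos :=
  (Real.smoothTransition.contDiff.mul contDiff_id).add
    (contDiff_const.sub Real.smoothTransition.contDiff)

/-- The unbounded parameter `r` becomes `q = (1 + r)⁻¹` in the compact interval `[0, 1]`, with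
smooth dependence up to `q = 0`. This gives bounds uniform in all `r ≥ 0`. -/
theorem exp_neg_eq_expNegInvGlue {r v : ℝ} (hr : 0 ≤ r) (hv : 1 ≤ v) :
    Real.exp (-((1 + r) * v)) = expNegInvGlue ((1 + r)⁻¹ / softPos v) := by
  have h : 0 < (1 + r)⁻¹ / v := by positivity
  rw [softPos_eq hv, expNegInvGlue, if_neg (not_le.2 h), inv_div, div_inv_eq_mul, mul_comm v]

/-- A smooth function with support in `(1/2, 2)` whose dyadic dilates sum up to one. -/
def dyadicCutoff (u : ℝ) : ℝ :=
  Real.smoothTransition ((9 / 5 - u) / (3 / 5)) - Real.smoothTransition ((9 / 5 - 2 * u) / (3 / 5))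

theorem contDiff_dyadicCutoff : ContDiff ℝ ∞ dyadicCutoff :=
  (Real.smoothTransition.contDiff.comp (by fun_prop)).sub
    (Real.smoothTransition.contDiff.comp (by fun_prop))

theorem dyadicCutoff_ne_zero {u : ℝ} (h : dyadicCutoff u ≠ 0) : 3 / 5 ≤ u ∧ u ≤ 9 / 5 := by
  constructor
  · by_contra hu
    refine h ?_
    rw [dyadicCutoff, Real.smoothTransition.one_of_one_le (by linarith),
      Real.smoothTransition.one_of_one_le (by linarith), sub_self]
  · by_contra hu
    refine h ?_
    rw [dyadicCutoff, Real.smoothTransition.zero_of_nonpos (by linarith),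
      Real.smoothTransition.zero_of_nonpos (by linarith), sub_self]

/-- The sum telescopes; `N` is so large that on `[r, R]` one end value is one and the other is zero.
-/
theorem sum_dyadicCutoff {r R : ℝ} (hr : 0 < r) : ∃ A : Finset ℤ, ∀ u ∈ Icc r R,
    ∑ m ∈ A, dyadicCutoff ((2 : ℝ) ^ (-m) * u) = 1 := by
  obtain ⟨N, hN⟩ := pow_unbounded_of_one_lt (max R (2 * r⁻¹)) (one_lt_two (α := ℝ))
  have hR : R < 2 ^ N := (le_max_left _ _).trans_lt hN
  have hr' : 2 * r⁻¹ < 2 ^ N := (le_max_right _ _).trans_lt hN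
  refine ⟨(Finset.range (2 * N + 1)).image fun i : ℕ => (i : ℤ) - N, fun u hu => ?_⟩
  rw [Finset.sum_image (fun i _ j _ h => by simpa using h)]
  set T : ℕ → ℝ := fun i =>
    Real.smoothTransition ((9 / 5 - 2 * ((2 : ℝ) ^ (-((i : ℤ) - N)) * u)) / (3 / 5)) with hT
  have h1 : ∀ i : ℕ, dyadicCutoff ((2 : ℝ) ^ (-((i : ℤ) - N)) * u) = T (i + 1) - T i := by
    intro i
    rw [dyadicCutoff, hT]
    simp only
    have : (2 : ℝ) * ((2 : ℝ) ^ (-(((i + 1 : ℕ) : ℤ) - N)) * u) = (2 : ℝ) ^ (-((i : ℤ) - N)) * u := by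
      rw [← mul_assoc, ← zpow_one_add₀ two_ne_zero]
      congr 2
      push_cast
      ring
    rw [this]
  simp_rw [h1]
  rw [Finset.sum_range_sub]
  have hpow : (0 : ℝ) < 2 ^ N := by positivity
  have h2 : T (2 * N + 1) = 1 := by
    refine Real.smoothTransition.one_of_one_le ?_
    have h3 : (2 : ℝ) * ((2 : ℝ) ^ (-(((2 * N + 1 : ℕ) : ℤ) - N)) * u) = (2 ^ N)⁻¹ * u := by
      rw [← mul_assoc, ← zpow_one_add₀ two_ne_zero, ← zpow_natCast, ← zpow_neg]
      congr 2
      push_cast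
      ring
    have h4 : (2 ^ N)⁻¹ * u ≤ 1 := by
      rw [inv_mul_le_iff₀ hpow]
      linarith [hu.2]
    rw [h3]
    linarith
  have h5 : T 0 = 0 := by
    refine Real.smoothTransition.zero_of_nonpos ?_
    have h3 : (2 : ℝ) ^ (-(((0 : ℕ) : ℤ) - N)) = 2 ^ N := by
      rw [← zpow_natCast]
      congr 1
      push_cast
      ring
    have h4 : 2 ≤ 2 ^ N * u := by
      have h6 := mul_le_mul_of_nonneg_right hr'.le hr.le
      rw [mul_assoc, inv_mul_cancel₀ hr.ne', mul_one] at h6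
      exact h6.trans (mul_le_mul_of_nonneg_left hu.1 hpow.le)
    rw [h3]
    refine div_nonpos_of_nonpos_of_nonneg ?_ (by norm_num)
    linarith
  rw [h2, h5, sub_zero]

section

variable {V : Type*} [NormedAddCommGroup V] [InnerProductSpace ℝ V] [FiniteDimensional ℝ V]
  [MeasurableSpace V] [BorelSpace V]

theorem MultiplierBound.of_eq_zero {p : ℝ≥0∞} [Fact (1 ≤ p)] {m : V → ℝ} {B : ℝ}
    (h : ∀ ξ, m ξ = 0) (hB : 0 ≤ B) : MultiplierBound p m B := by
  intro f f' hf
  have h1 : f' = 0 := by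
    apply fourierHat_injective
    ext ξ
    simp [hf, h]
  have h0 : (0 : 𝓢(V, ℂ)).toLp p (volume : Measure V) = 0 := rfl
  rw [h1, h0, norm_zero]
  positivity

end

namespace JordanCone
namespace LittlewoodPaley

variable {V : Type*} [NormedAddCommGroup V] [InnerProductSpace ℝ V] [FiniteDimensional ℝ V]
  [Nontrivial V] [MeasurableSpace V] [BorelSpace V] {𝒞 : JordanCone V} (P : 𝒞.LittlewoodPaley)
  {p : ℝ≥0∞} [Fact (1 ≤ p)]

/-- The transported symbols form a compact family in the parameters `h`, `z` and `q`. For the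
denominator of `ψHat`, `softPos` ensures smoothness everywhere and changes nothing on the support,
where that denominator is at least one. -/
theorem exists_multiplierBound_family (hp : p ≠ ⊤) {a : ℝ → ℝ} (ha : ContDiff ℝ ∞ a)
    (b c R : ℝ) : ∃ C : ℝ, 0 ≤ C ∧ ∀ k, ∀ z : V, ‖z‖ ≤ R → ∀ q ∈ Icc (0 : ℝ) 1,
      MultiplierBound p (fun ξ => P.ψHat k (P.g k ξ) *
        (a ⟪z, ξ⟫ * expNegInvGlue (q / softPos (b * ⟪z, ξ⟫ + c)))) C := by
  obtain ⟨N, C₀, hfam⟩ := P.exists_ψHat_family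
  set F : ((Fin N → (V →L[ℝ] V)) × V × ℝ) × V → ℝ := fun w =>
    P.φ₀ w.2 / softPos (∑ i, P.φ₀ (w.1.1 i w.2)) * (a ⟪w.1.2.1, w.2⟫ *
      expNegInvGlue (w.1.2.2 / softPos (b * ⟪w.1.2.1, w.2⟫ + c))) with hFdef
  have hin : ContDiff ℝ ∞ fun w : ((Fin N → (V →L[ℝ] V)) × V × ℝ) × V => ⟪w.1.2.1, w.2⟫ :=
    (contDiff_fst.comp (contDiff_snd.comp contDiff_fst)).inner ℝ contDiff_snd
  have hsum : ContDiff ℝ ∞ fun w : ((Fin N → (V →L[ℝ] V)) × V × ℝ) × V =>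
      ∑ i, P.φ₀ (w.1.1 i w.2) := by
    refine ContDiff.sum fun i _ => P.smooth.comp (ContDiff.clm_apply ?_ contDiff_snd)
    exact (contDiff_apply ℝ (V →L[ℝ] V) i).comp (contDiff_fst.comp contDiff_fst)
  have hF : ContDiff ℝ ∞ F := by
    refine ContDiff.mul ?_ (ContDiff.mul (ha.comp hin) (expNegInvGlue.contDiff.comp ?_))
    · exact (P.smooth.comp contDiff_snd).div (contDiff_softPos.comp hsum)
        fun w => (softPos_pos _).ne'
    · exact (contDiff_snd.comp (contDiff_snd.comp contDiff_fst)).div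
        (contDiff_softPos.comp ((contDiff_const.mul hin).add contDiff_const))
        fun w => (softPos_pos _).ne'
  have hpr := FiniteDimensional.proper ℝ (V →L[ℝ] V)
  have hpr' := FiniteDimensional.proper ℝ V
  have hK : IsCompact ((Metric.closedBall (0 : Fin N → (V →L[ℝ] V)) C₀) ×ˢ
      ((Metric.closedBall (0 : V) R) ×ˢ Icc (0 : ℝ) 1)) :=
    (isCompact_closedBall _ _).prod ((isCompact_closedBall _ _).prod isCompact_Icc)
  obtain ⟨C, hC0, hC⟩ := exists_multiplierBound (p := p) hp hF hK P.compactSupport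
    (fun w _ ξ hξ => subset_tsupport _ fun h0 => hξ (by simp [F, h0]))
  refine ⟨C, hC0, fun k z hz q hq => ?_⟩
  obtain ⟨h, hh, h1, h2⟩ := hfam k
  have h3 := hC (h, z, q) ⟨by simpa using hh, by simpa using hz, hq⟩
  have h4 : (fun ξ => F ((h, z, q), ξ)) = fun ξ => P.ψHat k (P.g k ξ) *
      (a ⟪z, ξ⟫ * expNegInvGlue (q / softPos (b * ⟪z, ξ⟫ + c))) := by
    ext ξ
    simp only [F]
    rw [h2]
    by_cases hξ : ξ ∈ tsupport P.φ₀
    · rw [softPos_eq (h1 ξ hξ)]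
    · simp [image_eq_zero_of_notMem_tsupport hξ]
  rwa [h4] at h3

theorem norm_adjoint_g_e_le (k : ℕ) :
    ‖adjointEquiv (P.g k) 𝒞.e‖ ≤ ⟪𝒞.e, P.ξ k⟫ := by
  have h := 𝒞.norm_le_inner_e (subset_closure
    (coneAut_apply_mem (𝒞.adjointEquiv_mem (P.g_mem k)) 𝒞.e_mem))
  rwa [adjointEquiv_inner_right, P.g_e, real_inner_comm] at h

/-- On the support of the cutoff `v = (e|ξ) ≥ 3/5`, hence `4v - 1 ≥ 1`. Writing `exp(-tv)` as
`exp(-t/4) exp(4v - 1) exp(-(1 + t/4)(4v - 1))` extracts the decay and leaves a member of the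
compact family. -/
theorem exists_multiplierBound_exp_neg (hp : p ≠ ⊤) : ∃ C : ℝ, 0 ≤ C ∧ ∀ k, ∀ t : ℝ, 0 ≤ t →
    MultiplierBound p (fun ξ => P.ψHat k ξ * (dyadicCutoff ⟪𝒞.e, ξ⟫ * Real.exp (-(t * ⟪𝒞.e, ξ⟫))))
      (C * Real.exp (-(t / 4))) := by
  -- On the cutoff `(e|ξ) < 2`, and comparability loses a factor `exp 2`; for larger `(e|ξ k)` the
  -- symbol vanishes.
  set R := Real.exp 2 * 2 with hR
  obtain ⟨C, hC0, hC⟩ := P.exists_multiplierBound_family (p := p) hp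
    (a := fun v => dyadicCutoff v * Real.exp (4 * v - 1))
    (contDiff_dyadicCutoff.mul (Real.contDiff_exp.comp (by fun_prop))) 4 (-1) R
  refine ⟨C, hC0, fun k t ht => ?_⟩
  by_cases hk : ⟪𝒞.e, P.ξ k⟫ ≤ R
  · refine MultiplierBound.of_comp hp (P.g k) ?_
    have h1 := (hC k (adjointEquiv (P.g k) 𝒞.e) ((P.norm_adjoint_g_e_le k).trans hk)
      ((1 + t / 4)⁻¹) ⟨by positivity, inv_le_one_of_one_le₀ (by linarith)⟩).const_mul
        (Real.exp (-(t / 4)))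
    rw [abs_of_pos (Real.exp_pos _), mul_comm] at h1
    convert h1 using 2 with ξ
    rw [adjointEquiv_inner_left]
    by_cases h0 : dyadicCutoff ⟪𝒞.e, P.g k ξ⟫ = 0
    · simp [h0]
    have h2 := (dyadicCutoff_ne_zero h0).1
    rw [← sub_eq_add_neg, ← exp_neg_eq_expNegInvGlue (by positivity) (by linarith)]
    set v := ⟪𝒞.e, P.g k ξ⟫
    have h3 : Real.exp (-(t * v)) = Real.exp (-(t / 4)) * (Real.exp (4 * v - 1) *
        Real.exp (-((1 + t / 4) * (4 * v - 1)))) := by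
      rw [← Real.exp_add, ← Real.exp_add]
      congr 1
      ring
    rw [h3]
    ring
  · refine MultiplierBound.of_eq_zero (fun ξ => ?_) (by positivity)
    by_contra hne
    have h1 : P.ψHat k ξ ≠ 0 := fun h => hne (by simp [h])
    have h2 : dyadicCutoff ⟪𝒞.e, ξ⟫ ≠ 0 := fun h => hne (by simp [h])
    have h3 := (dyadicCutoff_ne_zero h2).2
    have h4 := (P.comparable_of_ψHat_ne_zero h1 𝒞.e (subset_closure 𝒞.e_mem)).1
    rw [real_inner_comm, real_inner_comm 𝒞.e ξ] at h4
    refine hk (h4.trans ?_)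
    rw [hR]
    gcongr
    linarith

/-- With `t = (e|ξ k)`, the exponent moved to `e` is `(z|ξ)` with `‖z‖ ≤ t`. Dividing by `1 + t`
keeps `z` bounded, and extracting `exp((1 + t)R)` leaves a decaying exponential with rate function
at least one on the support; hence `κ = R`. -/
theorem exists_multiplierBound_exp (hp : p ≠ ⊤) : ∃ C κ : ℝ, 0 ≤ C ∧ 0 ≤ κ ∧ ∀ k,
    MultiplierBound p (fun ξ => P.ψHat k ξ * Real.exp ⟪𝒞.e, ξ⟫)
      (C * Real.exp (κ * ⟪𝒞.e, P.ξ k⟫)) := by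
  obtain ⟨ρ, hρ⟩ := P.compactSupport.isBounded.exists_norm_le
  set R := 1 + max ρ 0 with hR
  have hR1 : 0 ≤ R := by positivity
  obtain ⟨C, hC0, hC⟩ := P.exists_multiplierBound_family (p := p) hp
    (a := fun _ => 1) contDiff_const (-1) R 1
  refine ⟨C * Real.exp R, R, by positivity, hR1, fun k => ?_⟩
  refine MultiplierBound.of_comp hp (P.g k) ?_
  set z := adjointEquiv (P.g k) 𝒞.e with hz
  set t := ⟪𝒞.e, P.ξ k⟫ with ht
  have hzt : ‖z‖ ≤ t := P.norm_adjoint_g_e_le k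
  have ht0 : 0 ≤ t := (norm_nonneg _).trans hzt
  have hω : ‖(1 + t)⁻¹ • z‖ ≤ 1 := by
    rw [norm_smul, norm_inv, Real.norm_of_nonneg (by linarith), inv_mul_le_iff₀ (by linarith)]
    linarith
  have h1 := (hC k _ hω ((1 + t)⁻¹) ⟨by positivity, inv_le_one_of_one_le₀ (by linarith)⟩).const_mul
        (Real.exp ((1 + t) * R))
  have h2 : |Real.exp ((1 + t) * R)| * C = C * Real.exp R * Real.exp (R * t) := by
    rw [abs_of_pos (Real.exp_pos _), mul_assoc, ← Real.exp_add, mul_comm]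
    congr 2
    ring
  rw [h2] at h1
  convert h1 using 2 with ξ
  by_cases hξ : ξ ∈ tsupport P.φ₀
  · have hn : ‖ξ‖ ≤ max ρ 0 := (hρ ξ hξ).trans (le_max_left _ _)
    have h3 : ⟪(1 + t)⁻¹ • z, ξ⟫ ≤ max ρ 0 :=
      (real_inner_le_norm _ _).trans (by nlinarith [norm_nonneg ξ, norm_nonneg ((1 + t)⁻¹ • z)])
    rw [← exp_neg_eq_expNegInvGlue ht0 (by linarith), inner_smul_left, hz,
      adjointEquiv_inner_left]
    set v := ⟪𝒞.e, P.g k ξ⟫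
    have h4 : Real.exp v = Real.exp ((1 + t) * R) *
        Real.exp (-((1 + t) * (-1 * ((1 + t)⁻¹ * v) + R))) := by
      rw [← Real.exp_add]
      congr 1
      have : (1 + t) * ((1 + t)⁻¹ * v) = v := by
        rw [← mul_assoc, mul_inv_cancel₀ (by linarith), one_mul]
      linear_combination this.symm
    rw [h4]
    simp only [conj_trivial]
    ring
  · have h5 : P.ψHat k (P.g k ξ) = 0 := by
      simp [ψHat, φ, image_eq_zero_of_notMem_tsupport hξ]
    simp [h5]

end LittlewoodPaley
end JordanCone
end ConeLP

namespace ConeLP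

/-! ### Sums with finite overlap -/

open Classical in
-- Hölder over at most `N` indices `j` costs `N^(s-1)`; after exchanging sums, at most `N` indices
-- `k` meet each `j`. The total `N^s` becomes `N` after the root.
theorem sum_rpow_le_of_overlap {ι κ : Type*} {A : Finset ι} {B : Finset κ} {r : ι → κ → Prop}
    {N : ℕ} {s c D : ℝ} (hs : 1 ≤ s) (hc : 0 ≤ c) (hD : 0 ≤ D) {a v : ι → ℝ} {U w : κ → ℝ}
    (ha : ∀ j, 0 ≤ a j) (hU0 : ∀ k, 0 ≤ U k) (hw0 : ∀ k, 0 ≤ w k)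
    (hN : ∀ k ∈ B, (A.filter (r · k)).card ≤ N) (hN' : ∀ j ∈ A, (B.filter (r j ·)).card ≤ N)
    (hU : ∀ k ∈ B, U k ≤ D * ∑ j ∈ A.filter (r · k), a j) (hv0 : ∀ j, 0 ≤ v j)
    (hw : ∀ k ∈ B, ∀ j ∈ A, r j k → w k ≤ c * v j) :
    (∑ k ∈ B, w k * U k ^ s) ^ (1 / s) ≤
      D * N * c ^ (1 / s) * (∑ j ∈ A, v j * a j ^ s) ^ (1 / s) := by
  have hs0 : 0 < s := by linarith
  have h1 : ∀ k ∈ B, w k * U k ^ s ≤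
      ∑ j ∈ A.filter (r · k), D ^ s * (N : ℝ) ^ (s - 1) * c * (v j * a j ^ s) := by
    intro k hk
    have h2 : U k ^ s ≤ D ^ s * ((N : ℝ) ^ (s - 1) * ∑ j ∈ A.filter (r · k), a j ^ s) := by
      refine (Real.rpow_le_rpow (hU0 k) (hU k hk) hs0.le).trans ?_
      rw [Real.mul_rpow hD (Finset.sum_nonneg fun j _ => ha j)]
      refine mul_le_mul_of_nonneg_left ?_ (Real.rpow_nonneg hD _)
      have h3 := Real.rpow_sum_le_const_mul_sum_rpow (A.filter (r · k)) a hs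
      simp only [fun j => abs_of_nonneg (ha j)] at h3
      refine h3.trans (mul_le_mul_of_nonneg_right ?_
        (Finset.sum_nonneg fun j _ => Real.rpow_nonneg (ha j) _))
      exact Real.rpow_le_rpow (Nat.cast_nonneg _) (by exact_mod_cast hN k hk) (by linarith)
    refine (mul_le_mul_of_nonneg_left h2 (hw0 k)).trans ?_
    rw [Finset.mul_sum, Finset.mul_sum, Finset.mul_sum]
    refine Finset.sum_le_sum fun j hj => ?_
    obtain ⟨hjA, hjk⟩ := Finset.mem_filter.1 hj
    have h4 := hw k hk j hjA hjk
    have h5 : 0 ≤ D ^ s * ((N : ℝ) ^ (s - 1) * a j ^ s) := by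
      have := Real.rpow_nonneg (ha j) s
      have := Real.rpow_nonneg hD s
      positivity
    calc w k * (D ^ s * ((N : ℝ) ^ (s - 1) * a j ^ s))
        ≤ c * v j * (D ^ s * ((N : ℝ) ^ (s - 1) * a j ^ s)) := mul_le_mul_of_nonneg_right h4 h5
      _ = _ := by ring
  have h6 : ∑ k ∈ B, w k * U k ^ s ≤ (D * N) ^ s * c * ∑ j ∈ A, v j * a j ^ s := by
    refine (Finset.sum_le_sum h1).trans ?_
    simp only [Finset.sum_filter]
    rw [Finset.sum_comm, Finset.mul_sum]
    refine Finset.sum_le_sum fun j hj => ?_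
    rw [← Finset.sum_filter, Finset.sum_const, nsmul_eq_mul]
    have h7 : 0 ≤ v j * a j ^ s := mul_nonneg (hv0 j) (Real.rpow_nonneg (ha j) _)
    have h8 : (N : ℝ) * (N : ℝ) ^ (s - 1) = (N : ℝ) ^ s := by
      rcases Nat.eq_zero_or_pos N with rfl | h
      · simp [Real.zero_rpow hs0.ne']
      · rw [Real.rpow_sub_one (by positivity), mul_div_cancel₀ _ (by positivity)]
    have h9 : 0 ≤ D ^ s * (N : ℝ) ^ (s - 1) * c * (v j * a j ^ s) := by
      have := Real.rpow_nonneg hD s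
      positivity
    refine (mul_le_mul_of_nonneg_right (Nat.cast_le.2 (hN' j hj)) h9).trans (le_of_eq ?_)
    rw [Real.mul_rpow hD (Nat.cast_nonneg _), ← h8]
    ring
  have h10 : 0 ≤ ∑ j ∈ A, v j * a j ^ s :=
    Finset.sum_nonneg fun j _ => mul_nonneg (hv0 j) (Real.rpow_nonneg (ha j) _)
  have h11 : 0 ≤ D * N := by positivity
  refine (Real.rpow_le_rpow (Finset.sum_nonneg fun k _ =>
    mul_nonneg (hw0 k) (Real.rpow_nonneg (hU0 k) _)) h6 (by positivity)).trans (le_of_eq ?_)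
  rw [Real.mul_rpow (mul_nonneg (Real.rpow_nonneg h11 _) hc) h10,
    Real.mul_rpow (Real.rpow_nonneg h11 _) hc, ← Real.rpow_mul h11, mul_one_div_cancel hs0.ne',
    Real.rpow_one]

/-- For positive `m` the exponential beats the power. For negative `m` the series is dominated by a
geometric one of ratio `2^(-κ)`, which needs `κ > 0`. -/
theorem exists_sum_two_zpow_le {κ : ℝ} (hκ : 0 < κ) : ∃ S : ℝ, 0 < S ∧ ∀ A : Finset ℤ,
    ∑ m ∈ A, ((2 : ℝ) ^ m) ^ κ * Real.exp (-((2 : ℝ) ^ m / 4)) ≤ S := by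
  set T : ℤ → ℝ := fun m => ((2 : ℝ) ^ m) ^ κ * Real.exp (-((2 : ℝ) ^ m / 4)) with hT
  have hT0 : ∀ m, 0 ≤ T m := fun m => by positivity
  obtain ⟨k, hk⟩ := exists_nat_ge κ
  have hpos : Summable fun i : ℕ => T i := by
    refine Summable.of_nonneg_of_le (fun i => hT0 i) (fun i => ?_)
      ((summable_geometric_two).mul_left (4 ^ (k + 1) * (k + 1).factorial : ℝ))
    have hx : (1 : ℝ) ≤ 2 ^ i := one_le_pow₀ one_le_two
    simp only [hT, zpow_natCast]
    set x : ℝ := 2 ^ i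
    have hx0 : 0 < x := by linarith
    have h1 : x ^ κ ≤ x ^ k := by
      rw [← Real.rpow_natCast]
      exact Real.rpow_le_rpow_of_exponent_le hx hk
    have h2 := Real.pow_div_factorial_le_exp (x / 4) (by positivity) (k + 1)
    rw [Real.exp_neg, one_div, inv_pow, ← div_eq_mul_inv, div_le_iff₀ (Real.exp_pos _)]
    refine h1.trans ?_
    calc x ^ k = 4 ^ (k + 1) * (k + 1).factorial * x⁻¹ * ((x / 4) ^ (k + 1) / (k + 1).factorial) := by
          field_simp
          rw [div_pow, mul_div_cancel₀ _ (by positivity), pow_succ]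
      _ ≤ _ := by gcongr
  have hneg : Summable fun i : ℕ => T (-(i : ℤ)) := by
    have hρ : (2 : ℝ) ^ (-κ) < 1 := Real.rpow_lt_one_of_one_lt_of_neg one_lt_two (by linarith)
    refine Summable.of_nonneg_of_le (fun i => hT0 _) (fun i => ?_)
      (summable_geometric_of_lt_one (by positivity) hρ)
    simp only [hT]
    have h1 : ((2 : ℝ) ^ (-(i : ℤ))) ^ κ = ((2 : ℝ) ^ (-κ)) ^ i := by
      rw [← Real.rpow_intCast, ← Real.rpow_mul zero_le_two, ← Real.rpow_natCast,
        ← Real.rpow_mul zero_le_two]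
      congr 1
      push_cast
      ring
    rw [h1]
    refine mul_le_of_le_one_right (by positivity) (Real.exp_le_one_iff.2 ?_)
    have : (0 : ℝ) < 2 ^ (-(i : ℤ)) := by positivity
    linarith
  have hsum : Summable T := Summable.of_nat_of_neg hpos hneg
  have hT1 : 0 ≤ ∑' m, T m := tsum_nonneg hT0
  exact ⟨(∑' m, T m) + 1, by linarith,
    fun A => (hsum.sum_le_tsum A fun m _ => hT0 m).trans (by linarith)⟩

section

variable {V : Type*} [NormedAddCommGroup V] [InnerProductSpace ℝ V] [FiniteDimensional ℝ V]
  [MeasurableSpace V] [BorelSpace V] {p : ℝ≥0∞} [Fact (1 ≤ p)]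

theorem toLp_sum {ι : Type*} (S : Finset ι) (v : ι → 𝓢(V, ℂ)) :
    (∑ j ∈ S, v j).toLp p (volume : Measure V) = ∑ j ∈ S, (v j).toLp p volume :=
  map_sum (SchwartzMap.toLpCLM ℂ ℂ p (volume : Measure V)) v S

theorem sum_schwartz_apply {ι : Type*} (S : Finset ι) (v : ι → 𝓢(V, ℂ)) (x : V) :
    (∑ j ∈ S, v j) x = ∑ j ∈ S, v j x := by
  classical
  induction S using Finset.induction_on with
  | empty => simp
  | insert j S hj ih => rw [Finset.sum_insert hj, Finset.sum_insert hj, add_apply, ih]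

theorem MultiplierBound.norm_le_sum {m : V → ℝ} {B : ℝ} (h : MultiplierBound p m B) (hB : 0 ≤ B)
    {ι : Type*} {S : Finset ι} {v : ι → 𝓢(V, ℂ)} {u : 𝓢(V, ℂ)}
    (hu : ∀ ξ, fourierHat V u ξ = m ξ * ∑ j ∈ S, fourierHat V (v j) ξ) :
    ‖u.toLp p‖ ≤ B * ∑ j ∈ S, ‖(v j).toLp p‖ := by
  refine (h (∑ j ∈ S, v j) u fun ξ => ?_).trans (mul_le_mul_of_nonneg_left ?_ hB)
  · rw [hu, map_sum, sum_schwartz_apply]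
  · rw [toLp_sum]
    exact norm_sum_le _ _

theorem eLpNorm_eq_ofReal_norm_toLp (f : 𝓢(V, ℂ)) :
    eLpNorm f p volume = ENNReal.ofReal ‖f.toLp p‖ := by
  rw [norm_toLp, ENNReal.ofReal_toReal (f.memLp p volume).2.ne]

end

/-! ### Littlewood–Paley pieces of test functions -/

namespace JordanCone
namespace LittlewoodPaley

variable {V : Type*} [NormedAddCommGroup V] [InnerProductSpace ℝ V] [FiniteDimensional ℝ V]
  [Nontrivial V] [MeasurableSpace V] [BorelSpace V] {𝒞 : JordanCone V} (P : 𝒞.LittlewoodPaley)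
  {p : ℝ≥0∞} [Fact (1 ≤ p)]

theorem exists_finset_ψHat {K : Set V} (hK : IsCompact K) (hKΩ : K ⊆ 𝒞.Ω) :
    ∃ B : Finset ℕ, ∀ k ∉ B, ∀ ξ ∈ K, P.ψHat k ξ = 0 := by
  obtain ⟨M, hM, hMK⟩ := 𝒞.exists_comparable_of_isCompact hK hKΩ
  have hM0 : 0 < M := by linarith
  obtain ⟨N, hN⟩ := P.exists_count (mul_pos hM0 (Real.exp_pos 2))
  obtain ⟨B, -, hB⟩ := hN 𝒞.e 𝒞.e_mem
  refine ⟨B, fun k hk ξ hξ => ?_⟩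
  by_contra h
  refine hk ((hB k).2 ?_)
  exact (hMK ξ hξ).trans hM0.le (Real.exp_pos 2).le (P.comparable_of_ψHat_ne_zero h).symm

/-- The `j`-th piece of `f`, as a Schwartz function. -/
def schwartzPiece (f : 𝓢(V, ℂ)) (j : ℕ) : 𝓢(V, ℂ) :=
  invHat V (smulCutoff (P.ψHat j) (fourierHat V f))

theorem fourierHat_schwartzPiece (f : 𝓢(V, ℂ)) (j : ℕ) (ξ : V) :
    fourierHat V (P.schwartzPiece f j) ξ = P.ψHat j ξ * fourierHat V f ξ := by
  rw [schwartzPiece, fourierHat_invHat, smulCutoff_apply (P.contDiff_ψHat j)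
    (P.hasCompactSupport_ψHat j)]

theorem piece_eq (f : 𝓢(V, ℂ)) (j : ℕ) : P.piece f j = P.schwartzPiece f j := by
  ext x
  rw [schwartzPiece, invHat_apply, piece]
  congr 1
  ext ξ
  rw [smulCutoff_apply (P.contDiff_ψHat j) (P.hasCompactSupport_ψHat j), mul_comm]

theorem besovNorm_eq {s ν : ℝ} (hs : 1 ≤ s) {f : 𝓢(V, ℂ)} {A : Finset ℕ}
    (hA : ∀ j ∉ A, ∀ ξ, P.ψHat j ξ * fourierHat V f ξ = 0) :
    P.besovNorm p s ν f = ENNReal.ofReal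
      ((∑ j ∈ A, 𝒞.det (P.ξ j) ^ (-ν) * ‖(P.schwartzPiece f j).toLp p‖ ^ s) ^ (1 / s)) := by
  have hs0 : 0 < s := by linarith
  have hd : ∀ j, 0 ≤ 𝒞.det (P.ξ j) ^ (-ν) := fun j =>
    Real.rpow_nonneg (𝒞.det_pos (P.ξ_mem j)).le _
  have hn : ∀ j, 0 ≤ ‖(P.schwartzPiece f j).toLp p (volume : Measure V)‖ ^ s := fun j =>
    Real.rpow_nonneg (norm_nonneg _) _
  have h1 : ∀ j, ENNReal.ofReal (𝒞.det (P.ξ j) ^ (-ν)) * eLpNorm (P.piece f j) p volume ^ s =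
      ENNReal.ofReal (𝒞.det (P.ξ j) ^ (-ν) * ‖(P.schwartzPiece f j).toLp p‖ ^ s) := by
    intro j
    rw [piece_eq, eLpNorm_eq_ofReal_norm_toLp, ENNReal.ofReal_rpow_of_nonneg (norm_nonneg _) hs0.le,
      ENNReal.ofReal_mul (hd j)]
  rw [besovNorm]
  simp_rw [h1]
  rw [tsum_eq_sum (s := A) fun j hj => ?_, ← ENNReal.ofReal_sum_of_nonneg
    (fun j _ => mul_nonneg (hd j) (hn j)), ENNReal.ofReal_rpow_of_nonneg
    (Finset.sum_nonneg fun j _ => mul_nonneg (hd j) (hn j)) (by positivity)]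
  have h2 : P.schwartzPiece f j = 0 := by
    apply fourierHat_injective
    ext ξ
    rw [fourierHat_schwartzPiece, hA j hj ξ]
    simp
  have h0 : (0 : 𝓢(V, ℂ)).toLp p (volume : Measure V) = 0 := rfl
  rw [h2, h0, norm_zero, Real.zero_rpow hs0.ne', mul_zero, ENNReal.ofReal_zero]

end LittlewoodPaley
end JordanCone
end ConeLP

namespace ConeLP

section

variable {V : Type*} [NormedAddCommGroup V] [InnerProductSpace ℝ V] [FiniteDimensional ℝ V]
  [MeasurableSpace V] [BorelSpace V] {p : ℝ≥0∞} [Fact (1 ≤ p)]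

/-- The cutoff `χ = 0` is admissible in the approximation theorem, so all approximants vanish. -/
theorem eq_zero_of_fourierSupport_eq_empty (hp : p ≠ ⊤) {f : Lp ℂ p (volume : Measure V)}
    (hf : fourierSupport f = ∅) : f = 0 := by
  obtain ⟨h, h1, h2⟩ := exists_tendsto_of_fourierSupport_subset hp f (χ := 0) contDiff_const
    HasCompactSupport.zero (by simp [hf])
  have h3 : ∀ n, h n = 0 := by
    intro n
    obtain ⟨u, hu⟩ := h1 n
    apply fourierHat_injective
    ext ξ
    simp [hu]
  have h0 : (0 : 𝓢(V, ℂ)).toLp p (volume : Measure V) = 0 := rfl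
  simp only [h3, h0] at h2
  exact tendsto_nhds_unique h2 tendsto_const_nhds

end

namespace JordanCone
namespace LittlewoodPaley

variable {V : Type*} [NormedAddCommGroup V] [InnerProductSpace ℝ V] [FiniteDimensional ℝ V]
  [Nontrivial V] [MeasurableSpace V] [BorelSpace V] {𝒞 : JordanCone V} (P : 𝒞.LittlewoodPaley)
  {p : ℝ≥0∞} [Fact (1 ≤ p)]

/-! ### Decoupling with exponential weights and in the band -/

variable (p) in
/-- The decoupling inequality for functions with spectrum in the balls `B₂(ξ j)`, with weights
`Δ(ξ j)^(-μ) exp (δ (ξ j | e))`. -/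
def ExpDecoupling (s μ : ℝ) : Prop :=
  ∃ δ : ℝ, 0 < δ ∧ ∃ C : ℝ, 0 < C ∧
    ∀ (A : Finset ℕ) (f : ℕ → Lp ℂ p (volume : Measure V)),
      (∀ j ∈ A, fourierSupport (f j) ⊆ 𝒞.ball 2 (P.ξ j)) →
      ‖∑ j ∈ A, f j‖ ≤
        C * (∑ j ∈ A, 𝒞.det (P.ξ j) ^ (-μ) * Real.exp (δ * ⟪P.ξ j, 𝒞.e⟫) * ‖f j‖ ^ s) ^ (1 / s)

variable (p) in
/-- The decoupling inequality for functions with spectrum in `B₂(ξ j) ∩ H₀`, with weights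
`Δ(ξ j)^(-μ)`. -/
def BandDecoupling (s μ : ℝ) : Prop :=
  ∃ C : ℝ, 0 < C ∧
    ∀ (A : Finset ℕ) (f : ℕ → Lp ℂ p (volume : Measure V)),
      (∀ j ∈ A, fourierSupport (f j) ⊆ 𝒞.ball 2 (P.ξ j) ∩ 𝒞.band) →
      ‖∑ j ∈ A, f j‖ ≤ C * (∑ j ∈ A, 𝒞.det (P.ξ j) ^ (-μ) * ‖f j‖ ^ s) ^ (1 / s)

variable (p) in
/-- The estimate for the Fourier–Laplace extension on horizontal translates of `V`. -/
def LaplaceEstimate (s μ : ℝ) : Prop :=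
  ∃ C : ℝ, 0 < C ∧
    ∀ f : 𝓢(V, ℂ), 𝒞.IsTest f → ∀ y ∈ 𝒞.Ω,
      eLpNorm (fun x => 𝒞.fourierLaplace f x y) p volume ≤
        ENNReal.ofReal (C * 𝒞.det y ^ (-μ / s)) * P.besovNorm p s μ f

theorem det_rpow_nonneg (μ : ℝ) (j : ℕ) : 0 ≤ 𝒞.det (P.ξ j) ^ μ :=
  Real.rpow_nonneg (𝒞.det_pos (P.ξ_mem j)).le _

theorem inner_e_nonneg (j : ℕ) : 0 ≤ ⟪𝒞.e, P.ξ j⟫ :=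
  (norm_nonneg _).trans (P.norm_adjoint_g_e_le j)

variable {P}

theorem ExpDecoupling.bandDecoupling (hp : p ≠ ⊤) {s μ : ℝ} (hs : 1 ≤ s)
    (h : P.ExpDecoupling p s μ) : P.BandDecoupling p s μ := by
  classical
  obtain ⟨δ, hδ, C, hC, hmain⟩ := h
  have hs0 : 0 < s := by linarith
  set E := Real.exp (δ * (Real.exp 2 * 2)) with hE
  refine ⟨C * E ^ (1 / s), by positivity, fun A f hf => ?_⟩
  -- A zero function gives no spectral point in the band and hence no bound on its `ξ j`; such terms
  -- are removed before the weights are compared.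
  set A' := A.filter fun j => f j ≠ 0 with hA'
  have h1 : ∑ j ∈ A', f j = ∑ j ∈ A, f j := Finset.sum_filter_ne_zero A
  have hle : ∀ j ∈ A', ⟪P.ξ j, 𝒞.e⟫ ≤ Real.exp 2 * 2 := by
    intro j hj
    obtain ⟨hjA, hj0⟩ := Finset.mem_filter.1 hj
    obtain ⟨x, hx⟩ : (fourierSupport (f j)).Nonempty := by
      rw [nonempty_iff_ne_empty]
      exact fun h0 => hj0 (eq_zero_of_fourierSupport_eq_empty hp h0)
    obtain ⟨hx1, hx2⟩ := hf j hjA hx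
    have h3 := (𝒞.comparable_of_mem_ball (P.ξ_mem j) hx1 𝒞.e (subset_closure 𝒞.e_mem)).1
    have h4 := hx2.2
    rw [real_inner_comm] at h4
    exact h3.trans (mul_le_mul_of_nonneg_left h4.le (Real.exp_pos 2).le)
  rw [← h1]
  refine (hmain A' f fun j hj => (hf j (Finset.mem_filter.1 hj).1).trans inter_subset_left).trans ?_
  rw [mul_assoc]
  refine mul_le_mul_of_nonneg_left ?_ hC.le
  have hn : ∀ j, 0 ≤ 𝒞.det (P.ξ j) ^ (-μ) * ‖f j‖ ^ s := fun j =>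
    mul_nonneg (P.det_rpow_nonneg _ j) (Real.rpow_nonneg (norm_nonneg _) _)
  rw [← Real.mul_rpow (Real.exp_pos _).le (Finset.sum_nonneg fun j _ => hn j)]
  refine Real.rpow_le_rpow (Finset.sum_nonneg fun j _ => ?_) ?_ (by positivity)
  · have := P.det_rpow_nonneg (-μ) j
    positivity
  · calc ∑ j ∈ A', 𝒞.det (P.ξ j) ^ (-μ) * Real.exp (δ * ⟪P.ξ j, 𝒞.e⟫) * ‖f j‖ ^ s
        ≤ ∑ j ∈ A', E * (𝒞.det (P.ξ j) ^ (-μ) * ‖f j‖ ^ s) := by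
          refine Finset.sum_le_sum fun j hj => ?_
          have h5 : Real.exp (δ * ⟪P.ξ j, 𝒞.e⟫) ≤ E :=
            Real.exp_le_exp.2 (mul_le_mul_of_nonneg_left (hle j hj) hδ.le)
          calc _ = Real.exp (δ * ⟪P.ξ j, 𝒞.e⟫) * (𝒞.det (P.ξ j) ^ (-μ) * ‖f j‖ ^ s) := by ring
            _ ≤ _ := mul_le_mul_of_nonneg_right h5 (hn j)
      _ ≤ ∑ j ∈ A, E * (𝒞.det (P.ξ j) ^ (-μ) * ‖f j‖ ^ s) :=
          Finset.sum_le_sum_of_subset_of_nonneg (Finset.filter_subset _ _)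
            fun j _ _ => mul_nonneg (Real.exp_pos _).le (hn j)
      _ = _ := by rw [Finset.mul_sum]

/-! ### From the band to the Fourier–Laplace extension -/

/-- The closed support must lie in the open band; this is why the cutoff lives on `[3/5, 9/5]`. -/
theorem tsupport_dyadicCutoff_subset :
    tsupport (fun ξ => dyadicCutoff ⟪𝒞.e, ξ⟫) ⊆ 𝒞.band := by
  have h1 : tsupport (fun ξ => dyadicCutoff ⟪𝒞.e, ξ⟫) ⊆ {ξ | 3 / 5 ≤ ⟪𝒞.e, ξ⟫ ∧ ⟪𝒞.e, ξ⟫ ≤ 9 / 5} := by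
    refine closure_minimal (fun ξ hξ => dyadicCutoff_ne_zero hξ) ?_
    have hc : Continuous fun ξ => ⟪𝒞.e, ξ⟫ := continuous_const.inner continuous_id
    exact (isClosed_le continuous_const hc).inter (isClosed_le hc continuous_const)
  intro ξ hξ
  have := h1 hξ
  exact ⟨by linarith [this.1], by linarith [this.2]⟩

/-- A band-limited part of a test function is controlled by its Littlewood–Paley pieces. -/
theorem BandDecoupling.exists_norm_le (hp : p ≠ ⊤) {s μ : ℝ} (hs : 1 ≤ s) (hμ : 0 < μ)
    (h : P.BandDecoupling p s μ) : ∃ C : ℝ, 0 < C ∧ ∀ (f : 𝓢(V, ℂ)) (A : Finset ℕ), 𝒞.IsTest f →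
      (∀ j ∉ A, ∀ ξ, P.ψHat j ξ * fourierHat V f ξ = 0) →
      ∀ g ∈ coneAut 𝒞.Ω, ∀ t : ℝ, 0 ≤ t → ∀ F : 𝓢(V, ℂ),
      (∀ ξ, fourierHat V F ξ = (dyadicCutoff ⟪𝒞.e, g ξ⟫ * Real.exp (-(t * ⟪𝒞.e, g ξ⟫)) : ℝ) *
        fourierHat V f ξ) →
      ‖F.toLp p‖ ≤ C * Real.exp (-(t / 4)) * (absDet g ^ (1 / 𝒞.traceConst)) ^ (-μ / s) *
        (∑ j ∈ A, 𝒞.det (P.ξ j) ^ (-μ) * ‖(P.schwartzPiece f j).toLp p‖ ^ s) ^ (1 / s) := by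
  classical
  have hs0 : 0 < s := by linarith
  obtain ⟨C₂, hC₂, hband⟩ := h
  obtain ⟨C₁, hC₁, hMB⟩ := P.exists_multiplierBound_exp_neg (p := p) hp
  set M := Real.exp 2 * Real.exp 2 with hM
  have hM0 : 0 < M := by positivity
  obtain ⟨N, hN⟩ := P.exists_count hM0
  obtain ⟨C₃, hC₃, hdet⟩ := 𝒞.exists_det_rpow_le hM0.le hμ.le
  -- `C₁` and `N` may vanish; adding one keeps the constant positive.
  refine ⟨C₂ * (C₁ * N * C₃ ^ (1 / s)) + 1, by positivity, fun f A hf hA g hg t ht F hF => ?_⟩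
  set d := absDet g with hd
  have hd0 : 0 < d := absDet_pos g
  set S := (∑ j ∈ A, 𝒞.det (P.ξ j) ^ (-μ) * ‖(P.schwartzPiece f j).toLp p‖ ^ s) ^ (1 / s) with hS
  have hS0 : 0 ≤ S := Real.rpow_nonneg (Finset.sum_nonneg fun j _ =>
    mul_nonneg (P.det_rpow_nonneg _ j) (Real.rpow_nonneg (norm_nonneg _) _)) _
  set χ := d ^ (1 / 𝒞.traceConst) with hχ
  have hχ0 : 0 < χ := Real.rpow_pos_of_pos hd0 _
  set β := d⁻¹ ^ (1 / p).toReal with hβ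
  have hβ0 : 0 < β := Real.rpow_pos_of_pos (inv_pos.2 hd0) _
  -- everything is moved to the band by composition with the adjoint of `g`
  set T : 𝓢(V, ℂ) → 𝓢(V, ℂ) := fun w => compEquiv (adjointEquiv g) w with hT
  have hTn : ∀ w, ‖(T w).toLp p (volume : Measure V)‖ = β * ‖w.toLp p (volume : Measure V)‖ := fun w => by
    rw [hT, norm_toLp_compEquiv hp, absDet_adjointEquiv]
  have hThat : ∀ w ξ, fourierHat V (T w) ξ = (d⁻¹ : ℝ) * fourierHat V w (g.symm ξ) := fun w ξ =>
    fourierHat_compEquiv g w ξ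
  set σ : V → ℝ := fun ξ => dyadicCutoff ⟪𝒞.e, ξ⟫ * Real.exp (-(t * ⟪𝒞.e, ξ⟫)) with hσ
  have hGhat : ∀ ξ, fourierHat V (T F) ξ = σ ξ * fourierHat V (T f) ξ := by
    intro ξ
    rw [hThat, hThat, hF, g.apply_symm_apply]
    simp only [hσ]
    ring
  have hcΩ : (fun ξ => g ξ) '' (tsupport (fourierHat V f)) ⊆ 𝒞.Ω := by
    rintro _ ⟨ξ, hξ, rfl⟩
    exact coneAut_apply_mem hg (hf.2 hξ)
  obtain ⟨B, hB⟩ := P.exists_finset_ψHat (hf.1.isCompact.image g.continuous) hcΩ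
  have hTf0 : ∀ ξ, fourierHat V (T f) ξ ≠ 0 → ξ ∈ (fun ξ => g ξ) '' (tsupport (fourierHat V f)) := by
    intro ξ hξ
    refine ⟨g.symm ξ, subset_tsupport _ fun h0 => hξ ?_, g.apply_symm_apply ξ⟩
    rw [hThat, h0, mul_zero]
  set u : ℕ → 𝓢(V, ℂ) := fun k => P.schwartzPiece (T F) k with hu
  have huhat : ∀ k ξ, fourierHat V (u k) ξ = (P.ψHat k ξ * σ ξ : ℝ) * fourierHat V (T f) ξ := by
    intro k ξ
    rw [hu, fourierHat_schwartzPiece, hGhat]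
    push_cast
    ring
  have hsum : T F = ∑ k ∈ B, u k := by
    apply fourierHat_injective
    ext ξ
    rw [map_sum, sum_schwartz_apply]
    simp only [hu, fourierHat_schwartzPiece]
    rw [← Finset.sum_mul]
    by_cases h0 : fourierHat V (T f) ξ = 0
    · rw [hGhat, h0]
      simp
    · have h1 := hTf0 ξ h0
      have h2 := P.sum_ψHat (hcΩ h1) (A := B) fun k hk => by
        by_contra hkB
        exact hk (hB k hkB ξ h1)
      have h3 : ∑ k ∈ B, (P.ψHat k ξ : ℂ) = 1 := by exact_mod_cast h2
      rw [h3, one_mul]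
  have hb := hband B (fun k => (u k).toLp p) fun k _ => by
    refine (fourierSupport_toLp_subset (u k)).trans (subset_inter ?_ ?_)
    · refine Subset.trans (closure_mono ?_) (P.tsupport_ψHat_subset_ball k)
      intro ξ hξ h0
      exact hξ (by rw [huhat, h0]; simp)
    · refine Subset.trans (closure_mono ?_) (tsupport_dyadicCutoff_subset (𝒞 := 𝒞))
      intro ξ hξ h0
      have h1 : dyadicCutoff ⟪𝒞.e, ξ⟫ = 0 := h0
      exact hξ (by rw [huhat, hσ]; simp [h1])
  rw [← toLp_sum, ← hsum, hTn] at hb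
  -- the pieces that meet
  set r : ℕ → ℕ → Prop := fun j k => 𝒞.Comparable M (g (P.ξ j)) (P.ξ k) with hr
  have hrel : ∀ j k ξ, P.ψHat k ξ ≠ 0 → P.ψHat j (g.symm ξ) ≠ 0 → r j k := by
    intro j k ξ hk hj
    have h1 := (P.comparable_of_ψHat_ne_zero hj).apply hg
    rw [g.apply_symm_apply] at h1
    exact h1.trans (Real.exp_pos 2).le (Real.exp_pos 2).le (P.comparable_of_ψHat_ne_zero hk).symm
  have hU : ∀ k ∈ B, ‖(u k).toLp p (volume : Measure V)‖ ≤ (C₁ * Real.exp (-(t / 4)) * β) *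
      ∑ j ∈ A.filter (r · k), ‖(P.schwartzPiece f j).toLp p (volume : Measure V)‖ := by
    intro k _
    have h1 := (hMB k t ht).norm_le_sum (by positivity) (S := A.filter (r · k))
      (v := fun j => T (P.schwartzPiece f j)) (u := u k) fun ξ => by
        rw [huhat]
        by_cases hk : P.ψHat k ξ = 0
        · simp [hk]
        congr 1
        have h2 : ∑ j ∈ A.filter (r · k), fourierHat V (T (P.schwartzPiece f j)) ξ =
            (d⁻¹ : ℝ) * ((∑ j ∈ A.filter (r · k), (P.ψHat j (g.symm ξ) : ℂ)) *
              fourierHat V f (g.symm ξ)) := by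
          rw [Finset.sum_mul, Finset.mul_sum]
          refine Finset.sum_congr rfl fun j _ => ?_
          rw [hThat, fourierHat_schwartzPiece]
        rw [h2, hThat]
        congr 1
        by_cases h0 : fourierHat V f (g.symm ξ) = 0
        · rw [h0, mul_zero]
        have h3 := P.sum_ψHat (hf.2 (subset_tsupport _ h0)) (A := A.filter (r · k)) fun j hj => by
          refine Finset.mem_filter.2 ⟨?_, hrel j k ξ hk hj⟩
          by_contra hjA
          have := hA j hjA (g.symm ξ)
          rcases mul_eq_zero.1 this with h4 | h4
          · exact hj (by exact_mod_cast h4)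
          · exact h0 h4
        have h4 : ∑ j ∈ A.filter (r · k), (P.ψHat j (g.symm ξ) : ℂ) = 1 := by exact_mod_cast h3
        rw [h4, one_mul]
    simp only [hTn] at h1
    rw [← Finset.mul_sum, ← mul_assoc] at h1
    exact h1
  -- The pieces of the transported function are summed against those of `f`. Passing from `Δ(ξ k)`
  -- to `Δ(g ξ j)`, a multiple of `Δ(ξ j)`, produces the factor `χ^(-μ)`.
  have hover := sum_rpow_le_of_overlap (A := A) (B := B) (r := r) (N := N) (s := s)
    (c := C₃ * χ ^ (-μ)) (D := C₁ * Real.exp (-(t / 4)) * β)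
    (a := fun j => ‖(P.schwartzPiece f j).toLp p (volume : Measure V)‖)
    (v := fun j => 𝒞.det (P.ξ j) ^ (-μ)) (U := fun k => ‖(u k).toLp p (volume : Measure V)‖)
    (w := fun k => 𝒞.det (P.ξ k) ^ (-μ)) hs (by positivity) (by positivity)
    (fun j => norm_nonneg _) (fun k => norm_nonneg _) (P.det_rpow_nonneg _)
    (fun k _ => by
      obtain ⟨Q, hQ, hQ'⟩ := hN _ (coneAut_apply_mem (coneAut_symm hg) (P.ξ_mem k))
      refine (Finset.card_le_card fun j hj => (hQ' j).2 ?_).trans hQ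
      have h1 := (Finset.mem_filter.1 hj).2.apply (coneAut_symm hg)
      rw [g.symm_apply_apply] at h1
      exact h1.symm)
    (fun j _ => by
      obtain ⟨Q, hQ, hQ'⟩ := hN _ (coneAut_apply_mem hg (P.ξ_mem j))
      exact (Finset.card_le_card fun k hk => (hQ' k).2 (Finset.mem_filter.1 hk).2).trans hQ)
    hU (P.det_rpow_nonneg _)
    (fun k _ j _ hjk => by
      have h1 := hdet _ (coneAut_apply_mem hg (P.ξ_mem j)) _ hjk
      rw [𝒞.det_apply hg (P.ξ_mem j), Real.mul_rpow hχ0.le (𝒞.det_pos (P.ξ_mem j)).le,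
        ← mul_assoc] at h1
      exact h1)
  have h5 := hb.trans (mul_le_mul_of_nonneg_left hover hC₂.le)
  have h6 : (C₃ * χ ^ (-μ)) ^ (1 / s) = C₃ ^ (1 / s) * χ ^ (-μ / s) := by
    rw [Real.mul_rpow hC₃.le (Real.rpow_nonneg hχ0.le _), ← Real.rpow_mul hχ0.le]
    congr 2
    ring
  rw [h6] at h5
  -- Both sides carry the Jacobian factor `β` from the change of variables, so it cancels.
  have h7 : β * ‖F.toLp p (volume : Measure V)‖ ≤ β * ((C₂ * (C₁ * N * C₃ ^ (1 / s))) *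
      Real.exp (-(t / 4)) * χ ^ (-μ / s) * S) := by
    refine h5.trans (le_of_eq ?_)
    rw [hS]
    ring
  refine (le_of_mul_le_mul_left h7 hβ0).trans ?_
  gcongr
  linarith

end LittlewoodPaley
end JordanCone
end ConeLP

namespace ConeLP

section

variable {V : Type*} [NormedAddCommGroup V] [InnerProductSpace ℝ V] [FiniteDimensional ℝ V]

variable (V) in
/-- The dilation by a positive number. -/
def homothety {c : ℝ} (hc : 0 < c) : V ≃L[ℝ] V :=
  ContinuousLinearEquiv.smulLeft (Units.mk0 c hc.ne')

theorem homothety_apply {c : ℝ} (hc : 0 < c) (x : V) : homothety V hc x = c • x := rfl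

theorem homothety_symm_apply {c : ℝ} (hc : 0 < c) (x : V) : (homothety V hc).symm x = c⁻¹ • x := by
  rw [ContinuousLinearEquiv.symm_apply_eq, homothety_apply, smul_inv_smul₀ hc.ne']

theorem absDet_homothety {c : ℝ} (hc : 0 < c) :
    absDet (homothety V hc) = c ^ Module.finrank ℝ V := by
  have h : ((homothety V hc : V →L[ℝ] V) : V →ₗ[ℝ] V) = c • LinearMap.id := rfl
  rw [absDet, h, LinearMap.det_smul, LinearMap.det_id, mul_one, abs_of_pos (by positivity)]

theorem JordanCone.homothety_mem (𝒞 : JordanCone V) {c : ℝ} (hc : 0 < c) :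
    homothety V hc ∈ coneAut 𝒞.Ω := by
  refine mem_coneAut_of (fun x hx => ?_) fun x hx => ?_
  · exact 𝒞.isSymmetricCone.smul_mem c hc x hx
  · rw [homothety_symm_apply]
    exact 𝒞.isSymmetricCone.smul_mem _ (inv_pos.2 hc) x hx

variable [MeasurableSpace V] [BorelSpace V]

theorem exists_fourierHat_eq_mul {u : V → ℂ} (hu : ContDiff ℝ ∞ u) (huc : HasCompactSupport u)
    {m : V → ℝ} (hm : ContDiff ℝ ∞ m) :
    ∃ L : 𝓢(V, ℂ), ∀ ξ, fourierHat V L ξ = m ξ * u ξ := by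
  have h1 : HasCompactSupport fun ξ => (m ξ : ℂ) * u ξ := huc.mul_left
  have h2 : ContDiff ℝ ∞ fun ξ => (m ξ : ℂ) * u ξ :=
    (Complex.ofRealCLM.contDiff.comp hm).mul hu
  exact ⟨invHat V (h1.toSchwartzMap h2), fun ξ => by rw [fourierHat_invHat]; rfl⟩

theorem JordanCone.fourierLaplace_eq (𝒞 : JordanCone V) {f L : 𝓢(V, ℂ)} (hf : 𝒞.IsTest f) {y : V}
    (hL : ∀ ξ, fourierHat V L ξ = Real.exp (-⟪y, ξ⟫) * fourierHat V f ξ) (x : V) :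
    𝒞.fourierLaplace f x y = L x := by
  rw [← invHat_fourierHat L, invHat_apply, fourierInvInt, JordanCone.fourierLaplace,
    setIntegral_eq_integral_of_forall_compl_eq_zero]
  · refine integral_congr_ae (Filter.Eventually.of_forall fun ξ => ?_)
    simp only
    rw [hL, ← mul_assoc, Complex.ofReal_exp, ← Complex.exp_add]
    congr 2
    push_cast
    linear_combination (⟪y, ξ⟫ : ℂ) * Complex.I_sq
  · intro ξ hξ
    rw [image_eq_zero_of_notMem_tsupport fun h => hξ (hf.2 h), mul_zero]

end

namespace JordanCone
namespace LittlewoodPaley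

variable {V : Type*} [NormedAddCommGroup V] [InnerProductSpace ℝ V] [FiniteDimensional ℝ V]
  [Nontrivial V] [MeasurableSpace V] [BorelSpace V] {𝒞 : JordanCone V} {P : 𝒞.LittlewoodPaley}
  {p : ℝ≥0∞} [Fact (1 ≤ p)]

variable (P) in
theorem exists_finset_test {f : 𝓢(V, ℂ)} (hf : 𝒞.IsTest f) :
    ∃ A : Finset ℕ, ∀ j ∉ A, ∀ ξ, P.ψHat j ξ * fourierHat V f ξ = 0 := by
  obtain ⟨A, hA⟩ := P.exists_finset_ψHat hf.1.isCompact hf.2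
  refine ⟨A, fun j hj ξ => ?_⟩
  by_cases hξ : ξ ∈ tsupport (fourierHat V f)
  · simp [hA j hj ξ hξ]
  · simp [image_eq_zero_of_notMem_tsupport hξ]

theorem BandDecoupling.laplaceEstimate (hp : p ≠ ⊤) {s μ : ℝ} (hs : 1 ≤ s) (hμ : 0 < μ)
    (h : P.BandDecoupling p s μ) : P.LaplaceEstimate p s μ := by
  have hs0 : 0 < s := by linarith
  obtain ⟨C, hC, hmain⟩ := h.exists_norm_le hp hs hμ
  have hl := 𝒞.traceConst_pos
  set n := Module.finrank ℝ V with hn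
  have hn0 : 0 < n := Module.finrank_pos
  -- The dilation by `2^(-m)` has determinant `2^(-mn)`; its power in the piece estimate is
  -- `2^(mκ)`.
  set κ : ℝ := n * (1 / 𝒞.traceConst) * (μ / s) with hκ
  have hκ0 : 0 < κ := by positivity
  obtain ⟨S, hS0, hS⟩ := exists_sum_two_zpow_le hκ0
  refine ⟨C * S, by positivity, fun f hf y hy => ?_⟩
  obtain ⟨A, hA⟩ := P.exists_finset_test hf
  rw [P.besovNorm_eq hs hA]
  set Q := (∑ j ∈ A, 𝒞.det (P.ξ j) ^ (-μ) * ‖(P.schwartzPiece f j).toLp p‖ ^ s) ^ (1 / s) with hQ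
  have hQ0 : 0 ≤ Q := Real.rpow_nonneg (Finset.sum_nonneg fun j _ =>
    mul_nonneg (P.det_rpow_nonneg _ j) (Real.rpow_nonneg (norm_nonneg _) _)) _
  obtain ⟨g₀, hg₀, hg₀y⟩ := 𝒞.exists_apply_e_eq hy
  set g := adjointEquiv g₀ with hgdef
  have hg : g ∈ coneAut 𝒞.Ω := 𝒞.adjointEquiv_mem hg₀
  have hin : ∀ ξ, ⟪𝒞.e, g ξ⟫ = ⟪y, ξ⟫ := fun ξ => by
    rw [hgdef, adjointEquiv_inner_right, hg₀y]
  have hdety : 𝒞.det y = absDet g ^ (1 / 𝒞.traceConst) := by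
    rw [hgdef, absDet_adjointEquiv, ← 𝒞.det_apply_e hg₀, hg₀y]
  have hsm : ContDiff ℝ ∞ fun ξ : V => ⟪y, ξ⟫ := contDiff_const.inner ℝ contDiff_id
  have hfs : ContDiff ℝ ∞ (fourierHat V f) := (fourierHat V f).smooth ⊤
  obtain ⟨L, hL⟩ := exists_fourierHat_eq_mul hfs hf.1 (m := fun ξ => Real.exp (-⟪y, ξ⟫))
    (Real.contDiff_exp.comp hsm.neg)
  have hpow : ∀ m : ℤ, (0 : ℝ) < 2 ^ (-m) := fun m => by positivity
  have hF : ∀ m : ℤ, ∃ F : 𝓢(V, ℂ), ∀ ξ, fourierHat V F ξ =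
      (dyadicCutoff ((2 : ℝ) ^ (-m) * ⟪y, ξ⟫) * Real.exp (-⟪y, ξ⟫) : ℝ) * fourierHat V f ξ := fun m =>
    exists_fourierHat_eq_mul hfs hf.1
      ((contDiff_dyadicCutoff.comp (contDiff_const.mul hsm)).mul (Real.contDiff_exp.comp hsm.neg))
  choose F hFhat using hF
  have hFn : ∀ m, ‖(F m).toLp p (volume : Measure V)‖ ≤
      C * 𝒞.det y ^ (-μ / s) * Q * (((2 : ℝ) ^ m) ^ κ * Real.exp (-((2 : ℝ) ^ m / 4))) := by
    intro m
    -- After `g` and the dilation, `(e|·)` becomes `2^(-m) (y|ξ)`; damping with `t = 2^m` restores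
    -- `exp(-(y|ξ))`.
    have h1 := hmain f A hf hA (g.trans (homothety V (hpow m)))
      (coneAut_trans hg (𝒞.homothety_mem _)) ((2 : ℝ) ^ m) (by positivity) (F m) fun ξ => by
        have h2 : ⟪𝒞.e, (g.trans (homothety V (hpow m))) ξ⟫ = (2 : ℝ) ^ (-m) * ⟪y, ξ⟫ := by
          rw [ContinuousLinearEquiv.trans_apply, homothety_apply, inner_smul_right, hin]
        have h3 : (2 : ℝ) ^ m * ((2 : ℝ) ^ (-m) * ⟪y, ξ⟫) = ⟪y, ξ⟫ := by
          rw [← mul_assoc, ← zpow_add₀ two_ne_zero, add_neg_cancel, zpow_zero, one_mul]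
        rw [hFhat, h2, h3]
    have h4 : (absDet (g.trans (homothety V (hpow m))) ^ (1 / 𝒞.traceConst)) ^ (-μ / s) =
        𝒞.det y ^ (-μ / s) * ((2 : ℝ) ^ m) ^ κ := by
      have hx : (0 : ℝ) < 2 ^ m := by positivity
      rw [absDet_trans, absDet_homothety, hdety,
        Real.mul_rpow (absDet_pos g).le (by positivity),
        Real.mul_rpow (Real.rpow_nonneg (absDet_pos g).le _) (by positivity), zpow_neg]
      congr 1
      rw [inv_pow, ← Real.rpow_natCast, ← Real.rpow_neg hx.le, ← Real.rpow_mul hx.le,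
        ← Real.rpow_mul hx.le]
      congr 1
      rw [hκ]
      ring
    rw [h4] at h1
    refine h1.trans (le_of_eq ?_)
    rw [hQ]
    ring
  -- On the compact spectrum of `f` the form `(y|·)` lies between two positive bounds, so finitely
  -- many scales suffice; their number does not enter the final constant.
  have hLsum : ∃ B : Finset ℤ, L = ∑ m ∈ B, F m := by
    have hc : Continuous fun ξ : V => ⟪y, ξ⟫ := hsm.continuous
    by_cases hne : (tsupport (fourierHat V f)).Nonempty
    · obtain ⟨ξ₁, hξ₁, hmin⟩ := hf.1.isCompact.exists_isMinOn hne hc.continuousOn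
      obtain ⟨ξ₂, hξ₂, hmax⟩ := hf.1.isCompact.exists_isMaxOn hne hc.continuousOn
      have hpos : 0 < ⟪y, ξ₁⟫ := by
        have h1 := hf.2 hξ₁
        rw [𝒞.mem_iff] at hy
        exact hy _ (subset_closure h1) fun h0 => 𝒞.zero_notMem (h0 ▸ h1)
      obtain ⟨B, hB⟩ := sum_dyadicCutoff (R := ⟪y, ξ₂⟫) hpos
      refine ⟨B, fourierHat_injective ?_⟩
      ext ξ
      rw [map_sum, sum_schwartz_apply, hL]
      simp only [hFhat]
      by_cases hξ : ξ ∈ tsupport (fourierHat V f)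
      · have h1 := hB ⟪y, ξ⟫ ⟨hmin hξ, hmax hξ⟩
        rw [← Finset.sum_mul, ← Complex.ofReal_sum, ← Finset.sum_mul, h1, one_mul]
      · simp [image_eq_zero_of_notMem_tsupport hξ]
    · refine ⟨∅, fourierHat_injective ?_⟩
      ext ξ
      have h0 : fourierHat V f ξ = 0 :=
        image_eq_zero_of_notMem_tsupport fun h => hne ⟨ξ, h⟩
      simp [hL, h0]
  obtain ⟨B, hB⟩ := hLsum
  have h5 : (fun x => 𝒞.fourierLaplace f x y) = L := funext fun x => 𝒞.fourierLaplace_eq hf hL x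
  have hd0 : 0 ≤ 𝒞.det y ^ (-μ / s) := Real.rpow_nonneg (𝒞.det_pos hy).le _
  rw [h5, eLpNorm_eq_ofReal_norm_toLp, ← ENNReal.ofReal_mul (by positivity)]
  refine ENNReal.ofReal_le_ofReal ?_
  rw [hB, toLp_sum]
  refine (norm_sum_le _ _).trans ((Finset.sum_le_sum fun m _ => hFn m).trans ?_)
  rw [← Finset.mul_sum]
  calc C * 𝒞.det y ^ (-μ / s) * Q * ∑ m ∈ B, ((2 : ℝ) ^ m) ^ κ * Real.exp (-((2 : ℝ) ^ m / 4))
      ≤ C * 𝒞.det y ^ (-μ / s) * Q * S := mul_le_mul_of_nonneg_left (hS B) (by positivity)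
    _ = _ := by ring

/-! ### From the Fourier–Laplace extension to the exponential weights -/

/-- The Schwartz core of the last implication. Spectra are only required to be comparable to `ξ j`,
so that approximants with spectrum slightly outside the balls are admitted. -/
theorem LaplaceEstimate.exists_norm_sum_le (hp : p ≠ ⊤) {s μ : ℝ} (hs : 1 ≤ s) (hμ : 0 < μ)
    (h : P.LaplaceEstimate p s μ) {M : ℝ} (hM : 0 < M) : ∃ δ : ℝ, 0 < δ ∧ ∃ C : ℝ, 0 < C ∧
      ∀ (A : Finset ℕ) (v : ℕ → 𝓢(V, ℂ)), (∀ j ∈ A, HasCompactSupport (fourierHat V (v j))) →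
      (∀ j ∈ A, tsupport (fourierHat V (v j)) ⊆ {ξ | 𝒞.Comparable M (P.ξ j) ξ}) →
      ‖∑ j ∈ A, (v j).toLp p‖ ≤ C * (∑ j ∈ A, 𝒞.det (P.ξ j) ^ (-μ) *
        Real.exp (δ * ⟪P.ξ j, 𝒞.e⟫) * ‖(v j).toLp p‖ ^ s) ^ (1 / s) := by
  classical
  have hs0 : 0 < s := by linarith
  obtain ⟨C₃, hC₃, hlap⟩ := h
  obtain ⟨C₁, κ, hC₁, hκ, hMB⟩ := P.exists_multiplierBound_exp (p := p) hp
  set M' := M * Real.exp 2 with hM'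
  have hM'0 : 0 < M' := by positivity
  obtain ⟨N, hN⟩ := P.exists_count hM'0
  obtain ⟨C₂, hC₂, hdet⟩ := 𝒞.exists_det_rpow_le hM'0.le hμ.le
  have hde : 0 ≤ 𝒞.det 𝒞.e ^ (-μ / s) := Real.rpow_nonneg (𝒞.det_pos 𝒞.e_mem).le _
  -- Overlapping pieces satisfy `(e|ξ k) ≤ M' (e|ξ j)`, which moves the exponential cost from `k` to
  -- `j`. The added one keeps `θ`, hence `δ = sθ`, positive when `κ = 0`.
  set θ := (κ + 1) * M' with hθ
  have hθ0 : 0 < θ := by positivity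
  refine ⟨s * θ, by positivity, C₃ * 𝒞.det 𝒞.e ^ (-μ / s) * (C₁ * N * C₂ ^ (1 / s)) + 1,
    by positivity, fun A v hvc hv => ?_⟩
  set W : V → ℂ := fun ξ => ∑ j ∈ A, fourierHat V (v j) ξ with hW
  have hWs : ContDiff ℝ ∞ W := ContDiff.sum fun j _ => (fourierHat V (v j)).smooth ⊤
  have hWsupp : tsupport W ⊆ ⋃ j ∈ A, tsupport (fourierHat V (v j)) := by
    have hcl : IsClosed (⋃ j ∈ A, tsupport (fourierHat V (v j))) :=
      A.finite_toSet.isClosed_biUnion fun j _ => isClosed_tsupport _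
    refine closure_minimal ?_ hcl
    intro ξ hξ
    obtain ⟨j, hj, hne⟩ := Finset.exists_ne_zero_of_sum_ne_zero hξ
    exact mem_biUnion hj (subset_tsupport _ hne)
  have hWc : HasCompactSupport W := by
    have hcp : IsCompact (⋃ j ∈ A, tsupport (fourierHat V (v j))) :=
      A.finite_toSet.isCompact_biUnion fun j hj => hvc j hj
    exact hcp.of_isClosed_subset (isClosed_tsupport _) hWsupp
  -- This growth exactly undoes the damping of the extension at `y = e`.
  obtain ⟨f, hf⟩ := exists_fourierHat_eq_mul hWs hWc (m := fun ξ => Real.exp ⟪𝒞.e, ξ⟫)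
    (Real.contDiff_exp.comp (contDiff_const.inner ℝ contDiff_id))
  have hfW : tsupport (fourierHat V f) ⊆ tsupport W := by
    refine closure_mono ?_
    intro ξ hξ h0
    exact hξ (by rw [hf, h0, mul_zero])
  have hft : 𝒞.IsTest f := by
    refine ⟨hWc.of_isClosed_subset (isClosed_tsupport _) hfW, fun ξ hξ => ?_⟩
    obtain ⟨j, hj, hξj⟩ := mem_iUnion₂.1 (hWsupp (hfW hξ))
    exact (hv j hj hξj).mem hM.le (P.ξ_mem j)
  obtain ⟨B, hB⟩ := P.exists_finset_test hft
  have h1 := hlap f hft 𝒞.e 𝒞.e_mem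
  have h2 : (fun x => 𝒞.fourierLaplace f x 𝒞.e) = (∑ j ∈ A, v j : 𝓢(V, ℂ)) :=
    funext fun x => 𝒞.fourierLaplace_eq hft (fun ξ => by
      rw [hf, ← mul_assoc, ← Complex.ofReal_mul, ← Real.exp_add, neg_add_cancel, Real.exp_zero,
        Complex.ofReal_one, one_mul, map_sum, sum_schwartz_apply]) x
  rw [h2, P.besovNorm_eq hs hB, eLpNorm_eq_ofReal_norm_toLp, ← ENNReal.ofReal_mul (by positivity)]
    at h1
  rw [ENNReal.ofReal_le_ofReal_iff (mul_nonneg (by positivity) (Real.rpow_nonneg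
    (Finset.sum_nonneg fun j _ => mul_nonneg (P.det_rpow_nonneg _ j)
      (Real.rpow_nonneg (norm_nonneg _) _)) _)), toLp_sum] at h1
  set r : ℕ → ℕ → Prop := fun j k => 𝒞.Comparable M' (P.ξ j) (P.ξ k) with hr
  have hU : ∀ k ∈ B, ‖(P.schwartzPiece f k).toLp p (volume : Measure V)‖ ≤ C₁ *
      ∑ j ∈ A.filter (r · k), Real.exp (θ * ⟪P.ξ j, 𝒞.e⟫) * ‖(v j).toLp p (volume : Measure V)‖ := by
    intro k _
    have h3 := (hMB k).norm_le_sum (by positivity) (S := A.filter (r · k)) (v := v)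
      (u := P.schwartzPiece f k) fun ξ => by
        rw [fourierHat_schwartzPiece, hf]
        by_cases hk : P.ψHat k ξ = 0
        · simp [hk]
        have h4 : W ξ = ∑ j ∈ A.filter (r · k), fourierHat V (v j) ξ := by
          rw [hW]
          refine (Finset.sum_filter_of_ne fun j hj hne => ?_).symm
          exact (hv j hj (subset_tsupport _ hne)).trans hM.le (Real.exp_pos 2).le
            (P.comparable_of_ψHat_ne_zero hk).symm
        rw [h4]
        push_cast
        ring
    refine h3.trans ?_
    rw [mul_assoc]
    refine mul_le_mul_of_nonneg_left ?_ hC₁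
    rw [Finset.mul_sum]
    refine Finset.sum_le_sum fun j hj => mul_le_mul_of_nonneg_right ?_ (norm_nonneg _)
    have h5 := ((Finset.mem_filter.1 hj).2 𝒞.e (subset_closure 𝒞.e_mem)).2
    have h6 := P.inner_e_nonneg j
    have h7 := P.inner_e_nonneg k
    rw [real_inner_comm] at h5
    rw [real_inner_comm] at h6
    refine Real.exp_le_exp.2 ?_
    calc κ * ⟪𝒞.e, P.ξ k⟫ ≤ (κ + 1) * (M' * ⟪P.ξ j, 𝒞.e⟫) := by
          exact mul_le_mul (by linarith) h5 h7 (by linarith)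
      _ = _ := by rw [hθ]; ring
  have hover := sum_rpow_le_of_overlap (A := A) (B := B) (r := r) (N := N) (s := s)
    (c := C₂) (D := C₁)
    (a := fun j => Real.exp (θ * ⟪P.ξ j, 𝒞.e⟫) * ‖(v j).toLp p (volume : Measure V)‖)
    (v := fun j => 𝒞.det (P.ξ j) ^ (-μ))
    (U := fun k => ‖(P.schwartzPiece f k).toLp p (volume : Measure V)‖)
    (w := fun k => 𝒞.det (P.ξ k) ^ (-μ)) hs hC₂.le hC₁
    (fun j => by positivity) (fun k => norm_nonneg _) (P.det_rpow_nonneg _)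
    (fun k _ => by
      obtain ⟨Q, hQ, hQ'⟩ := hN _ (P.ξ_mem k)
      exact (Finset.card_le_card fun j hj => (hQ' j).2 (Finset.mem_filter.1 hj).2.symm).trans hQ)
    (fun j _ => by
      obtain ⟨Q, hQ, hQ'⟩ := hN _ (P.ξ_mem j)
      exact (Finset.card_le_card fun k hk => (hQ' k).2 (Finset.mem_filter.1 hk).2).trans hQ)
    hU (P.det_rpow_nonneg _) (fun k _ j _ hjk => hdet _ (P.ξ_mem j) _ hjk)
  have h8 : ∑ j ∈ A, 𝒞.det (P.ξ j) ^ (-μ) *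
      (Real.exp (θ * ⟪P.ξ j, 𝒞.e⟫) * ‖(v j).toLp p (volume : Measure V)‖) ^ s =
      ∑ j ∈ A, 𝒞.det (P.ξ j) ^ (-μ) *
        Real.exp (s * θ * ⟪P.ξ j, 𝒞.e⟫) * ‖(v j).toLp p (volume : Measure V)‖ ^ s := by
    refine Finset.sum_congr rfl fun j _ => ?_
    rw [Real.mul_rpow (Real.exp_pos _).le (norm_nonneg _), ← Real.exp_mul, ← mul_assoc,
      show θ * ⟪P.ξ j, 𝒞.e⟫ * s = s * θ * ⟪P.ξ j, 𝒞.e⟫ by ring]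
  rw [h8] at hover
  have h9 := h1.trans (mul_le_mul_of_nonneg_left hover (by positivity))
  refine h9.trans ?_
  rw [← mul_assoc]
  refine mul_le_mul_of_nonneg_right (by linarith) (Real.rpow_nonneg (Finset.sum_nonneg fun j _ => ?_) _)
  have := P.det_rpow_nonneg (-μ) j
  positivity

/-- One cutoff around the points comparable to `e`, transported by every `g j`, gives Schwartz
approximants whose spectra are comparable to `ξ j` with one constant `M`. Both sides of the estimate
are continuous in the finitely many functions. -/
theorem LaplaceEstimate.expDecoupling (hp : p ≠ ⊤) {s μ : ℝ} (hs : 1 ≤ s) (hμ : 0 < μ)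
    (h : P.LaplaceEstimate p s μ) : P.ExpDecoupling p s μ := by
  have hs0 : 0 < s := by linarith
  obtain ⟨χ, hχ, hχc, hχΩ, hχ1⟩ := 𝒞.exists_cutoff (Real.exp_pos 2)
  obtain ⟨M, hM, hMχ⟩ := 𝒞.exists_comparable_of_isCompact hχc hχΩ
  obtain ⟨δ, hδ, C, hC, hmain⟩ := h.exists_norm_sum_le hp hs hμ (M := M) (by linarith)
  refine ⟨δ, hδ, C, hC, fun A f hf => ?_⟩
  set χj : ℕ → V → ℝ := fun j ξ => χ ((P.g j).symm ξ) with hχj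
  have hs1 : ∀ j, ContDiff ℝ ∞ (χj j) := fun j => hχ.comp (P.g j).symm.contDiff
  have hs2 : ∀ j, HasCompactSupport (χj j) := fun j =>
    hχc.comp_homeomorph (P.g j).symm.toHomeomorph
  have hs3 : ∀ j, tsupport (χj j) ⊆ {ξ | 𝒞.Comparable M (P.ξ j) ξ} := by
    intro j ξ hξ
    have h1 : (P.g j).symm ξ ∈ tsupport χ := by
      have : tsupport (χj j) ⊆ (P.g j).symm ⁻¹' tsupport χ :=
        closure_minimal (fun η hη => subset_tsupport χ hη)
          ((isClosed_tsupport χ).preimage (P.g j).symm.continuous)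
      exact this hξ
    have h2 := (hMχ _ h1).apply (P.g_mem j)
    rwa [P.g_e, (P.g j).apply_symm_apply] at h2
  have happ : ∀ j ∈ A, ∃ v : ℕ → 𝓢(V, ℂ), (∀ n, ∃ u : 𝓢(V, ℂ), ∀ ξ,
      fourierHat V (v n) ξ = χj j ξ * u ξ) ∧
      Filter.Tendsto (fun n => (v n).toLp p (volume : Measure V)) Filter.atTop (nhds (f j)) := by
    intro j hj
    refine exists_tendsto_of_fourierSupport_subset hp (f j) (hs1 j) (hs2 j) fun x hx => ?_
    have h1 := (𝒞.comparable_of_mem_ball (P.ξ_mem j) (hf j hj hx)).apply (coneAut_symm (P.g_mem j))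
    rw [← P.g_e, (P.g j).symm_apply_apply] at h1
    exact (P.g j).symm.continuous.continuousAt.eventually (hχ1 _ h1)
  choose! v hv hlim using happ
  have hsupp : ∀ j ∈ A, ∀ n, tsupport (fourierHat V (v j n)) ⊆ tsupport (χj j) := by
    intro j hj n
    obtain ⟨u, hu⟩ := hv j hj n
    refine closure_mono ?_
    intro ξ hξ h0
    exact hξ (by rw [hu, h0]; simp)
  have hn : ∀ n, ‖∑ j ∈ A, (v j n).toLp p (volume : Measure V)‖ ≤
      C * (∑ j ∈ A, 𝒞.det (P.ξ j) ^ (-μ) * Real.exp (δ * ⟪P.ξ j, 𝒞.e⟫) *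
        ‖(v j n).toLp p (volume : Measure V)‖ ^ s) ^ (1 / s) := fun n =>
    hmain A (fun j => v j n)
      (fun j hj => (hs2 j).of_isClosed_subset (isClosed_tsupport _) (hsupp j hj n))
      fun j hj => (hsupp j hj n).trans (hs3 j)
  refine le_of_tendsto_of_tendsto' (tendsto_finsetSum A hlim).norm ?_ hn
  refine Filter.Tendsto.const_mul _ (Filter.Tendsto.rpow_const ?_ (Or.inr (by positivity)))
  refine tendsto_finsetSum A fun j hj => Filter.Tendsto.const_mul _ ?_
  exact (hlim j hj).norm.rpow_const (Or.inr hs0.le)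

end LittlewoodPaley
end JordanCone
end ConeLP

end

/-! ### The equivalence -/

theorem mainTheorem7 {V : Type*} [NormedAddCommGroup V] [InnerProductSpace ℝ V]
    [FiniteDimensional ℝ V] [Nontrivial V] [MeasurableSpace V] [BorelSpace V]
    (𝒞 : ConeLP.JordanCone V) (P : 𝒞.LittlewoodPaley)
    (p : ℝ≥0∞) [Fact (1 ≤ p)] (hp : p ≠ ⊤) (s : ℝ) (hs : 1 ≤ s) (μ : ℝ) (hμ : 0 < μ) :
    List.TFAE [
      ∃ δ : ℝ, 0 < δ ∧ ∃ C : ℝ, 0 < C ∧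
        ∀ (A : Finset ℕ) (f : ℕ → Lp ℂ p (volume : Measure V)),
          (∀ j ∈ A, ConeLP.fourierSupport (f j) ⊆ 𝒞.ball 2 (P.ξ j)) →
          ‖∑ j ∈ A, f j‖ ≤
            C * (∑ j ∈ A, 𝒞.det (P.ξ j) ^ (-μ) * Real.exp (δ * ⟪P.ξ j, 𝒞.e⟫) * ‖f j‖ ^ s) ^ (1 / s),
      ∃ C : ℝ, 0 < C ∧
        ∀ (A : Finset ℕ) (f : ℕ → Lp ℂ p (volume : Measure V)),
          (∀ j ∈ A, ConeLP.fourierSupport (f j) ⊆ 𝒞.ball 2 (P.ξ j) ∩ 𝒞.band) →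
          ‖∑ j ∈ A, f j‖ ≤ C * (∑ j ∈ A, 𝒞.det (P.ξ j) ^ (-μ) * ‖f j‖ ^ s) ^ (1 / s),
      ∃ C : ℝ, 0 < C ∧
        ∀ f : 𝓢(V, ℂ), 𝒞.IsTest f → ∀ y ∈ 𝒞.Ω,
          eLpNorm (fun x => 𝒞.fourierLaplace f x y) p volume ≤
            ENNReal.ofReal (C * 𝒞.det y ^ (-μ / s)) * P.besovNorm p s μ f] := by
  tfae_have 1 → 2 := fun h => ConeLP.JordanCone.LittlewoodPaley.ExpDecoupling.bandDecoupling hp hs h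
  tfae_have 2 → 3 := fun h =>
    ConeLP.JordanCone.LittlewoodPaley.BandDecoupling.laplaceEstimate hp hs hμ h
  tfae_have 3 → 1 := fun h =>
    ConeLP.JordanCone.LittlewoodPaley.LaplaceEstimate.expDecoupling hp hs hμ h
  tfae_finish
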